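/- Let $\mathcal K$ be a minor-closed family of finite graphs (if $G\in\mathcal K$ and $H$ is a minor of $G$, i.e. $H$ can be obtained from $G$ by deleting vertices, deleting edges and contracting edges, then $H\in\mathcal K$; in particular $\mathcal K$ is closed under isomorphism) that is nontrivial, i.e. omits at least one finite graph. An instance of uniform uncapacitated facility location on $\mathcal K$ consists of a graph $G\in\mathcal K$ with a nonnegative rational weight on each edge, a set $C\subseteq V(G)$ of clients, and a rational facility opening cost $f\ge 0$; the cost of a set $S\subseteq V(G)$ is $$\mathrm{cost}(S)=f\,|S|+\sum_{c\in C}\min_{u\in S}\mathrm{dist}(c,u),$$ where $\mathrm{dist}$ is the shortest-path distance in $G$ with respect to the edge weights ($\infty$ between different components) and the minimum over the empty set is $\infty$. Then there is a polynomial-time approximation scheme for this problem: there is an algorithm which, given a rational $\varepsilon>0$ and such an instance, returns a set $S\subseteq V(G)$ with $$\mathrm{cost}(S)\le(1+\varepsilon)\min_{S'\subseteq V(G)}\mathrm{cost}(S'),$$ and which, for every fixed $\varepsilon$, runs in time bounded by a polynomial (depending on $\mathcal K$ and $\varepsilon$) in the number of bits of the input. Here time is the number of steps of a random access machine whose unit-cost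 operations are setting constants, addition, truncated subtraction, halving, reading and writing memory with indirect addressing, and tests for zero; the graph is given by its adjacency matrix, with weights as fractions in binary. -/

import Mathlib

open scoped NNReal ENNReal

namespace UFL

/-! ### Graph minors -/

/-- `H` is a minor of `G`: the vertices of `H` can be assigned pairwise disjoint, connected
(in particular nonempty) branch sets in `G` such that adjacent vertices of `H` have branch sets
joined by an edge of `G`.  For finite graphs this says that `H` arises from `G` by deleting vertices
and edges and contracting edges. -/
def IsMinor {V W : Type*} (H : SimpleGraph V) (G : SimpleGraph W) : Prop :=
  ∃ B : V → Set W,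
    (∀ v, (G.induce (B v)).Connected) ∧
    (∀ u v, u ≠ v → Disjoint (B u) (B v)) ∧
    (∀ u v, H.Adj u v → ∃ x ∈ B u, ∃ y ∈ B v, G.Adj x y)

/-- A family of finite graphs; every finite graph is isomorphic to one on some `Fin n`. -/
abbrev GraphFamily : Type := (n : ℕ) → Set (SimpleGraph (Fin n))

/-- The family contains every minor of each of its members (hence is closed under isomorphism). -/
def GraphFamily.MinorClosed (K : GraphFamily) : Prop :=
  ∀ (n m : ℕ) (G : SimpleGraph (Fin n)) (H : SimpleGraph (Fin m)),
    G ∈ K n → IsMinor H G → H ∈ K m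

/-- The family omits at least one finite graph. -/
def GraphFamily.Nontrivial (K : GraphFamily) : Prop :=
  ∃ (n : ℕ) (H : SimpleGraph (Fin n)), H ∉ K n

/-! ### Uniform uncapacitated facility location in edge-weighted graphs -/

/-- An instance: an edge-weighted graph, a set of clients and a facility opening cost.
Only the values of `weight` on edges of `graph` matter. -/
structure Instance where
  n : ℕ
  graph : SimpleGraph (Fin n)
  weight : Sym2 (Fin n) → ℚ≥0
  clients : Finset (Fin n)
  openCost : ℚ≥0

namespace Instance

/-- The length of a walk: the sum of the weights of its edges. -/
def walkLength (I : Instance) {u v : Fin I.n} (p : I.graph.Walk u v) : ℚ≥0 :=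
  (p.edges.map I.weight).sum

/-- The shortest-path distance, which is `⊤` for vertices in different components. -/
noncomputable def dist (I : Instance) (u v : Fin I.n) : ℝ≥0∞ :=
  ⨅ p : I.graph.Walk u v, ((I.walkLength p : ℝ≥0) : ℝ≥0∞)

/-- `cost(S) = f |S| + ∑_{c ∈ C} min_{u ∈ S} dist(c, u)`, where the minimum over the empty set
is `⊤`. -/
noncomputable def cost (I : Instance) (S : Finset (Fin I.n)) : ℝ≥0∞ :=
  ((I.openCost : ℝ≥0) : ℝ≥0∞) * (S.card : ℝ≥0∞) + ∑ c ∈ I.clients, ⨅ u ∈ S, I.dist c u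

open Classical in
/-- The instance as a sequence of natural numbers: the number of vertices, the opening cost as a
reduced fraction, the characteristic vector of the clients, and, row by row, the adjacency matrix.
Its entry at `(u, v)` consists of three numbers: `1` and the numerator and denominator of the weight
if `uv` is an edge, and `0, 0, 0` otherwise. -/
noncomputable def encode (I : Instance) : List ℕ :=
  [I.n, I.openCost.num, I.openCost.den] ++
  ((List.finRange I.n).map fun v => if v ∈ I.clients then 1 else 0) ++
  ((List.finRange I.n).flatMap fun u => (List.finRange I.n).flatMap fun v =>
    if I.graph.Adj u v then [1, (I.weight s(u, v)).num, (I.weight s(u, v)).den] else [0, 0, 0])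

end Instance

/-- The size in bits of a sequence of natural numbers written in binary, with one extra symbol
per number as a separator. -/
def bitSize (l : List ℕ) : ℕ := (l.map fun x => Nat.size x + 1).sum

/-! ### Random access machines

Programs of a random access machine with unit cost.  One step sets a register to a fixed constant,
adds, subtracts or halves numbers, copies one memory cell, or tests a register; there is no
multiplication, so the largest number present at most doubles in a step (or becomes a fixed
constant).  Therefore `t` steps can be simulated by a Turing machine in time polynomial in `t` and
the bit size of the input, and conversely: polynomial time on this machine is the usual polynomial
time. -/

/-- The machine has scalar registers and a memory that is addressed by the content of registers. -/
structure State where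
  reg : ℕ → ℕ
  mem : ℕ → ℕ

/-- Write `a` into register `x`. -/
def State.setReg (s : State) (x a : ℕ) : State := { s with reg := Function.update s.reg x a }

/-- Write `a` into memory cell `i`. -/
def State.setMem (s : State) (i a : ℕ) : State := { s with mem := Function.update s.mem i a }

/-- Programs.  The numbers in the constructors are names of registers, except that the second
argument of `const` is a literal. -/
inductive Prog : Type
  /-- Do nothing. -/
  | skip : Prog
  /-- `x := k`, with a fixed number `k`. -/
  | const (x k : ℕ) : Prog
  /-- `x := y + z`. -/
  | add (x y z : ℕ) : Prog
  /-- `x := max (y - z) 0`. -/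
  | sub (x y z : ℕ) : Prog
  /-- `x := ⌊y / 2⌋`. -/
  | half (x y : ℕ) : Prog
  /-- `x := mem[y]`. -/
  | load (x y : ℕ) : Prog
  /-- `mem[x] := y`. -/
  | store (x y : ℕ) : Prog
  /-- First `P`, then `Q`. -/
  | seq (P Q : Prog) : Prog
  /-- `P` if `x ≠ 0`, and `Q` otherwise. -/
  | ite (x : ℕ) (P Q : Prog) : Prog
  /-- Repeat `P` as long as `x ≠ 0`. -/
  | loop (x : ℕ) (P : Prog) : Prog

/-- `Exec P s t s'`: started in state `s`, the program `P` halts in state `s'` after exactly `t`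
steps.  Every elementary instruction and every test takes one step. -/
inductive Exec : Prog → State → ℕ → State → Prop
  | skip (s : State) : Exec Prog.skip s 1 s
  | const (x k : ℕ) (s : State) : Exec (Prog.const x k) s 1 (s.setReg x k)
  | add (x y z : ℕ) (s : State) : Exec (Prog.add x y z) s 1 (s.setReg x (s.reg y + s.reg z))
  | sub (x y z : ℕ) (s : State) : Exec (Prog.sub x y z) s 1 (s.setReg x (s.reg y - s.reg z))
  | half (x y : ℕ) (s : State) : Exec (Prog.half x y) s 1 (s.setReg x (s.reg y / 2))
  | load (x y : ℕ) (s : State) : Exec (Prog.load x y) s 1 (s.setReg x (s.mem (s.reg y)))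
  | store (x y : ℕ) (s : State) : Exec (Prog.store x y) s 1 (s.setMem (s.reg x) (s.reg y))
  | seq {P Q : Prog} {s₁ s₂ s₃ : State} {t₁ t₂ : ℕ} (hP : Exec P s₁ t₁ s₂)
      (hQ : Exec Q s₂ t₂ s₃) : Exec (Prog.seq P Q) s₁ (t₁ + t₂) s₃
  | iteTrue {x : ℕ} {P Q : Prog} {s s' : State} {t : ℕ} (hx : s.reg x ≠ 0)
      (hP : Exec P s t s') : Exec (Prog.ite x P Q) s (1 + t) s'
  | iteFalse {x : ℕ} {P Q : Prog} {s s' : State} {t : ℕ} (hx : s.reg x = 0)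
      (hQ : Exec Q s t s') : Exec (Prog.ite x P Q) s (1 + t) s'
  | loopDone {x : ℕ} {P : Prog} {s : State} (hx : s.reg x = 0) : Exec (Prog.loop x P) s 1 s
  | loopStep {x : ℕ} {P : Prog} {s₁ s₂ s₃ : State} {t₁ t₂ : ℕ} (hx : s₁.reg x ≠ 0)
      (hP : Exec P s₁ t₁ s₂) (hL : Exec (Prog.loop x P) s₂ t₂ s₃) :
      Exec (Prog.loop x P) s₁ (1 + t₁ + t₂) s₃

/-- The initial state: the input is in the first memory cells, all else is `0`. -/
def initState (l : List ℕ) : State where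
  reg := fun _ => 0
  mem := fun i => l.getD i 0

/-- The output, a set of vertices given by its characteristic vector in the first `n` memory
cells. -/
def State.output (s : State) (n : ℕ) : Finset (Fin n) :=
  Finset.univ.filter fun v => s.mem v ≠ 0

/-! ### Polynomial-time approximation schemes -/

/-- The input for error parameter `ε`: numerator and denominator of `ε`, then the instance. -/
noncomputable def input (ε : ℚ≥0) (I : Instance) : List ℕ := ε.num :: ε.den :: I.encode

/-- The program `P` is a polynomial-time approximation scheme for uniform uncapacitated facility
location in the graphs of `K`: for every fixed `ε > 0` it runs in time polynomial in the bit size of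
the input, and the cost of the set that it returns is at most `1 + ε` times the minimum. -/
def IsPTAS (K : GraphFamily) (P : Prog) : Prop :=
  ∀ ε : ℚ≥0, 0 < ε → ∃ T : Polynomial ℕ, ∀ I : Instance, I.graph ∈ K I.n →
    ∃ (t : ℕ) (s : State),
      Exec P (initState (input ε I)) t s ∧
      t ≤ T.eval (bitSize (input ε I)) ∧
      ∀ S : Finset (Fin I.n),
        I.cost (s.output I.n) ≤ (1 + ((ε : ℝ≥0) : ℝ≥0∞)) * I.cost S

end UFL

/-! The algorithm is local search. It starts with all vertices open, and each round moves to the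
best solution that differs from the current one in at most `(c * q) ^ 2` vertices. Here `q` is the
denominator of `ε`, so that `1 / q ≤ ε`, and `c = 384 * (h + 1) ^ 2`, where some graph on `h`
vertices is missing from the family. Since every graph on `h` vertices is a subgraph of the complete
one, no graph of the family has a clique minor on `h` vertices, and this is all that is used about
the family.

Let `L` be the current solution and `O` any other. Assign every vertex to a nearest point of `L ∪
O`, breaking ties so that the cells are connected. Contracting the cells gives a graph on `L ∪ O`
that again has no such clique minor (`exists_isVoronoi`, `HasCliqueMinor.of_contraction`). A
separator theorem, applied recursively, covers the vertices and edges of this graph by regions of at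
most `(c * q) ^ 2` vertices whose sizes add up to at most `1 + 1 / (24 q)` times `|L ∪ O|`
(`exists_separator`, `exists_division`).

For each region take the solution `mixed`: `O` in the interior, `L` outside, and all boundary points
of the region. A walk from a client that crosses the boundary passes through the cell of an open
facility, which is at least as near as the end of the walk. So clients with their cell in the region
are served as well as by `O`, and clients whose cell is not interior are served as well as by `L`
(`setDist_mixed_le_right`, `setDist_mixed_le_left`). Summing over the `k` regions, the costs of the
mixed solutions plus the cost of `L` are at most `k cost(L) + cost(O)`, up to an error `(cost(L) +
cost(O)) / (8 q)` that pays for the boundaries (`exists_swaps`).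

Hence a round shrinks the excess `(8 q - 1) cost(L) - (8 q + 1) cost(O)` by a factor `1 - 1 / (2 K)`
with `K = 2 n + 1`. Polynomially many rounds bring it below `1`; costs being scaled to integers, it
is then at most `0`. No exact local optimum is needed (`exists_progress`, `converges`).

On the machine, all loops of the local search are capped by a common bound, the fuel. The predicate
`Comp` is closed under such loops, so running times polynomial in the fuel come for free, and
correctness amounts to showing that the cap is never reached too early. Solutions and distance
tables are packed into single integers, so the input stays in memory unchanged until the output is
written. The fuel is a power of a polynomial in the input size with an exponent that depends on `c`
and `q` only. -/

namespace UFL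

set_option linter.unusedSectionVars false

/-! ### Connected vertex sets and clique minors. -/

section Connectivity

variable {V : Type*} [DecidableEq V] (G : SimpleGraph V)

/-- `b` can be reached from `a` along edges with both ends in `s`. -/
def LinkedIn (s : Finset V) : V → V → Prop :=
  Relation.ReflTransGen fun x y => G.Adj x y ∧ x ∈ s ∧ y ∈ s

/-- The nonempty finite set `s` induces a connected subgraph. -/
def Conn (s : Finset V) : Prop :=
  s.Nonempty ∧ ∀ a ∈ s, ∀ b ∈ s, LinkedIn G s a b

variable {G}

theorem LinkedIn.symm {s : Finset V} {a b : V} (h : LinkedIn G s a b) : LinkedIn G s b a := by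
  induction h with
  | refl => exact Relation.ReflTransGen.refl
  | tail _ hbc ih => exact Relation.ReflTransGen.head ⟨hbc.1.symm, hbc.2.2, hbc.2.1⟩ ih

theorem LinkedIn.mono {s t : Finset V} (hst : s ⊆ t) {a b : V} (h : LinkedIn G s a b) :
    LinkedIn G t a b := by
  induction h with
  | refl => exact Relation.ReflTransGen.refl
  | tail _ hbc ih => exact ih.tail ⟨hbc.1, hst hbc.2.1, hst hbc.2.2⟩

theorem Conn.of_root {s : Finset V} {r : V} (hr : r ∈ s) (h : ∀ b ∈ s, LinkedIn G s r b) :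
    Conn G s :=
  ⟨⟨r, hr⟩, fun a ha b hb => (h a ha).symm.trans (h b hb)⟩

theorem Conn.singleton (a : V) : Conn G {a} :=
  Conn.of_root (Finset.mem_singleton_self a) fun b hb => by
    rw [Finset.mem_singleton.1 hb]; exact Relation.ReflTransGen.refl

/-- The form in which connectedness is used later: what passes along the edges inside the set
spreads from one vertex to all of it. -/
theorem Conn.induct {s : Finset V} (h : Conn G s) {P : V → Prop} {a : V} (ha : a ∈ s) (hP : P a)
    (hstep : ∀ x ∈ s, ∀ y ∈ s, G.Adj x y → P x → P y) : ∀ b ∈ s, P b := by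
  intro b hb
  have hab := h.2 a ha b hb
  clear hb
  induction hab with
  | refl => exact hP
  | tail _ hbc ih => exact hstep _ hbc.2.1 _ hbc.2.2 hbc.1 ih

theorem Conn.union {s t : Finset V} (hs : Conn G s) (ht : Conn G t)
    (h : ∃ x ∈ s, ∃ y ∈ t, G.Adj x y) : Conn G (s ∪ t) := by
  obtain ⟨x, hx, y, hy, hxy⟩ := h
  refine Conn.of_root (Finset.mem_union_left t hx) fun b hb => ?_
  rcases Finset.mem_union.1 hb with hb | hb
  · exact (hs.2 x hx b hb).mono Finset.subset_union_left
  · refine Relation.ReflTransGen.head ⟨hxy, Finset.mem_union_left t hx, Finset.mem_union_right s hy⟩ ?_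
    exact (ht.2 y hy b hb).mono Finset.subset_union_right

open Classical in
variable (G) in
/-- The component of `a` in the subgraph induced by `s`. -/
noncomputable def compIn (s : Finset V) (a : V) : Finset V :=
  s.filter (LinkedIn G s a)

theorem compIn_subset (s : Finset V) (a : V) : compIn G s a ⊆ s := by
  classical exact Finset.filter_subset _ _

theorem mem_compIn_self {s : Finset V} {a : V} (ha : a ∈ s) : a ∈ compIn G s a := by
  classical exact Finset.mem_filter.2 ⟨ha, Relation.ReflTransGen.refl⟩

theorem mem_compIn_of_adj {s : Finset V} {a x y : V} (hx : x ∈ compIn G s a) (hy : y ∈ s)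
    (h : G.Adj x y) : y ∈ compIn G s a := by
  classical
  have hx' := Finset.mem_filter.1 hx
  exact Finset.mem_filter.2 ⟨hy, hx'.2.tail ⟨h, hx'.1, hy⟩⟩

theorem conn_compIn {s : Finset V} {a : V} (ha : a ∈ s) : Conn G (compIn G s a) := by
  classical
  refine Conn.of_root (mem_compIn_self ha) fun b hb => ?_
  have hb' := (Finset.mem_filter.1 hb).2
  clear hb
  induction hb' with
  | refl => exact Relation.ReflTransGen.refl
  | @tail c d hac hcd ih =>
    have hc : c ∈ compIn G s a := Finset.mem_filter.2 ⟨hcd.2.1, hac⟩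
    exact ih.tail ⟨hcd.1, hc, mem_compIn_of_adj hc hcd.2.2 hcd.1⟩

theorem Conn.subset_compIn {s t : Finset V} (ht : Conn G t) (hts : t ⊆ s) {a : V} (ha : a ∈ t) :
    t ⊆ compIn G s a := by
  classical
  intro b hb
  exact Finset.mem_filter.2 ⟨hts hb, (ht.2 a ha b hb).mono hts⟩

theorem Conn.induce_connected {s : Finset V} (h : Conn G s) : (G.induce (s : Set V)).Connected := by
  obtain ⟨a, ha⟩ := h.1
  have key : ∀ b ∈ s, ∃ hb : b ∈ s, (G.induce (s : Set V)).Reachable ⟨a, ha⟩ ⟨b, hb⟩ := by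
    refine h.induct ha ⟨ha, SimpleGraph.Reachable.refl _⟩ ?_
    rintro x hx y hy hxy ⟨_, hr⟩
    refine ⟨hy, hr.trans (SimpleGraph.Adj.reachable ?_)⟩
    simpa using hxy
  have : Nonempty (s : Set V) := ⟨⟨a, ha⟩⟩
  refine ⟨fun u v => ?_⟩
  obtain ⟨_, hu⟩ := key u.1 u.2
  obtain ⟨_, hv⟩ := key v.1 v.2
  exact hu.symm.trans hv

variable (G) in
/-- The complete graph on `h` vertices is a minor of `G[W]`. -/
def HasCliqueMinor (W : Finset V) (h : ℕ) : Prop :=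
  ∃ C : ℕ → Finset V, (∀ i < h, C i ⊆ W ∧ Conn G (C i)) ∧
    ∀ i < h, ∀ j < h, i ≠ j → Disjoint (C i) (C j) ∧ ∃ x ∈ C i, ∃ y ∈ C j, G.Adj x y

theorem HasCliqueMinor.mono {W W' : Finset V} {h : ℕ} (H : HasCliqueMinor G W h) (hW : W ⊆ W') :
    HasCliqueMinor G W' h := by
  obtain ⟨C, h1, h2⟩ := H
  exact ⟨C, fun i hi => ⟨(h1 i hi).1.trans hW, (h1 i hi).2⟩, h2⟩

/-- A connected set that meets all sets `A j`, or a small set that separates them. -/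
theorem steiner_or_separate (D : Finset V) (A : ℕ → Finset V) (k r : ℕ) (hr : 1 ≤ r) :
    (∃ T ⊆ D, Conn G T ∧ T.card ≤ r ∧ ∀ j < k, ∃ x ∈ T, x ∈ A j) ∨
    ∃ Z ⊆ D, Z.card * r ≤ k * D.card ∧
      ∀ Q ⊆ D \ Z, Conn G Q → ∃ j < k, ∀ x ∈ Q, x ∉ A j := by
  classical
  by_contra! hcon
  obtain ⟨hT, hZ⟩ := hcon
  -- The least `t` with `P i t v` behaves like a distance: it grows by at most one along an edge of
  -- `D`.
  let P : ℕ → ℕ → V → Prop := fun i t v =>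
    ∃ T ⊆ D, Conn G T ∧ v ∈ T ∧ T.card ≤ t ∧ ∀ j < i, ∃ x ∈ T, x ∈ A j
  have hmono : ∀ i s t v, s ≤ t → P i s v → P i t v := by
    rintro i s t v hst ⟨T, h1, h2, h3, h4, h5⟩
    exact ⟨T, h1, h2, h3, h4.trans hst, h5⟩
  -- Vertices for which this least size is exactly `t + 2`. For fixed `i` these levels are disjoint,
  -- so by averaging one of the `r` unions `Z t` is small.
  let z : ℕ → ℕ → Finset V := fun i t => D.filter fun v => P (i + 1) (t + 2) v ∧ ¬ P (i + 1) (t + 1) v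
  let Z : ℕ → Finset V := fun t => (Finset.range k).biUnion fun i => z i t
  have hsum : ∑ t ∈ Finset.range r, (Z t).card ≤ k * D.card := by
    calc ∑ t ∈ Finset.range r, (Z t).card
        ≤ ∑ t ∈ Finset.range r, ∑ i ∈ Finset.range k, (z i t).card :=
          Finset.sum_le_sum fun t _ => Finset.card_biUnion_le
      _ = ∑ i ∈ Finset.range k, ∑ t ∈ Finset.range r, (z i t).card := Finset.sum_comm
      _ ≤ ∑ i ∈ Finset.range k, D.card := by
          refine Finset.sum_le_sum fun i _ => ?_
          rw [← Finset.card_biUnion]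
          · refine Finset.card_le_card fun v hv => ?_
            obtain ⟨t, _, hv⟩ := Finset.mem_biUnion.1 hv
            exact (Finset.mem_filter.1 hv).1
          · intro s _ t _ hst
            refine Finset.disjoint_left.2 ?_
            intro v hvs hvt
            have h1 := (Finset.mem_filter.1 hvs).2
            have h2 := (Finset.mem_filter.1 hvt).2
            rcases lt_or_gt_of_ne hst with h | h
            · exact h2.2 (hmono _ _ _ _ (by omega) h1.1)
            · exact h1.2 (hmono _ _ _ _ (by omega) h2.1)
      _ = k * D.card := by simp
  obtain ⟨t, ht, hcard⟩ : ∃ t ∈ Finset.range r, (Z t).card * r ≤ k * D.card := by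
    by_contra! h
    have h1 : ∑ t ∈ Finset.range r, k * D.card < ∑ t ∈ Finset.range r, (Z t).card * r :=
      Finset.sum_lt_sum_of_nonempty ⟨0, Finset.mem_range.2 hr⟩ h
    rw [Finset.sum_const, Finset.card_range, smul_eq_mul, mul_comm, ← Finset.sum_mul] at h1
    exact absurd (Nat.mul_le_mul_right r hsum) (not_le.2 h1)
  have htr : t + 1 ≤ r := Finset.mem_range.1 ht
  obtain ⟨Q, hQ, hQc, hmeet⟩ := hZ (Z t)
    (fun v hv => by
      obtain ⟨i, _, hv⟩ := Finset.mem_biUnion.1 hv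
      exact (Finset.mem_filter.1 hv).1) hcard
  -- A connected set that avoids a level cannot cross it. A vertex of `Q` in `A i` gets from `i` to
  -- `i + 1` at no cost, and from there the bound `t + 1` spreads through `Q`.
  have key : ∀ i ≤ k, ∀ v ∈ Q, P i (t + 1) v := by
    intro i
    induction i with
    | zero =>
      intro _ v hv
      exact ⟨{v}, by simpa using (Finset.mem_sdiff.1 (hQ hv)).1, Conn.singleton v, by simp, by simp,
        by simp⟩
    | succ i ih =>
      intro hi
      obtain ⟨a, haQ, haA⟩ := hmeet i hi
      refine hQc.induct haQ ?_ ?_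
      · obtain ⟨T, h1, h2, h3, h4, h5⟩ := ih (by omega) a haQ
        refine ⟨T, h1, h2, h3, h4, fun j hj => ?_⟩
        rcases Nat.lt_succ_iff_lt_or_eq.1 hj with hj | rfl
        · exact h5 j hj
        · exact ⟨a, h3, haA⟩
      · rintro x hx y hy hxy ⟨T, h1, h2, h3, h4, h5⟩
        by_contra hny
        have hyD := Finset.mem_sdiff.1 (hQ hy)
        refine hyD.2 (Finset.mem_biUnion.2 ⟨i, by simpa using hi,
          Finset.mem_filter.2 ⟨hyD.1, ⟨T ∪ {y}, ?_, ?_, ?_, ?_, ?_⟩, hny⟩⟩)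
        · exact Finset.union_subset h1 (by simpa using hyD.1)
        · exact h2.union (Conn.singleton y) ⟨x, h3, y, by simp, hxy⟩
        · simp
        · have := Finset.card_union_le T {y}
          simp only [Finset.card_singleton] at this
          omega
        · intro j hj
          obtain ⟨w, hw, hwA⟩ := h5 j hj
          exact ⟨w, Finset.mem_union_left _ hw, hwA⟩
  obtain ⟨v, hv⟩ := hQc.1
  obtain ⟨T, h1, h2, h3, h4, h5⟩ := key k le_rfl v hv
  obtain ⟨j, hj, hj'⟩ := hT T h1 h2 (by omega)
  obtain ⟨x, hx, hxA⟩ := h5 j hj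
  exact hj' x hx hxA

end Connectivity

set_option linter.unusedSectionVars false

/-! ### Balanced separators in graphs without a fixed clique minor. -/

section Separator

variable {V : Type*} [DecidableEq V] {G : SimpleGraph V}

/-- A large connected set `D` of `W` together with disjoint connected sets `C j`, `j ∈ J`, that are
pairwise adjacent and contain all neighbours of `D`, at most `m` each. -/
structure Haven (G : SimpleGraph V) (W : Finset V) (m : ℕ) (D : Finset V) (J : Finset ℕ)
    (C : ℕ → Finset V) : Prop where
  subset : D ⊆ W
  conn : Conn G D
  large : W.card < 2 * D.card
  bag_subset : ∀ j ∈ J, C j ⊆ W \ D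
  bag_conn : ∀ j ∈ J, Conn G (C j)
  disj : ∀ i ∈ J, ∀ j ∈ J, i ≠ j → Disjoint (C i) (C j)
  touch : ∀ i ∈ J, ∀ j ∈ J, i ≠ j → ∃ x ∈ C i, ∃ y ∈ C j, G.Adj x y
  nbr : ∀ x ∈ D, ∀ y ∈ W \ D, G.Adj x y → ∃ j ∈ J, y ∈ C j
  small : ∀ j ∈ J, ∀ S ⊆ C j, (∀ y ∈ S, ∃ x ∈ D, G.Adj x y) → S.card ≤ m

/-- Every small set leaves a connected component with more than half of the vertices of `W`. -/
def Unseparable (G : SimpleGraph V) (W : Finset V) (b : ℕ) : Prop :=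
  ∀ X ⊆ W, X.card ≤ b → ∃ D ⊆ W \ X, Conn G D ∧ W.card < 2 * D.card ∧
    ∀ x ∈ D, ∀ y ∈ W \ X, G.Adj x y → y ∈ D

theorem inter_of_large {W D E : Finset V} (hD : D ⊆ W) (hE : E ⊆ W) (h1 : W.card < 2 * D.card)
    (h2 : W.card < 2 * E.card) : ∃ x ∈ D, x ∈ E := by
  by_contra! h
  have h3 : (D ∪ E).card = D.card + E.card :=
    Finset.card_union_of_disjoint (Finset.disjoint_left.2 h)
  have h4 := Finset.card_le_card (Finset.union_subset hD hE)
  omega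

/-- A large connected set that avoids all neighbours of `D` lies in `D`. -/
theorem Haven.subset_of_avoid {W D E : Finset V} {m : ℕ} {J : Finset ℕ} {C : ℕ → Finset V}
    (H : Haven G W m D J C) (hE : E ⊆ W) (hEc : Conn G E) (hEl : W.card < 2 * E.card)
    (hav : ∀ y ∈ E, y ∉ D → ∀ x ∈ D, ¬ G.Adj x y) : E ⊆ D := by
  obtain ⟨a, haD, haE⟩ := inter_of_large H.subset hE H.large hEl
  refine hEc.induct haE haD fun x _ y hy hxy hx => ?_
  by_contra hyD
  exact hav y hy hyD x hx hxy

/-- The neighbours of `D` number at most `m` per bag. Together with `m` further vertices they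
respect the budget `(h + 1) * m` of `Unseparable`. -/
theorem Haven.exists_boundary {W D : Finset V} {m h : ℕ} {J : Finset ℕ} {C : ℕ → Finset V}
    (H : Haven G W m D J C) (hJ : J ⊆ Finset.range h) :
    ∃ N ⊆ W \ D, N.card ≤ h * m ∧ (∀ x ∈ D, ∀ y ∈ W \ D, G.Adj x y → y ∈ N) := by
  classical
  refine ⟨J.biUnion fun j => (C j).filter fun y => ∃ x ∈ D, G.Adj x y, ?_, ?_, ?_⟩
  · intro y hy
    obtain ⟨j, hj, hy⟩ := Finset.mem_biUnion.1 hy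
    exact H.bag_subset j hj (Finset.mem_filter.1 hy).1
  · refine Finset.card_biUnion_le.trans ?_
    calc _ ≤ ∑ j ∈ J, m := Finset.sum_le_sum fun j hj =>
            H.small j hj _ (Finset.filter_subset _ _) fun y hy => (Finset.mem_filter.1 hy).2
      _ ≤ h * m := by
        rw [Finset.sum_const, smul_eq_mul]
        exact Nat.mul_le_mul_right _ (by simpa using Finset.card_le_card hJ)
  · intro x hx y hy hxy
    obtain ⟨j, hj, hyj⟩ := H.nbr x hx y hy hxy
    exact Finset.mem_biUnion.2 ⟨j, hj, Finset.mem_filter.2 ⟨hyj, x, hx, hxy⟩⟩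

/-- Add a connected subset of `D` that touches all bags as a new bag. -/
theorem Haven.add {W D T : Finset V} {m h : ℕ} {J : Finset ℕ} {C : ℕ → Finset V}
    (H : Haven G W m D J C) (hJ : J ⊆ Finset.range h) (hU : Unseparable G W ((h + 1) * m))
    (hTD : T ⊆ D) (hT : Conn G T) (hTm : T.card ≤ m)
    (hmeet : ∀ j ∈ J, ∃ x ∈ T, ∃ y ∈ C j, G.Adj x y) {j₀ : ℕ} (hj₀ : j₀ ∉ J) :
    ∃ E C', Haven G W m E (insert j₀ J) C' ∧ E.card < D.card := by
  obtain ⟨N, hN, hNc, hNb⟩ := H.exists_boundary hJ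
  -- The large component left after deleting the boundary of `D` meets `D`, since both contain more
  -- than half of `W`, and cannot leave it.
  obtain ⟨E, hE, hEc, hEl, hEcl⟩ := hU (N ∪ T)
    (Finset.union_subset (hN.trans Finset.sdiff_subset) (hTD.trans H.subset)) (by
      have := Finset.card_union_le N T
      nlinarith)
  have hEW : E ⊆ W := hE.trans Finset.sdiff_subset
  have hEN : ∀ y ∈ E, y ∉ N ∧ y ∉ T := fun y hy => by
    simpa using (Finset.mem_sdiff.1 (hE hy)).2
  have hED : E ⊆ D := H.subset_of_avoid hEW hEc hEl fun y hy hyD x hx hxy =>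
    (hEN y hy).1 (hNb x hx y (Finset.mem_sdiff.2 ⟨hEW hy, hyD⟩) hxy)
  have hne : ∀ j ∈ J, j ≠ j₀ := fun j hj h => hj₀ (h ▸ hj)
  have hold : ∀ j ∈ J, Function.update C j₀ T j = C j := fun j hj => by simp [hne j hj]
  refine ⟨E, Function.update C j₀ T, ⟨hEW, hEc, hEl, ?_, ?_, ?_, ?_, ?_, ?_⟩, ?_⟩
  · intro j hj
    rcases Finset.mem_insert.1 hj with rfl | hj
    · rw [Function.update_self]
      exact fun x hx => Finset.mem_sdiff.2 ⟨H.subset (hTD hx), fun hxE => (hEN x hxE).2 hx⟩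
    · rw [hold j hj]
      exact (H.bag_subset j hj).trans (Finset.sdiff_subset_sdiff le_rfl hED)
  · intro j hj
    rcases Finset.mem_insert.1 hj with rfl | hj
    · simpa using hT
    · rw [hold j hj]; exact H.bag_conn j hj
  · have hd : ∀ j ∈ J, Disjoint T (C j) := fun j hj =>
      Finset.disjoint_left.2 fun x hx hxC => (Finset.mem_sdiff.1 (H.bag_subset j hj hxC)).2 (hTD hx)
    intro i hi j hj hij
    rcases Finset.mem_insert.1 hi with rfl | hi'
    · have hj' : j ∈ J := (Finset.mem_insert.1 hj).resolve_left (Ne.symm hij)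
      rw [Function.update_self, hold j hj']; exact hd j hj'
    · rcases Finset.mem_insert.1 hj with rfl | hj
      · rw [Function.update_self, hold i hi']; exact (hd i hi').symm
      · rw [hold i hi', hold j hj]; exact H.disj i hi' j hj hij
  · intro i hi j hj hij
    rcases Finset.mem_insert.1 hi with rfl | hi'
    · have hj' : j ∈ J := (Finset.mem_insert.1 hj).resolve_left (Ne.symm hij)
      rw [Function.update_self, hold j hj']; exact hmeet j hj'
    · rcases Finset.mem_insert.1 hj with rfl | hj
      · rw [Function.update_self, hold i hi']
        obtain ⟨x, hx, y, hy, hxy⟩ := hmeet i hi'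
        exact ⟨y, hy, x, hx, hxy.symm⟩
      · rw [hold i hi', hold j hj]; exact H.touch i hi' j hj hij
  · intro x hx y hy hxy
    have hy' := Finset.mem_sdiff.1 hy
    by_cases hyD : y ∈ D
    · refine ⟨j₀, Finset.mem_insert_self _ _, ?_⟩
      rw [Function.update_self]
      by_contra hyT
      refine hy'.2 (hEcl x hx y (Finset.mem_sdiff.2 ⟨hy'.1, ?_⟩) hxy)
      rw [Finset.mem_union]
      rintro (h | h)
      · exact (Finset.mem_sdiff.1 (hN h)).2 hyD
      · exact hyT h
    · obtain ⟨j, hj, hyj⟩ := H.nbr x (hED hx) y (Finset.mem_sdiff.2 ⟨hy'.1, hyD⟩) hxy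
      exact ⟨j, Finset.mem_insert_of_mem hj, by rwa [hold j hj]⟩
  · intro j hj S hS hSE
    rcases Finset.mem_insert.1 hj with rfl | hj
    · rw [Function.update_self] at hS
      exact (Finset.card_le_card hS).trans hTm
    · rw [hold j hj] at hS
      refine H.small j hj S hS fun y hy => ?_
      obtain ⟨x, hx, hxy⟩ := hSE y hy
      exact ⟨x, hED hx, hxy⟩
  · obtain ⟨a, ha⟩ := hT.1
    exact Finset.card_lt_card ⟨hED, fun h => (hEN a (h (hTD ha))).2 ha⟩

/-- Enlarge a bag when a small set separates `D`. -/
theorem Haven.enlarge {W D Z : Finset V} {m h : ℕ} {J : Finset ℕ} {C : ℕ → Finset V}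
    (H : Haven G W m D J C) (hJ : J ⊆ Finset.range h) (hU : Unseparable G W ((h + 1) * m))
    (hZD : Z ⊆ D) (hZm : Z.card ≤ m)
    (hsep : ∀ Q ⊆ D \ Z, Conn G Q → ∃ j ∈ J, ∀ x ∈ Q, ∀ y ∈ C j, ¬ G.Adj x y)
    (hmeet : ∀ j ∈ J, ∃ x ∈ D, ∃ y ∈ C j, G.Adj x y) :
    ∃ E C', Haven G W m E J C' ∧ E.card < D.card := by
  obtain ⟨N, hN, hNc, hNb⟩ := H.exists_boundary hJ
  obtain ⟨E, hE, hEc, hEl, hEcl⟩ := hU (N ∪ Z)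
    (Finset.union_subset (hN.trans Finset.sdiff_subset) (hZD.trans H.subset)) (by
      have := Finset.card_union_le N Z
      nlinarith)
  have hEW : E ⊆ W := hE.trans Finset.sdiff_subset
  have hEN : ∀ y ∈ E, y ∉ N ∧ y ∉ Z := fun y hy => by
    simpa using (Finset.mem_sdiff.1 (hE hy)).2
  have hED : E ⊆ D := H.subset_of_avoid hEW hEc hEl fun y hy hyD x hx hxy =>
    (hEN y hy).1 (hNb x hx y (Finset.mem_sdiff.2 ⟨hEW hy, hyD⟩) hxy)
  obtain ⟨j, hj, hjE⟩ := hsep E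
    (fun x hx => Finset.mem_sdiff.2 ⟨hED hx, (hEN x hx).2⟩) hEc
  obtain ⟨c, hc⟩ := (H.bag_conn j hj).1
  have hCD : ∀ x ∈ C j, x ∈ W ∧ x ∉ D := fun x hx => Finset.mem_sdiff.1 (H.bag_subset j hj hx)
  -- The bag `C j` absorbs everything in `D \ E` that it reaches without entering `E`. The vertices
  -- of the enlarged bag with a neighbour in the rest of `D` then all lie in `Z`.
  let U := (C j ∪ D) \ E
  have hCU : C j ⊆ U := fun x hx =>
    Finset.mem_sdiff.2 ⟨Finset.mem_union_left _ hx, fun h => (hCD x hx).2 (hED h)⟩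
  let B := compIn G U c
  have hBU : B ⊆ U := compIn_subset U c
  have hCB : C j ⊆ B := (H.bag_conn j hj).subset_compIn hCU hc
  have hBconn : Conn G B := conn_compIn (hCU hc)
  have hBE : ∀ x ∈ B, x ∉ E := fun x hx => (Finset.mem_sdiff.1 (hBU hx)).2
  have hBCD : ∀ x ∈ B, x ∈ C j ∨ x ∈ D := fun x hx =>
    Finset.mem_union.1 (Finset.mem_sdiff.1 (hBU hx)).1
  have hBcl : ∀ x ∈ B, ∀ y ∈ D, y ∉ E → G.Adj x y → y ∈ B := fun x hx y hy hyE hxy =>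
    mem_compIn_of_adj hx (Finset.mem_sdiff.2 ⟨Finset.mem_union_right _ hy, hyE⟩) hxy
  have hED' : E ⊆ D \ B := fun x hx => Finset.mem_sdiff.2 ⟨hED hx, fun h => hBE x h hx⟩
  obtain ⟨a, ha⟩ := hEc.1
  -- A path in `D` that enters `B` can leave it only into `E`, and `E` is connected, so the detour
  -- through `B` can be avoided.
  have hlink : ∀ b ∈ D, b ∈ B ∨ LinkedIn G (D \ B) a b := by
    refine H.conn.induct (hED ha) (Or.inr Relation.ReflTransGen.refl) ?_
    intro x hx y hy hxy hPx
    by_cases hyB : y ∈ B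
    · exact Or.inl hyB
    right
    by_cases hxB : x ∈ B
    · have hyE : y ∈ E := by
        by_contra hyE
        exact hyB (hBcl x hxB y hy hyE hxy)
      exact (hEc.2 a ha y hyE).mono hED'
    · exact (hPx.resolve_left hxB).tail
        ⟨hxy, Finset.mem_sdiff.2 ⟨hx, hxB⟩, Finset.mem_sdiff.2 ⟨hy, hyB⟩⟩
  have hold : ∀ i, i ≠ j → Function.update C j B i = C i := fun i hi => by simp [hi]
  have hDB : D \ B ⊆ D := Finset.sdiff_subset
  refine ⟨D \ B, Function.update C j B, ⟨hDB.trans H.subset, ?_, ?_, ?_, ?_, ?_, ?_, ?_, ?_⟩, ?_⟩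
  · exact Conn.of_root (hED' ha) fun b hb =>
      (hlink b (hDB hb)).resolve_left (Finset.mem_sdiff.1 hb).2
  · exact hEl.trans_le (Nat.mul_le_mul_left 2 (Finset.card_le_card hED'))
  · intro i hi
    by_cases hij : i = j
    · subst hij
      rw [Function.update_self]
      intro x hx
      refine Finset.mem_sdiff.2 ⟨?_, fun h => (Finset.mem_sdiff.1 h).2 hx⟩
      rcases hBCD x hx with h | h
      · exact (hCD x h).1
      · exact H.subset h
    · rw [hold i hij]
      exact (H.bag_subset i hi).trans (Finset.sdiff_subset_sdiff le_rfl hDB)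
  · intro i hi
    by_cases hij : i = j
    · subst hij
      rwa [Function.update_self]
    · rw [hold i hij]; exact H.bag_conn i hi
  · have hd : ∀ i ∈ J, i ≠ j → Disjoint (C i) B := fun i hi hij =>
      Finset.disjoint_left.2 fun x hx hxB => by
        rcases hBCD x hxB with h | h
        · exact Finset.disjoint_left.1 (H.disj i hi j hj hij) hx h
        · exact (Finset.mem_sdiff.1 (H.bag_subset i hi hx)).2 h
    intro i hi k hk hik
    by_cases hij : i = j
    · subst hij
      rw [Function.update_self, hold k hik.symm]; exact (hd k hk hik.symm).symm
    · by_cases hkj : k = j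
      · subst hkj
        rw [Function.update_self, hold i hik]; exact hd i hi hik
      · rw [hold i hij, hold k hkj]; exact H.disj i hi k hk hik
  · intro i hi k hk hik
    obtain ⟨x, hx, y, hy, hxy⟩ := H.touch i hi k hk hik
    refine ⟨x, ?_, y, ?_, hxy⟩
    · by_cases hij : i = j
      · subst hij; rw [Function.update_self]; exact hCB hx
      · rwa [hold i hij]
    · by_cases hkj : k = j
      · subst hkj; rw [Function.update_self]; exact hCB hy
      · rwa [hold k hkj]
  · intro x hx y hy hxy
    have hy' := Finset.mem_sdiff.1 hy
    by_cases hyD : y ∈ D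
    · refine ⟨j, hj, ?_⟩
      rw [Function.update_self]
      by_contra hyB
      exact hy'.2 (Finset.mem_sdiff.2 ⟨hyD, hyB⟩)
    · obtain ⟨i, hi, hyi⟩ := H.nbr x (hDB hx) y (Finset.mem_sdiff.2 ⟨hy'.1, hyD⟩) hxy
      refine ⟨i, hi, ?_⟩
      by_cases hij : i = j
      · subst hij; rw [Function.update_self]; exact hCB hyi
      · rwa [hold i hij]
  · intro i hi S hS hSD
    by_cases hij : i = j
    · subst hij
      rw [Function.update_self] at hS
      refine (Finset.card_le_card fun y hy => ?_).trans hZm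
      obtain ⟨x, hx, hxy⟩ := hSD y hy
      have hx' := Finset.mem_sdiff.1 hx
      have hxE : x ∈ E := by
        by_contra hxE
        exact hx'.2 (hBcl y (hS hy) x hx'.1 hxE hxy.symm)
      rcases hBCD y (hS hy) with hyC | hyD
      · exact absurd hxy (hjE x hxE y hyC)
      · by_contra hyZ
        refine hBE y (hS hy) (hEcl x hxE y (Finset.mem_sdiff.2 ⟨H.subset hyD, ?_⟩) hxy)
        rw [Finset.mem_union]
        rintro (h | h)
        · exact (Finset.mem_sdiff.1 (hN h)).2 hyD
        · exact hyZ h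
    · rw [hold i hij] at hS
      refine H.small i hi S hS fun y hy => ?_
      obtain ⟨x, hx, hxy⟩ := hSD y hy
      exact ⟨x, hDB hx, hxy⟩
  · obtain ⟨x, hx, y, hy, hxy⟩ := hmeet j hj
    have hxE : x ∉ E := fun h => hjE x h y hy hxy
    have hxB : x ∈ B := hBcl y (hCB hy) x hx hxE hxy.symm
    exact Finset.card_lt_card ⟨hDB, fun h => (Finset.mem_sdiff.1 (h hx)).2 hxB⟩

/-- Infinite descent in `|D| (h + 1) + |J|`. A bag without a neighbour in `D` is dropped. Otherwise
`steiner_or_separate` yields a new bag or an enlarged one, and `D` shrinks in both cases; the factor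
`h + 1` outweighs any growth of `J`. With `h` bags there would be a clique minor. -/
theorem Haven.false {W : Finset V} {m h : ℕ} (hG : ¬ HasCliqueMinor G W h) (hm : 1 ≤ m)
    (hW : h * W.card ≤ m * m) (hU : Unseparable G W ((h + 1) * m)) :
    ∀ (μ : ℕ) (D : Finset V) (J : Finset ℕ) (C : ℕ → Finset V), Haven G W m D J C →
      J ⊆ Finset.range h → D.card * (h + 1) + J.card ≤ μ → False := by
  classical
  intro μ
  induction μ with
  | zero =>
    intro D J C H _ hμ
    have := H.conn.1.card_pos
    nlinarith
  | succ μ ih =>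
    intro D J C H hJ hμ
    have hJc : J.card ≤ h := by simpa using Finset.card_le_card hJ
    have hdec : ∀ {E : Finset V} {J' : Finset ℕ}, E.card < D.card → J' ⊆ Finset.range h →
        E.card * (h + 1) + J'.card ≤ μ := by
      intro E J' hE hJ'
      have h1 : J'.card ≤ h := by simpa using Finset.card_le_card hJ'
      nlinarith
    by_cases hmeet : ∀ j ∈ J, ∃ x ∈ D, ∃ y ∈ C j, G.Adj x y
    swap
    · push Not at hmeet
      obtain ⟨j, hj, hno⟩ := hmeet
      have hsub : J.erase j ⊆ J := Finset.erase_subset _ _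
      refine ih D (J.erase j) C ⟨H.subset, H.conn, H.large, fun i hi => H.bag_subset i (hsub hi),
        fun i hi => H.bag_conn i (hsub hi), fun i hi k hk => H.disj i (hsub hi) k (hsub hk),
        fun i hi k hk => H.touch i (hsub hi) k (hsub hk), ?_, fun i hi => H.small i (hsub hi)⟩
        (hsub.trans hJ) ?_
      · intro x hx y hy hxy
        obtain ⟨i, hi, hyi⟩ := H.nbr x hx y hy hxy
        refine ⟨i, Finset.mem_erase.2 ⟨?_, hi⟩, hyi⟩
        rintro rfl
        exact hno x hx y hyi hxy
      · have := Finset.card_erase_lt_of_mem hj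
        omega
    by_cases hJh : J = Finset.range h
    · refine hG ⟨C, fun i hi => ?_, fun i hi j hj hij => ?_⟩
      · have hi' : i ∈ J := by simpa [hJh] using hi
        exact ⟨(H.bag_subset i hi').trans Finset.sdiff_subset, H.bag_conn i hi'⟩
      have hi' : i ∈ J := by simpa [hJh] using hi
      have hj' : j ∈ J := by simpa [hJh] using hj
      exact ⟨H.disj i hi' j hj' hij, H.touch i hi' j hj' hij⟩
    obtain ⟨j₀, hj₀r, hj₀⟩ := Finset.exists_of_ssubset (hJ.ssubset_of_ne hJh)
    -- Indices without a bag get all of `D`, so they impose no condition.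
    let A : ℕ → Finset V := fun j => if j ∈ J then D.filter fun x => ∃ y ∈ C j, G.Adj x y else D
    rcases steiner_or_separate (G := G) D A h m hm with ⟨T, hTD, hT, hTm, hTA⟩ | ⟨Z, hZD, hZ, hsep⟩
    · obtain ⟨E, C', H', hlt⟩ := H.add hJ hU hTD hT hTm (fun j hj => by
        obtain ⟨x, hx, hxA⟩ := hTA j (Finset.mem_range.1 (hJ hj))
        simp only [A, if_pos hj, Finset.mem_filter] at hxA
        exact ⟨x, hx, hxA.2⟩) hj₀
      have hJ' : insert j₀ J ⊆ Finset.range h := Finset.insert_subset hj₀r hJ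
      exact ih E _ C' H' hJ' (hdec hlt hJ')
    · have hDW := Finset.card_le_card H.subset
      have hZm : Z.card ≤ m := by
        have h1 : Z.card * m ≤ m * m := hZ.trans ((Nat.mul_le_mul_left h hDW).trans hW)
        exact Nat.le_of_mul_le_mul_right h1 hm
      obtain ⟨E, C', H', hlt⟩ := H.enlarge hJ hU hZD hZm (fun Q hQ hQc => by
        obtain ⟨j, _, hjQ⟩ := hsep Q hQ hQc
        have hQD : ∀ x ∈ Q, x ∈ D := fun x hx => (Finset.mem_sdiff.1 (hQ hx)).1
        by_cases hj : j ∈ J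
        · refine ⟨j, hj, fun x hx y hy hxy => hjQ x hx ?_⟩
          simp only [A, if_pos hj, Finset.mem_filter]
          exact ⟨hQD x hx, y, hy, hxy⟩
        · obtain ⟨x, hx⟩ := hQc.1
          exact absurd (by simpa only [A, if_neg hj] using hQD x hx) (hjQ x hx)) hmeet
      exact ih E _ C' H' hJ (hdec hlt hJ)

/-- A separator theorem of Alon, Seymour and Thomas (with a weaker constant). -/
theorem exists_separator {W : Finset V} {m h : ℕ} (hG : ¬ HasCliqueMinor G W h) (hm : 1 ≤ m)
    (hW : h * W.card ≤ m * m) :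
    ∃ X ⊆ W, X.card ≤ (h + 1) * m ∧ ∀ D ⊆ W \ X, Conn G D → 2 * D.card ≤ W.card := by
  by_contra! hcon
  have hU : Unseparable G W ((h + 1) * m) := by
    intro X hX hXc
    obtain ⟨D, hD, hDc, hDl⟩ := hcon X hX hXc
    obtain ⟨a, ha⟩ := hDc.1
    have hsub := hDc.subset_compIn hD ha
    exact ⟨compIn G (W \ X) a, compIn_subset _ _, conn_compIn (hD ha),
      hDl.trans_le (Nat.mul_le_mul_left 2 (Finset.card_le_card hsub)),
      fun x hx y hy hxy => mem_compIn_of_adj hx hy hxy⟩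
  -- With nothing deleted, the large component has no neighbours outside of it, so it is a haven
  -- without bags.
  obtain ⟨D, hD, hDc, hDl, hDcl⟩ := hU ∅ (by simp) (by simp)
  refine Haven.false hG hm hW hU _ D ∅ (fun _ => ∅) ⟨by simpa using hD, hDc, hDl, by simp, by simp,
    by simp, by simp, ?_, by simp⟩ (by simp) le_rfl
  intro x hx y hy hxy
  have hy' := Finset.mem_sdiff.1 hy
  exact absurd (hDcl x hx y (by simpa using hy'.1) hxy) hy'.2

/-- Two sides of a small separator, each with at most two thirds of the vertices. -/
theorem exists_balanced {W : Finset V} {m h : ℕ} (hG : ¬ HasCliqueMinor G W h) (hm : 1 ≤ m)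
    (hW : h * W.card ≤ m * m) :
    ∃ A B : Finset V, A ∪ B = W ∧ 3 * A.card ≤ 2 * W.card + 3 * ((h + 1) * m) ∧
      3 * B.card ≤ 2 * W.card + 3 * ((h + 1) * m) ∧ A.card + B.card ≤ W.card + (h + 1) * m ∧
      ∀ x ∈ W, ∀ y ∈ W, G.Adj x y → (x ∈ A ∧ y ∈ A) ∨ (x ∈ B ∧ y ∈ B) := by
  classical
  obtain ⟨X, hXW, hXm, hX⟩ := exists_separator hG hm hW
  -- the sets that are closed under adjacency outside of `X` and have at most `2|W|/3` vertices
  let F := (W \ X).powerset.filter fun A => 3 * A.card ≤ 2 * W.card ∧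
    ∀ x ∈ A, ∀ y ∈ W \ X, G.Adj x y → y ∈ A
  obtain ⟨A, hA, hAmax⟩ := F.exists_max_image Finset.card
    ⟨∅, Finset.mem_filter.2 ⟨by simp, by simp⟩⟩
  obtain ⟨hAX, hA3, hAcl⟩ := Finset.mem_filter.1 hA
  rw [Finset.mem_powerset] at hAX
  let B := (W \ X) \ A
  have hcard : A.card + B.card + X.card = W.card := by
    have h1 := Finset.card_sdiff_add_card_eq_card hAX
    have h2 := Finset.card_sdiff_add_card_eq_card hXW
    simp only [B]; omega
  -- If `B` were too large, then `3 |A| < |W|`. A component `Q` inside `B` has at most `|W| / 2`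
  -- vertices, hence by maximality at most `|A|`, and `A ∪ Q` would be a larger admissible set.
  have hB3 : 3 * B.card ≤ 2 * W.card := by
    by_contra! hlt
    have hA1 : 3 * A.card < W.card := by omega
    obtain ⟨b, hb⟩ : B.Nonempty := Finset.card_pos.1 (by omega)
    have hb' := Finset.mem_sdiff.1 hb
    let Q := compIn G (W \ X) b
    have hQ2 := hX Q (compIn_subset _ _) (conn_compIn hb'.1)
    have hQcl : ∀ x ∈ Q, ∀ y ∈ W \ X, G.Adj x y → y ∈ Q := fun x hx y hy hxy =>
      mem_compIn_of_adj hx hy hxy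
    have hQF : Q ∈ F := Finset.mem_filter.2
      ⟨Finset.mem_powerset.2 (compIn_subset _ _), by omega, hQcl⟩
    have hQA := hAmax Q hQF
    have hAQ := Finset.card_union_le A Q
    have hAQF : A ∪ Q ∈ F := by
      refine Finset.mem_filter.2 ⟨Finset.mem_powerset.2
        (Finset.union_subset hAX (compIn_subset _ _)), by omega, ?_⟩
      intro x hx y hy hxy
      rcases Finset.mem_union.1 hx with hx | hx
      · exact Finset.mem_union_left _ (hAcl x hx y hy hxy)
      · exact Finset.mem_union_right _ (hQcl x hx y hy hxy)
    have hlt : A.card < (A ∪ Q).card := Finset.card_lt_card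
      ⟨Finset.subset_union_left, fun h => hb'.2
        (h (Finset.mem_union_right _ (mem_compIn_self hb'.1)))⟩
    exact absurd (hAmax _ hAQF) (not_le.2 hlt)
  have hAXc := Finset.card_union_le A X
  have hBXc : (B ∪ X).card ≤ B.card + X.card := Finset.card_union_le B X
  refine ⟨A ∪ X, B ∪ X, ?_, by omega, by omega, ?_, ?_⟩
  · ext x
    simp only [Finset.mem_union, B, Finset.mem_sdiff]
    constructor
    · rintro ((h | h) | (h | h))
      · exact (Finset.mem_sdiff.1 (hAX h)).1
      · exact hXW h
      · exact h.1.1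
      · exact hXW h
    · intro h
      by_cases h1 : x ∈ X <;> by_cases h2 : x ∈ A <;> simp [*]
  · omega
  · intro x hx y hy hxy
    simp only [Finset.mem_union, B, Finset.mem_sdiff]
    by_cases hxX : x ∈ X
    · by_cases hyX : y ∈ X <;> by_cases hyA : y ∈ A <;> simp [*]
    · by_cases hyX : y ∈ X
      · by_cases hxA : x ∈ A <;> simp [*]
      · have h1 : x ∈ A → y ∈ A := fun h => hAcl x h y (Finset.mem_sdiff.2 ⟨hy, hyX⟩) hxy
        have h2 : y ∈ A → x ∈ A := fun h => hAcl y h x (Finset.mem_sdiff.2 ⟨hx, hxX⟩) hxy.symm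
        by_cases hxA : x ∈ A
        · simp [hxA, h1 hxA]
        · have hyA : y ∉ A := fun h => hxA (h2 h)
          simp [*]

end Separator

set_option linter.unusedSectionVars false

/-! ### Divisions into regions of bounded size with little overlap. -/

section Division

variable {V : Type*} [DecidableEq V] {G : SimpleGraph V}

/-- The members of `l` have at most `r` elements and cover the vertices and edges of `G[W]`. -/
structure IsDivision (G : SimpleGraph V) (W : Finset V) (r : ℕ) (l : List (Finset V)) : Prop where
  subset : ∀ R ∈ l, R ⊆ W
  nonempty : ∀ R ∈ l, R.Nonempty
  card_le : ∀ R ∈ l, R.card ≤ r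
  cover : ∀ x ∈ W, ∃ R ∈ l, x ∈ R
  cover_adj : ∀ x ∈ W, ∀ y ∈ W, G.Adj x y → ∃ R ∈ l, x ∈ R ∧ y ∈ R

theorem exists_isDivision_of_card_le {W : Finset V} {r : ℕ} (h : W.card ≤ r) :
    ∃ l, IsDivision G W r l ∧ (l.map Finset.card).sum = W.card := by
  rcases W.eq_empty_or_nonempty with rfl | hW
  · exact ⟨[], ⟨by simp, by simp, by simp, by simp, by simp⟩, by simp⟩
  · exact ⟨[W], ⟨by simp, by simpa using hW, by simpa using h, by simp,
      fun x hx y hy _ => ⟨W, by simp, hx, hy⟩⟩, by simp⟩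

theorem IsDivision.append {W A B : Finset V} {r : ℕ} {l₁ l₂ : List (Finset V)}
    (hAB : A ∪ B = W)
    (hadj : ∀ x ∈ W, ∀ y ∈ W, G.Adj x y → (x ∈ A ∧ y ∈ A) ∨ (x ∈ B ∧ y ∈ B))
    (h₁ : IsDivision G A r l₁) (h₂ : IsDivision G B r l₂) : IsDivision G W r (l₁ ++ l₂) := by
  have hA : A ⊆ W := hAB ▸ Finset.subset_union_left
  have hB : B ⊆ W := hAB ▸ Finset.subset_union_right
  refine ⟨?_, ?_, ?_, ?_, ?_⟩
  · intro R hR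
    rcases List.mem_append.1 hR with hR | hR
    · exact (h₁.subset R hR).trans hA
    · exact (h₂.subset R hR).trans hB
  · intro R hR
    exact (List.mem_append.1 hR).elim (h₁.nonempty R) (h₂.nonempty R)
  · intro R hR
    exact (List.mem_append.1 hR).elim (h₁.card_le R) (h₂.card_le R)
  · intro x hx
    rw [← hAB, Finset.mem_union] at hx
    rcases hx with hx | hx
    · obtain ⟨R, hR, hxR⟩ := h₁.cover x hx
      exact ⟨R, List.mem_append_left _ hR, hxR⟩
    · obtain ⟨R, hR, hxR⟩ := h₂.cover x hx
      exact ⟨R, List.mem_append_right _ hR, hxR⟩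
  · intro x hx y hy hxy
    rcases hadj x hx y hy hxy with h | h
    · obtain ⟨R, hR, hxR⟩ := h₁.cover_adj x h.1 y h.2 hxy
      exact ⟨R, List.mem_append_left _ hR, hxR⟩
    · obtain ⟨R, hR, hxR⟩ := h₂.cover_adj x h.1 y h.2 hxy
      exact ⟨R, List.mem_append_right _ hR, hxR⟩

/-- The balanced separation, with real numbers. -/
theorem exists_balanced_real {W : Finset V} {h : ℕ} (hG : ¬ HasCliqueMinor G W h)
    (hW : (12 * ((h : ℝ) + 1) ^ 2) ^ 2 ≤ W.card) :
    ∃ A B : Finset V, A ∪ B = W ∧ (A.card : ℝ) ≤ 3 / 4 * W.card ∧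
      (B.card : ℝ) ≤ 3 / 4 * W.card ∧
      (A.card + B.card : ℝ) ≤ W.card * (1 + ((h : ℝ) + 1) ^ 2 / √W.card) ∧
      ∀ x ∈ W, ∀ y ∈ W, G.Adj x y → (x ∈ A ∧ y ∈ A) ∨ (x ∈ B ∧ y ∈ B) := by
  set n : ℝ := (W.card : ℝ) with hn
  -- This makes `(h + 1) * m` at most `c √|W|` with `c = (h + 1) ^ 2`. As `√|W| ≥ 12 c`, this is at
  -- most `|W| / 12`, the difference between `3 / 4` and `2 / 3`.
  set m : ℕ := Nat.sqrt (h * W.card) + 1 with hm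
  obtain ⟨A, B, hAB, hA, hB, hsum, hadj⟩ := exists_balanced (m := m) hG (by omega)
    (by have := Nat.lt_succ_sqrt (h * W.card); exact this.le)
  have hh : (0 : ℝ) ≤ h := Nat.cast_nonneg h
  set c : ℝ := ((h : ℝ) + 1) ^ 2 with hc
  have hc1 : 1 ≤ c := by rw [hc]; nlinarith
  have hsn : 12 * c ≤ √n := Real.le_sqrt_of_sq_le hW
  have hss : √n * √n = n := Real.mul_self_sqrt (by positivity)
  have hm' : ((h : ℝ) + 1) * m ≤ c * √n := by
    have h1 : ((Nat.sqrt (h * W.card) : ℕ) : ℝ) ≤ h * √n := by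
      have h2 : ((Nat.sqrt (h * W.card) : ℕ) : ℝ) ≤ √((h : ℝ) * n) := by
        rw [hn]; exact_mod_cast Real.nat_sqrt_le_real_sqrt
      refine h2.trans (Real.sqrt_le_iff.2 ⟨by positivity, ?_⟩)
      rw [mul_pow, sq √n, hss]
      have h3 : (h : ℝ) ≤ (h : ℝ) ^ 2 := by
        rcases Nat.eq_zero_or_pos h with rfl | hp
        · simp
        · have : (1 : ℝ) ≤ h := by exact_mod_cast hp
          nlinarith
      have : 0 ≤ n := by positivity
      nlinarith
    have h4 : (m : ℝ) ≤ (h + 1) * √n := by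
      rw [hm]; push_cast; nlinarith
    rw [hc, sq, mul_assoc]
    exact mul_le_mul_of_nonneg_left h4 (by positivity)
  have hAr : (3 : ℝ) * A.card ≤ 2 * n + 3 * ((h + 1) * m) := by rw [hn]; exact_mod_cast hA
  have hBr : (3 : ℝ) * B.card ≤ 2 * n + 3 * ((h + 1) * m) := by rw [hn]; exact_mod_cast hB
  have hsr : (A.card + B.card : ℝ) ≤ n + (h + 1) * m := by rw [hn]; exact_mod_cast hsum
  have h12 : 12 * (c * √n) ≤ n := by
    have : 0 ≤ √n := Real.sqrt_nonneg n
    nlinarith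
  refine ⟨A, B, hAB, by linarith, by linarith, ?_, hadj⟩
  have hpos : 0 < √n := by linarith
  have : n * (1 + c / √n) = n + c * √n := by
    field_simp
    nlinarith
  linarith

/-- Recursive splitting. A set of more than `r (4 / 3) ^ j` vertices is split with growth factor at
most `1 + c / √|W| ≤ exp (γ (7 / 8) ^ j)`, where `γ = c / √r`, because `(8 / 7) ^ 2 ≤ 4 / 3`. The
exponents over all levels form a geometric series with sum `8 γ (1 - (7 / 8) ^ j)`. -/
theorem exists_division_aux {W₀ : Finset V} {h r : ℕ} (hG : ¬ HasCliqueMinor G W₀ h)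
    (hr : (12 * ((h : ℝ) + 1) ^ 2) ^ 2 ≤ r) (j : ℕ) :
    ∀ W ⊆ W₀, (W.card : ℝ) ≤ r * (4 / 3) ^ j → ∃ l, IsDivision G W r l ∧
      ((l.map Finset.card).sum : ℝ) ≤
        Real.exp (8 * (((h : ℝ) + 1) ^ 2 / √r) * (1 - (7 / 8) ^ j)) * W.card := by
  set c : ℝ := ((h : ℝ) + 1) ^ 2 with hc
  have hc1 : 1 ≤ c := by
    have hh : (0 : ℝ) ≤ h := Nat.cast_nonneg h
    rw [hc]; nlinarith
  have hr0 : (0 : ℝ) < r := lt_of_lt_of_le (by positivity) hr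
  set γ : ℝ := c / √r with hγ
  have hγ0 : 0 ≤ γ := by positivity
  have hbase : ∀ (W : Finset V) (a : ℝ), 0 ≤ a → W.card ≤ r → ∃ l, IsDivision G W r l ∧
      ((l.map Finset.card).sum : ℝ) ≤ Real.exp a * W.card := by
    intro W a ha hW
    obtain ⟨l, hl, hs⟩ := exists_isDivision_of_card_le (G := G) hW
    refine ⟨l, hl, ?_⟩
    rw [hs]
    exact le_mul_of_one_le_left (by positivity) (Real.one_le_exp ha)
  induction j with
  | zero =>
    intro W _ hW
    refine hbase W _ (by simp) ?_
    simpa using hW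
  | succ j ih =>
    intro W hW₀ hW
    have h78 : ((7 : ℝ) / 8) ^ (j + 1) ≤ 1 := pow_le_one₀ (by norm_num) (by norm_num)
    have hexp : 8 * γ * (1 - (7 / 8) ^ j) + γ * (7 / 8) ^ j = 8 * γ * (1 - (7 / 8) ^ (j + 1)) := by
      rw [pow_succ]; ring
    by_cases hsmall : (W.card : ℝ) ≤ r * (4 / 3) ^ j
    · obtain ⟨l, hl, hs⟩ := ih W hW₀ hsmall
      refine ⟨l, hl, hs.trans (mul_le_mul_of_nonneg_right (Real.exp_le_exp.2 ?_) (by positivity))⟩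
      rw [← hexp]
      have : 0 ≤ γ * (7 / 8) ^ j := by positivity
      linarith
    push Not at hsmall
    have hrW : (r : ℝ) ≤ W.card := by
      have : (1 : ℝ) ≤ (4 / 3) ^ j := one_le_pow₀ (by norm_num)
      nlinarith
    obtain ⟨A, B, hAB, hA, hB, hsum, hadj⟩ := exists_balanced_real
      (fun H => hG (H.mono hW₀)) (hr.trans hrW)
    have hW' : 3 / 4 * (W.card : ℝ) ≤ r * (4 / 3) ^ j := by
      rw [pow_succ] at hW; linarith
    obtain ⟨l₁, hl₁, hs₁⟩ := ih A ((hAB ▸ Finset.subset_union_left).trans hW₀) (hA.trans hW')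
    obtain ⟨l₂, hl₂, hs₂⟩ := ih B ((hAB ▸ Finset.subset_union_right).trans hW₀) (hB.trans hW')
    refine ⟨l₁ ++ l₂, hl₁.append hAB hadj hl₂, ?_⟩
    rw [List.map_append, List.sum_append, Nat.cast_add]
    have hfac : 1 + c / √W.card ≤ Real.exp (γ * (7 / 8) ^ j) := by
      refine le_trans ?_ (Real.add_one_le_exp _)
      have hsq : √r * (8 / 7) ^ j ≤ √(W.card : ℝ) := by
        refine Real.le_sqrt_of_sq_le ?_
        rw [mul_pow, Real.sq_sqrt hr0.le, ← pow_mul, mul_comm j, pow_mul]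
        refine le_trans (mul_le_mul_of_nonneg_left ?_ hr0.le) hsmall.le
        exact pow_le_pow_left₀ (by norm_num) (by norm_num) j
      have hsr : 0 < √(r : ℝ) := Real.sqrt_pos.2 hr0
      have : c / √(W.card : ℝ) ≤ γ * (7 / 8) ^ j := by
        calc c / √(W.card : ℝ) ≤ c / (√r * (8 / 7) ^ j) :=
              div_le_div_of_nonneg_left (by positivity) (by positivity) hsq
          _ = γ * (7 / 8) ^ j := by
            have h87 : ((7 : ℝ) / 8) ^ j = ((8 / 7) ^ j)⁻¹ := by rw [← inv_pow]; norm_num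
            rw [hγ, h87, div_mul_eq_div_div, div_eq_mul_inv]
      linarith
    set p := Real.exp (8 * γ * (1 - (7 / 8) ^ j)) with hp
    have hp0 : 0 < p := Real.exp_pos _
    calc _ ≤ p * A.card + p * B.card := add_le_add hs₁ hs₂
      _ = p * (A.card + B.card) := by ring
      _ ≤ p * (W.card * Real.exp (γ * (7 / 8) ^ j)) :=
        mul_le_mul_of_nonneg_left
          (hsum.trans (mul_le_mul_of_nonneg_left hfac (by positivity))) hp0.le
      _ = _ := by
        rw [← hexp, Real.exp_add, hp]; ring

/-- Graphs without a fixed clique minor have divisions into regions of bounded size with little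
overlap. -/
theorem exists_division {W : Finset V} {h q : ℕ} (hq : 1 ≤ q)
    (hG : ¬ HasCliqueMinor G W h) :
    ∃ l, IsDivision G W ((384 * (h + 1) ^ 2 * q) ^ 2) l ∧
      24 * q * (l.map Finset.card).sum ≤ (24 * q + 1) * W.card := by
  set r : ℕ := (384 * (h + 1) ^ 2 * q) ^ 2 with hr
  set c : ℝ := ((h : ℝ) + 1) ^ 2 with hc
  have hc1 : 1 ≤ c := by
    have hh : (0 : ℝ) ≤ h := Nat.cast_nonneg h
    rw [hc]; nlinarith
  have hq1 : (1 : ℝ) ≤ q := by exact_mod_cast hq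
  have hrr : (r : ℝ) = (384 * c * q) ^ 2 := by rw [hr, hc]; push_cast; ring
  have hsr : √(r : ℝ) = 384 * c * q := by rw [hrr]; exact Real.sqrt_sq (by positivity)
  have hr12 : (12 * c) ^ 2 ≤ (r : ℝ) := by
    rw [hrr]
    refine pow_le_pow_left₀ (by positivity) ?_ 2
    nlinarith
  have hr0 : (1 : ℝ) ≤ r := by nlinarith
  obtain ⟨j, hj⟩ := pow_unbounded_of_one_lt (W.card : ℝ) (by norm_num : (1 : ℝ) < 4 / 3)
  obtain ⟨l, hl, hs⟩ := exists_division_aux hG hr12 j W le_rfl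
    (hj.le.trans (le_mul_of_one_le_left (by positivity) hr0))
  refine ⟨l, hl, ?_⟩
  have hγ : c / √(r : ℝ) = 1 / (384 * q) := by
    rw [hsr]; field_simp
  -- The constant `384` makes the exponent at most `x = 8 / (384 q) = 1 / (48 q)`, and `exp x ≤ 1 /
  -- (1 - x) ≤ 1 + 2 x` for `x ≤ 1 / 2`.
  have hexp : Real.exp (8 * (c / √(r : ℝ)) * (1 - (7 / 8) ^ j)) ≤ 1 + 1 / (24 * q) := by
    set x : ℝ := 1 / (48 * q) with hx
    have hx0 : 0 < x := by positivity
    have hx1 : x ≤ 1 / 2 := by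
      rw [hx, div_le_div_iff₀ (by positivity) (by norm_num)]; linarith
    have h1 : 8 * (c / √(r : ℝ)) * (1 - (7 / 8) ^ j) ≤ x := by
      have h2 : 8 * (c / √(r : ℝ)) = x := by rw [hγ, hx]; field_simp; norm_num
      rw [h2]
      have : (0 : ℝ) ≤ (7 / 8) ^ j := by positivity
      nlinarith
    refine (Real.exp_le_exp.2 h1).trans ?_
    have h3 : 1 - x ≤ Real.exp (-x) := by have := Real.add_one_le_exp (-x); linarith
    have h4 : Real.exp x * Real.exp (-x) = 1 := by rw [← Real.exp_add]; simp
    have h5 : (1 : ℝ) / (24 * q) = 2 * x := by rw [hx]; field_simp; norm_num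
    rw [h5]
    have h6 : 0 < Real.exp x := Real.exp_pos x
    have h7 : Real.exp x * (1 - x) ≤ 1 := (mul_le_mul_of_nonneg_left h3 h6.le).trans h4.le
    nlinarith
  have hfin : ((l.map Finset.card).sum : ℝ) ≤ (1 + 1 / (24 * q)) * W.card :=
    hs.trans (mul_le_mul_of_nonneg_right hexp (by positivity))
  have h24 : (24 * q : ℝ) * (l.map Finset.card).sum ≤ (24 * q + 1) * W.card := by
    calc (24 * q : ℝ) * (l.map Finset.card).sum
        ≤ (24 * q : ℝ) * ((1 + 1 / (24 * q)) * W.card) :=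
          mul_le_mul_of_nonneg_left hfin (by positivity)
      _ = (24 * q + 1) * W.card := by field_simp
  exact_mod_cast h24

end Division

set_option linter.unusedSectionVars false

/-! ### Voronoi cells and their contraction. -/

section Voronoi

variable {V : Type*} {G : SimpleGraph V} (w : V → V → ℕ)

/-- The length of a walk with respect to natural edge lengths. -/
def wlen {u v : V} : G.Walk u v → ℕ
  | .nil => 0
  | .cons (u := a) (v := b) _ p => w a b + wlen p

variable (G) in
/-- The distance of `v` from the set `S`. -/
noncomputable def setDist (S : Finset V) (v : V) : ℕ∞ :=
  ⨅ u ∈ S, ⨅ p : G.Walk v u, (wlen w p : ℕ∞)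

variable {w}

theorem setDist_le {S : Finset V} {v u : V} (hu : u ∈ S) (p : G.Walk v u) :
    setDist G w S v ≤ wlen w p :=
  (iInf₂_le u hu).trans (iInf_le _ p)

theorem le_setDist {S : Finset V} {v : V} {x : ℕ∞}
    (h : ∀ u ∈ S, ∀ p : G.Walk v u, x ≤ wlen w p) : x ≤ setDist G w S v :=
  le_iInf₂ fun u hu => le_iInf fun p => h u hu p

/-- A shortest walk with as few edges as possible: its length is `a`, and it has `k` edges. -/
structure IsKey (G : SimpleGraph V) (w : V → V → ℕ) (F : Finset V) (v : V) (a k : ℕ) : Prop where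
  exists_walk : ∃ u ∈ F, ∃ p : G.Walk v u, wlen w p = a ∧ p.length = k
  le_wlen : ∀ u ∈ F, ∀ p : G.Walk v u, a ≤ wlen w p
  le_length : ∀ u ∈ F, ∀ p : G.Walk v u, wlen w p = a → k ≤ p.length

theorem exists_isKey {F : Finset V} {v u : V} (hu : u ∈ F) (p : G.Walk v u) :
    ∃ a k, IsKey G w F v a k := by
  classical
  have h1 : ∃ a, ∃ u ∈ F, ∃ p : G.Walk v u, wlen w p = a := ⟨_, u, hu, p, rfl⟩
  have h2 : ∃ k, ∃ u ∈ F, ∃ p : G.Walk v u, wlen w p = Nat.find h1 ∧ p.length = k := by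
    obtain ⟨u, hu, p, hp⟩ := Nat.find_spec h1
    exact ⟨_, u, hu, p, hp, rfl⟩
  exact ⟨Nat.find h1, Nat.find h2, Nat.find_spec h2,
    fun u hu p => Nat.find_min' h1 ⟨u, hu, p, rfl⟩,
    fun u hu p hp => Nat.find_min' h2 ⟨u, hu, p, hp, rfl⟩⟩

theorem IsKey.zero {F : Finset V} {v : V} {a : ℕ} (h : IsKey G w F v a 0) : v ∈ F := by
  obtain ⟨u, hu, p, _, hp⟩ := h.exists_walk
  rwa [SimpleGraph.Walk.eq_of_length_eq_zero hp]

/-- Any improvement of the tail of an optimal walk, in length or in number of edges, would improve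
the whole walk. -/
theorem IsKey.succ {F : Finset V} {v : V} {a k : ℕ} (h : IsKey G w F v a (k + 1)) :
    ∃ u b, G.Adj v u ∧ a = w v u + b ∧ IsKey G w F u b k := by
  obtain ⟨x, hx, p, hpa, hpk⟩ := h.exists_walk
  cases p with
  | nil => simp at hpk
  | @cons _ u _ hvu p =>
    simp only [wlen, SimpleGraph.Walk.length_cons] at hpa hpk
    refine ⟨u, wlen w p, hvu, hpa.symm, ⟨x, hx, p, rfl, by omega⟩, fun y hy p' => ?_,
      fun y hy p' hp' => ?_⟩
    · have := h.le_wlen y hy (.cons hvu p')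
      simp only [wlen] at this
      omega
    · have := h.le_length y hy (.cons hvu p') (by simp only [wlen]; omega)
      simpa using this

/-- `v` can reach `F`. -/
def Live (G : SimpleGraph V) (F : Finset V) (v : V) : Prop := ∃ u ∈ F, Nonempty (G.Walk v u)

/-- `c` assigns to each vertex a nearest vertex of `F`, with connected fibres. -/
structure IsVoronoi (G : SimpleGraph V) (w : V → V → ℕ) (F : Finset V) (c : V → V) : Prop where
  self : ∀ x ∈ F, c x = x
  mem : ∀ v, Live G F v → c v ∈ F
  nearest : ∀ v, Live G F v → ∃ p : G.Walk v (c v), ∀ y ∈ F, ∀ p' : G.Walk v y, wlen w p ≤ wlen w p'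
  linked : ∀ v, Live G F v →
    Relation.ReflTransGen (fun a b => G.Adj a b ∧ Live G F a ∧ Live G F b ∧ c a = c b) v (c v)

/-- Each vertex points to the next one on a shortest walk with fewest edges. Edges may have length
zero, so distances need not drop along the pointers, but the number of edges does. Following the
pointers leads to a nearest point of `F`, and all vertices on the way get the same one, which links
the cell to its centre. -/
theorem exists_isVoronoi (F : Finset V) : ∃ c, IsVoronoi G w F c := by
  classical
  have hkey : ∀ v, ∃ k, Live G F v → ∃ a, IsKey G w F v a k := by
    intro v
    by_cases hv : Live G F v
    · obtain ⟨u, hu, ⟨p⟩⟩ := hv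
      obtain ⟨a, k, h⟩ := exists_isKey (w := w) hu p
      exact ⟨k, fun _ => ⟨a, h⟩⟩
    · exact ⟨0, fun h => absurd h hv⟩
  choose hops hhops using hkey
  have huniq : ∀ v a k, IsKey G w F v a k → ∀ b m, IsKey G w F v b m → a = b ∧ k = m := by
    intro v a k h b m h'
    obtain ⟨u, hu, p, hpa, hpk⟩ := h.exists_walk
    obtain ⟨u', hu', p', hpa', hpk'⟩ := h'.exists_walk
    have h1 := h.le_wlen u' hu' p'
    have h2 := h'.le_wlen u hu p
    have hab : a = b := by omega
    have h3 := h.le_length u' hu' p' (by omega)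
    have h4 := h'.le_length u hu p (by omega)
    exact ⟨hab, by omega⟩
  have hlive : ∀ v a k, IsKey G w F v a k → Live G F v := by
    intro v a k h
    obtain ⟨u, hu, p, _⟩ := h.exists_walk
    exact ⟨u, hu, ⟨p⟩⟩
  have hpar : ∀ v, ∃ u, Live G F v → v ∉ F → G.Adj v u ∧ Live G F u ∧ hops v = hops u + 1 ∧
      ∃ a b, IsKey G w F v a (hops v) ∧ IsKey G w F u b (hops u) ∧ a = w v u + b := by
    intro v
    by_cases hv : Live G F v ∧ v ∉ F
    · obtain ⟨a, ha⟩ := hhops v hv.1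
      rcases hk : hops v with _ | k
      · rw [hk] at ha; exact absurd ha.zero hv.2
      · rw [hk] at ha
        obtain ⟨u, b, hvu, hab, hb⟩ := ha.succ
        have hu := hlive u b k hb
        obtain ⟨b', hb'⟩ := hhops u hu
        have := (huniq u b k hb b' (hops u) hb').2
        subst this
        exact ⟨u, fun _ _ => ⟨hvu, hu, rfl, a, b, ha, hb, hab⟩⟩
    · exact ⟨v, fun h1 h2 => absurd ⟨h1, h2⟩ hv⟩
  choose par hpar using hpar
  -- Follow at most `k` pointers and stop on reaching `F`; `hops v` is the number of pointers needed
  -- from `v`.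
  let aux : ℕ → V → V := fun k => Nat.rec id (fun _ f v => if v ∈ F then v else f (par v)) k
  have aux_self : ∀ k, ∀ v ∈ F, aux k v = v := by
    rintro (_ | k) v hv
    · rfl
    · exact if_pos hv
  have aux_step : ∀ v, Live G F v → v ∉ F → aux (hops v) v = aux (hops (par v)) (par v) := by
    intro v hv hvF
    rw [(hpar v hv hvF).2.2.1]
    exact if_neg hvF
  refine ⟨fun v => aux (hops v) v, ⟨fun x hx => aux_self _ x hx, ?_, ?_, ?_⟩⟩
  · suffices H : ∀ k v, hops v = k → Live G F v → aux (hops v) v ∈ F from fun v => H _ v rfl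
    intro k
    induction k with
    | zero =>
      intro v hk hv
      obtain ⟨a, ha⟩ := hhops v hv
      rw [hk] at ha
      show aux (hops v) v ∈ F
      rw [aux_self _ v ha.zero]; exact ha.zero
    | succ k ih =>
      intro v hk hv
      by_cases hvF : v ∈ F
      · rw [aux_self _ v hvF]; exact hvF
      · rw [aux_step v hv hvF]
        have := hpar v hv hvF
        exact ih _ (by omega) this.2.1
  · suffices H : ∀ k v, hops v = k → Live G F v → ∃ p : G.Walk v (aux (hops v) v),
        ∀ a, IsKey G w F v a (hops v) → wlen w p = a by
      intro v hv
      obtain ⟨p, hp⟩ := H _ v rfl hv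
      obtain ⟨a, ha⟩ := hhops v hv
      exact ⟨p, fun y hy p' => (hp a ha).trans_le (ha.le_wlen y hy p')⟩
    intro k
    have hmemF : ∀ v ∈ F, ∃ p : G.Walk v (aux (hops v) v),
        ∀ a, IsKey G w F v a (hops v) → wlen w p = a := by
      intro v hvF
      rw [aux_self _ v hvF]
      refine ⟨.nil, fun a ha => ?_⟩
      have := ha.le_wlen v hvF .nil
      simp only [wlen] at this ⊢
      omega
    induction k with
    | zero =>
      intro v hk hv
      obtain ⟨a, ha⟩ := hhops v hv
      rw [hk] at ha
      exact hmemF v ha.zero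
    | succ k ih =>
      intro v hk hv
      by_cases hvF : v ∈ F
      · exact hmemF v hvF
      · obtain ⟨hadj, hu, hh, a, b, ha, hb, hab⟩ := hpar v hv hvF
        obtain ⟨p, hp⟩ := ih (par v) (by omega) hu
        rw [aux_step v hv hvF]
        refine ⟨.cons hadj p, fun a' ha' => ?_⟩
        simp only [wlen]
        rw [hp b hb, ← hab]
        exact (huniq v _ _ ha _ _ ha').1
  · suffices H : ∀ k v, hops v = k → Live G F v → Relation.ReflTransGen
        (fun a b => G.Adj a b ∧ Live G F a ∧ Live G F b ∧ aux (hops a) a = aux (hops b) b) v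
        (aux (hops v) v) from fun v => H _ v rfl
    intro k
    induction k with
    | zero =>
      intro v hk hv
      obtain ⟨a, ha⟩ := hhops v hv
      rw [hk] at ha
      rw [aux_self _ v ha.zero]
    | succ k ih =>
      intro v hk hv
      by_cases hvF : v ∈ F
      · rw [aux_self _ v hvF]
      · obtain ⟨hadj, hu, hh, -⟩ := hpar v hv hvF
        have h1 := ih (par v) (by omega) hu
        have h2 := aux_step v hv hvF
        rw [h2]
        exact Relation.ReflTransGen.head ⟨hadj, hv, hu, h2⟩ h1

/-- The graph obtained by contracting the fibres of `c`. -/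
def contraction (G : SimpleGraph V) (F : Finset V) (c : V → V) : SimpleGraph V where
  Adj x y := x ≠ y ∧ ∃ u v, Live G F u ∧ Live G F v ∧ G.Adj u v ∧ c u = x ∧ c v = y
  symm := ⟨by
    rintro x y ⟨hxy, u, v, hu, hv, huv, h1, h2⟩
    exact ⟨hxy.symm, v, u, hv, hu, huv.symm, h2, h1⟩⟩
  loopless := ⟨fun x h => h.1 rfl⟩

theorem Live.of_adj {F : Finset V} {u v : V} (h : Live G F v) (huv : G.Adj u v) : Live G F u := by
  obtain ⟨x, hx, ⟨p⟩⟩ := h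
  exact ⟨x, hx, ⟨.cons huv p⟩⟩

variable [Fintype V] [DecidableEq V]

/-- The preimages of branch sets under `c` are branch sets in `G`: every vertex is linked to its
centre within its cell, and an edge of the contraction comes from an edge of `G` between two cells.
-/
theorem HasCliqueMinor.of_contraction {F : Finset V} {c : V → V} (hc : IsVoronoi G w F c) {h : ℕ}
    (H : HasCliqueMinor (contraction G F c) F h) : HasCliqueMinor G Finset.univ h := by
  classical
  obtain ⟨C, hC, hCC⟩ := H
  let B : ℕ → Finset V := fun i => Finset.univ.filter fun v => Live G F v ∧ c v ∈ C i
  have hB : ∀ i v, v ∈ B i ↔ Live G F v ∧ c v ∈ C i := fun i v => by simp [B]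
  have hFl : ∀ x ∈ F, Live G F x := fun x hx => ⟨x, hx, ⟨.nil⟩⟩
  have hlink : ∀ i v, v ∈ B i → LinkedIn G (B i) v (c v) := by
    intro i v hv
    have hv' := (hB i v).1 hv
    have key : ∀ b, Relation.ReflTransGen
        (fun a b => G.Adj a b ∧ Live G F a ∧ Live G F b ∧ c a = c b) v b →
        LinkedIn G (B i) v b ∧ b ∈ B i := by
      intro b hb
      induction hb with
      | refl => exact ⟨Relation.ReflTransGen.refl, hv⟩
      | @tail a b _ hab ih =>
        have hbB : b ∈ B i := (hB i b).2 ⟨hab.2.2.1, hab.2.2.2 ▸ ((hB i a).1 ih.2).2⟩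
        exact ⟨ih.1.tail ⟨hab.1, ih.2, hbB⟩, hbB⟩
    exact (key _ (hc.linked v hv'.1)).1
  refine ⟨B, fun i hi => ⟨Finset.subset_univ _, ?_⟩, fun i hi j hj hij => ⟨?_, ?_⟩⟩
  · obtain ⟨hCF, hCc⟩ := hC i hi
    obtain ⟨r, hr⟩ := hCc.1
    have hCB : ∀ x ∈ C i, x ∈ B i := fun x hx =>
      (hB i x).2 ⟨hFl x (hCF hx), by rwa [hc.self x (hCF hx)]⟩
    refine Conn.of_root (hCB r hr) ?_
    have hCl : ∀ x ∈ C i, LinkedIn G (B i) r x := by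
      refine hCc.induct hr Relation.ReflTransGen.refl ?_
      rintro x hx y hy ⟨_, u, v, hu, hv, huv, rfl, rfl⟩ hrx
      have huB : u ∈ B i := (hB i u).2 ⟨hu, hx⟩
      have hvB : v ∈ B i := (hB i v).2 ⟨hv, hy⟩
      exact ((hrx.trans (hlink i u huB).symm).tail ⟨huv, huB, hvB⟩).trans (hlink i v hvB)
    intro b hb
    exact (hCl _ ((hB i b).1 hb).2).trans (hlink i b hb).symm
  · refine Finset.disjoint_left.2 fun v hvi hvj => ?_
    exact Finset.disjoint_left.1 (hCC i hi j hj hij).1 ((hB i v).1 hvi).2 ((hB j v).1 hvj).2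
  · obtain ⟨x, hx, y, hy, _, u, v, hu, hv, huv, rfl, rfl⟩ := (hCC i hi j hj hij).2
    exact ⟨u, (hB i u).2 ⟨hu, hx⟩, v, (hB j v).2 ⟨hv, hy⟩, huv⟩

end Voronoi

/-! ### Solutions that are exchanged in a single region. -/

section Swaps

variable {V : Type*} [DecidableEq V] {G : SimpleGraph V} {w : V → V → ℕ}

/-- The number of regions that contain `x`. -/
def mult (l : List (Finset V)) (x : V) : ℕ := l.countP fun R => x ∈ R

/-- The vertices of `R` that are in no other region. -/
def inner (l : List (Finset V)) (R : Finset V) : Finset V := R.filter fun x => mult l x = 1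

/-- The solution that follows `O` inside of the region `R`, contains the boundary of `R`, and follows
`L` elsewhere. -/
def mixed (l : List (Finset V)) (L O R : Finset V) : Finset V :=
  (L \ inner l R) ∪ (O ∩ inner l R) ∪ (R \ inner l R)

theorem inner_subset (l : List (Finset V)) (R : Finset V) : inner l R ⊆ R :=
  Finset.filter_subset _ _

theorem symmDiff_mixed_subset (l : List (Finset V)) (L O R : Finset V) :
    symmDiff L (mixed l L O R) ⊆ R := by
  intro x hx
  have hI := @inner_subset V _ l R x
  simp only [mixed, Finset.mem_symmDiff, Finset.mem_union, Finset.mem_sdiff, Finset.mem_inter] at hx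
  tauto

theorem mult_pos {l : List (Finset V)} {R : Finset V} (hR : R ∈ l) {x : V} (hx : x ∈ R) :
    0 < mult l x :=
  List.countP_pos_iff.2 ⟨R, hR, by simpa using hx⟩

/-- A vertex of an inner part is in no other region. -/
theorem inner_adj {l : List (Finset V)} {R R' : Finset V} (hR : R ∈ l) (hR' : R' ∈ l) {x y : V}
    (hx : x ∈ inner l R) (hxR' : x ∈ R') (hy : y ∈ R') : y ∈ R := by
  obtain ⟨hxR, hx1⟩ := Finset.mem_filter.1 hx
  by_contra hyR
  have hne : R ≠ R' := by rintro rfl; exact hyR hy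
  obtain ⟨l₁, l₂, rfl⟩ := List.append_of_mem hR
  have h1 : R' ∈ l₁ ++ l₂ := by
    simp only [List.mem_append, List.mem_cons] at hR' ⊢
    rcases hR' with h | h | h
    · exact Or.inl h
    · exact absurd h.symm hne
    · exact Or.inr h
  have h2 := mult_pos h1 hxR'
  simp only [mult, List.countP_append, List.countP_cons, hxR, decide_true, if_true] at h2 hx1
  omega

variable {F : Finset V} {c : V → V} {l : List (Finset V)} {r : ℕ} {L O : Finset V}

/-- Clients whose cell belongs to `R` are served by the mixed solution as well as by `O`. -/
theorem setDist_mixed_le_right (hc : IsVoronoi G w (L ∪ O) c)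
    (hl : IsDivision (contraction G (L ∪ O) c) (L ∪ O) r l) {R : Finset V} (hR : R ∈ l) {v : V}
    (hv : c v ∈ R) : setDist G w (mixed l L O R) v ≤ setDist G w O v := by
  refine le_setDist fun u hu p => ?_
  suffices H : ∃ x ∈ mixed l L O R, ∃ p' : G.Walk v x, wlen w p' ≤ wlen w p by
    obtain ⟨x, hx, p', hp'⟩ := H
    exact (setDist_le hx p').trans (by exact_mod_cast hp')
  have huF : u ∈ L ∪ O := Finset.mem_union_right _ hu
  induction p with
  | @nil u =>
    rw [hc.self u huF] at hv
    refine ⟨u, ?_, .nil, le_rfl⟩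
    simp only [mixed, Finset.mem_union, Finset.mem_inter, Finset.mem_sdiff]
    tauto
  | @cons a b u hab p ih =>
    have hbl : Live G (L ∪ O) b := ⟨u, huF, ⟨p⟩⟩
    have hal := hbl.of_adj hab
    -- While the cells along the walk are interior, the next one is still in `R`, because some
    -- region covers the edge of the contraction. The first cell that is not interior has an open
    -- centre, no farther away than `u`.
    by_cases hin : c a ∈ inner l R
    · have hb : c b ∈ R := by
        by_cases heq : c a = c b
        · exact heq ▸ hv
        · obtain ⟨R', hR', h1, h2⟩ := hl.cover_adj _ (hc.mem a hal) _ (hc.mem b hbl)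
            ⟨heq, a, b, hal, hbl, hab, rfl, rfl⟩
          exact inner_adj hR hR' hin h1 h2
      obtain ⟨x, hx, p', hp'⟩ := ih hb hu huF
      exact ⟨x, hx, .cons hab p', by simp only [wlen]; omega⟩
    · obtain ⟨p', hp'⟩ := hc.nearest a hal
      exact ⟨c a, Finset.mem_union_right _ (Finset.mem_sdiff.2 ⟨hv, hin⟩), p', hp' u huF _⟩

/-- Clients whose cell is not an inner one of `R` are served by the mixed solution as well as by
`L`. -/
theorem setDist_mixed_le_left (hc : IsVoronoi G w (L ∪ O) c)
    (hl : IsDivision (contraction G (L ∪ O) c) (L ∪ O) r l) {R : Finset V} (hR : R ∈ l) {v : V}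
    (hv : c v ∉ inner l R) : setDist G w (mixed l L O R) v ≤ setDist G w L v := by
  refine le_setDist fun u hu p => ?_
  suffices H : ∃ x ∈ mixed l L O R, ∃ p' : G.Walk v x, wlen w p' ≤ wlen w p by
    obtain ⟨x, hx, p', hp'⟩ := H
    exact (setDist_le hx p').trans (by exact_mod_cast hp')
  have huF : u ∈ L ∪ O := Finset.mem_union_left _ hu
  induction p with
  | @nil u =>
    rw [hc.self u huF] at hv
    refine ⟨u, ?_, .nil, le_rfl⟩
    simp only [mixed, Finset.mem_union, Finset.mem_inter, Finset.mem_sdiff]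
    tauto
  | @cons a b u hab p ih =>
    have hbl : Live G (L ∪ O) b := ⟨u, huF, ⟨p⟩⟩
    have hal := hbl.of_adj hab
    -- The first cell of `R` on the walk belongs to the boundary, since only cells of `R` are
    -- adjacent to interior ones; its centre is open.
    by_cases hin : c a ∈ R
    · obtain ⟨p', hp'⟩ := hc.nearest a hal
      exact ⟨c a, Finset.mem_union_right _ (Finset.mem_sdiff.2 ⟨hin, hv⟩), p', hp' u huF _⟩
    · have hb : c b ∉ inner l R := by
        intro hb
        by_cases heq : c a = c b
        · exact hin (heq ▸ inner_subset l R hb)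
        · obtain ⟨R', hR', h1, h2⟩ := hl.cover_adj _ (hc.mem a hal) _ (hc.mem b hbl)
            ⟨heq, a, b, hal, hbl, hab, rfl, rfl⟩
          exact hin (inner_adj hR hR' hb h2 h1)
      obtain ⟨x, hx, p', hp'⟩ := ih hb hu huF
      exact ⟨x, hx, .cons hab p', by simp only [wlen]; omega⟩

/-- The total connection cost of a client in the mixed solutions. -/
theorem sum_setDist_mixed_le (hc : IsVoronoi G w (L ∪ O) c)
    (hl : IsDivision (contraction G (L ∪ O) c) (L ∪ O) r l) (v : V) :
    (l.map fun R => setDist G w (mixed l L O R) v).sum + setDist G w L v ≤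
      l.length * setDist G w L v + setDist G w O v := by
  by_cases hv : Live G (L ∪ O) v
  swap
  · have : setDist G w O v = ⊤ := by
      refine top_le_iff.1 (le_setDist fun u hu p => ?_)
      exact absurd ⟨u, Finset.mem_union_right _ hu, ⟨p⟩⟩ hv
    rw [this]; simp
  obtain ⟨R, hR, hvR⟩ := hl.cover _ (hc.mem v hv)
  have h1 := setDist_mixed_le_right hc hl hR hvR
  obtain ⟨l₁, l₂, hll⟩ := List.append_of_mem hR
  -- The centre `c v` lies in `R` already, so it is interior to no other region of the list.
  have h2 : ∀ R' ∈ l₁ ++ l₂, setDist G w (mixed l L O R') v ≤ setDist G w L v := by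
    intro R' hR'
    have hR'l : R' ∈ l := by
      rw [hll]; simp only [List.mem_append, List.mem_cons] at hR' ⊢; tauto
    refine setDist_mixed_le_left hc hl hR'l fun hin => ?_
    obtain ⟨hvR', hm⟩ := Finset.mem_filter.1 hin
    have h3 := mult_pos hR' hvR'
    rw [hll] at hm
    simp only [mult, List.countP_append, List.countP_cons, hvR, decide_true, if_true] at h3 hm
    omega
  have hsum : ∀ l' : List (Finset V),
      (∀ R' ∈ l', setDist G w (mixed l L O R') v ≤ setDist G w L v) →
      (l'.map fun R => setDist G w (mixed l L O R) v).sum ≤ l'.length * setDist G w L v := by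
    intro l' h'
    have := List.sum_le_card_nsmul (l'.map fun R => setDist G w (mixed l L O R) v)
      (setDist G w L v) (by simpa using h')
    simpa using this
  have h3 := hsum l₁ fun R' hR' => h2 R' (List.mem_append_left _ hR')
  have h4 := hsum l₂ fun R' hR' => h2 R' (List.mem_append_right _ hR')
  have hlen : (l.length : ℕ∞) = l₁.length + l₂.length + 1 := by
    rw [hll]; push_cast [List.length_append, List.length_cons]; ring
  have hs : (l.map fun R => setDist G w (mixed l L O R) v).sum =
      (l₁.map fun R => setDist G w (mixed l L O R) v).sum + (setDist G w (mixed l L O R) v +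
        (l₂.map fun R => setDist G w (mixed l L O R) v).sum) := by
    conv_lhs => rw [congrArg (List.map _) hll]
    simp
  rw [hs, hlen]
  calc _ ≤ l₁.length * setDist G w L v + (setDist G w O v + l₂.length * setDist G w L v) +
        setDist G w L v := by gcongr
    _ = _ := by ring

theorem sum_card_filter [Fintype V] (l : List (Finset V)) (P : V → Prop) [DecidablePred P] :
    (l.map fun R => (R.filter P).card).sum = ∑ x ∈ Finset.univ.filter P, mult l x := by
  induction l with
  | nil => simp [mult]
  | cons R l ih =>
    have : ∀ x, mult (R :: l) x = mult l x + if x ∈ R then 1 else 0 := by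
      intro x; simp [mult, List.countP_cons]
    simp only [List.map_cons, List.sum_cons, ih, this, Finset.sum_add_distrib]
    rw [add_comm, Finset.sum_boole, Finset.filter_filter]
    simp only [Nat.cast_id, Nat.add_left_cancel_iff]
    congr 1
    ext x; simp [and_comm]

/-- The total number of facilities of the mixed solutions. -/
theorem sum_card_mixed_le [Fintype V] {H : SimpleGraph V} (hl : IsDivision H (L ∪ O) r l) {q : ℕ}
    (hq : 24 * q * (l.map Finset.card).sum ≤ (24 * q + 1) * (L ∪ O).card) :
    8 * q * ((l.map fun R => (mixed l L O R).card).sum + L.card) ≤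
      8 * q * (l.length * L.card + O.card) + (L ∪ O).card := by
  classical
  set F := L ∪ O with hF
  have hsingle : ∀ R, (mixed l L O R).card + (R.filter fun x => mult l x = 1 ∧ x ∈ L).card ≤
      L.card + (R.filter fun x => mult l x = 1 ∧ x ∈ O).card +
        (R.filter fun x => mult l x ≠ 1).card := by
    intro R
    have h1 := Finset.card_union_le ((L \ inner l R) ∪ (O ∩ inner l R)) (R \ inner l R)
    have h2 := Finset.card_union_le (L \ inner l R) (O ∩ inner l R)
    have h3 : (R.filter fun x => mult l x = 1 ∧ x ∈ L) = L ∩ inner l R := by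
      ext x; simp only [inner, Finset.mem_filter, Finset.mem_inter]; tauto
    have h4 : (R.filter fun x => mult l x = 1 ∧ x ∈ O) = O ∩ inner l R := by
      ext x; simp only [inner, Finset.mem_filter, Finset.mem_inter]; tauto
    have h5 : (R.filter fun x => mult l x ≠ 1) = R \ inner l R := by
      ext x; simp only [inner, Finset.mem_filter, Finset.mem_sdiff]; tauto
    have h6 := Finset.card_sdiff_add_card_inter L (inner l R)
    rw [h3, h4, h5]
    unfold mixed
    omega
  have hsum : (l.map fun R => (mixed l L O R).card).sum +
      ∑ x ∈ Finset.univ.filter (fun x => mult l x = 1 ∧ x ∈ L), mult l x ≤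
      l.length * L.card + ∑ x ∈ Finset.univ.filter (fun x => mult l x = 1 ∧ x ∈ O), mult l x +
        ∑ x ∈ Finset.univ.filter (fun x => mult l x ≠ 1), mult l x := by
    rw [← sum_card_filter, ← sum_card_filter, ← sum_card_filter]
    generalize hgl : l = l' at hsingle
    have : ∀ l₁ : List (Finset V), (l₁.map fun R => (mixed l' L O R).card).sum +
      (l₁.map fun R => (R.filter fun x => mult l' x = 1 ∧ x ∈ L).card).sum ≤ l₁.length * L.card +
      (l₁.map fun R => (R.filter fun x => mult l' x = 1 ∧ x ∈ O).card).sum +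
      (l₁.map fun R => (R.filter fun x => mult l' x ≠ 1).card).sum := by
      intro l₁
      induction l₁ with
      | nil => simp
      | cons R l₁ ih =>
        have := hsingle R
        simp only [List.map_cons, List.sum_cons, List.length_cons]
        nlinarith
    exact this l'
  have hout : ∀ x, x ∉ F → mult l x = 0 := by
    intro x hx
    refine List.countP_eq_zero.2 fun R hR => ?_
    simpa using fun h => hx (hl.subset R hR h)
  have hin : ∀ x ∈ F, 1 ≤ mult l x := by
    intro x hx
    obtain ⟨R, hR, hxR⟩ := hl.cover x hx
    exact mult_pos hR hxR
  have hone : ∀ S : Finset V, ∑ x ∈ Finset.univ.filter (fun x => mult l x = 1 ∧ x ∈ S), mult l x =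
      (S.filter fun x => mult l x = 1).card := by
    intro S
    rw [Finset.card_eq_sum_ones]
    refine Finset.sum_congr ?_ fun x hx => ?_
    · ext x; simp [and_comm]
    · exact (Finset.mem_filter.1 hx).2
  have hmany : ∑ x ∈ Finset.univ.filter (fun x => mult l x ≠ 1), mult l x =
      ∑ x ∈ F.filter (fun x => mult l x ≠ 1), mult l x := by
    symm
    refine Finset.sum_subset (fun x hx => by simpa using (Finset.mem_filter.1 hx).2) ?_
    intro x hx hx'
    refine hout x fun hxF => hx' (Finset.mem_filter.2 ⟨hxF, (Finset.mem_filter.1 hx).2⟩)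
  have htot : (l.map Finset.card).sum = ∑ x ∈ F, mult l x := by
    have h1 := sum_card_filter l fun _ => True
    simp only [Finset.filter_true] at h1
    have h2 : (l.map Finset.card).sum = (l.map fun R => R.card).sum := rfl
    rw [h2, h1]
    symm
    exact Finset.sum_subset (Finset.subset_univ _) fun x _ hx => hout x hx
  have hO : (O.filter fun x => mult l x = 1).card ≤ O.card := Finset.card_filter_le _ _
  have hL : L.card ≤ (L.filter fun x => mult l x = 1).card + (F.filter fun x => mult l x ≠ 1).card := by
    rw [← Finset.card_filter_add_card_filter_not (s := L) fun x => mult l x = 1]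
    gcongr
    exact Finset.subset_union_left
  -- A boundary point of multiplicity `μ ≥ 2` is charged `μ` times for being opened, and once
  -- because no swap closes it. Here `μ + 1 ≤ 3 (μ - 1)`, and the division bounds the sum of all `μ
  -- - 1` by `|F| / (24 q)`, whence the `8 q`.
  have hB : ∑ x ∈ F.filter (fun x => mult l x ≠ 1), mult l x +
      (F.filter fun x => mult l x ≠ 1).card + 3 * F.card ≤ 3 * ∑ x ∈ F, mult l x := by
    rw [Finset.card_eq_sum_ones, ← Finset.sum_add_distrib, Finset.sum_filter,
      Finset.card_eq_sum_ones, Finset.mul_sum, Finset.mul_sum, ← Finset.sum_add_distrib]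
    refine Finset.sum_le_sum fun x hx => ?_
    have := hin x hx
    split_ifs with h <;> omega
  rw [hone, hone, hmany] at hsum
  rw [htot] at hq
  set B := ∑ x ∈ F.filter (fun x => mult l x ≠ 1), mult l x
  set D := (F.filter fun x => mult l x ≠ 1).card
  set s := ∑ x ∈ F, mult l x
  have h8 : 8 * q * (B + D) ≤ F.card := by
    have := Nat.mul_le_mul_left (8 * q) hB
    nlinarith
  have h9 : (l.map fun R => (mixed l L O R).card).sum + L.card ≤
      l.length * L.card + O.card + (B + D) := by omega
  have := Nat.mul_le_mul_left (8 * q) h9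
  nlinarith

end Swaps

/-! ### The averaged inequality over all swaps. -/

section LocalSearch

variable {V : Type*} [Fintype V] [DecidableEq V] (G : SimpleGraph V) (w : V → V → ℕ)

/-- The facility location cost for natural edge lengths and a natural opening cost. -/
noncomputable def natCost (f : ℕ) (C S : Finset V) : ℕ∞ := f * S.card + ∑ c ∈ C, setDist G w S c

variable {G w}

/-- If `L` is much more expensive than `O`, then the best of these swaps gains a fixed fraction of
the excess. The error term is needed only for the facilities on region boundaries; connection costs
cause no loss. -/
theorem exists_swaps {h q : ℕ} (hq : 1 ≤ q) (hG : ¬ HasCliqueMinor G Finset.univ h) (f : ℕ)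
    (C L O : Finset V) (hne : (L ∪ O).Nonempty) :
    ∃ l : List (Finset V), 1 ≤ l.length ∧ l.length ≤ 2 * Fintype.card V ∧
      (∀ M ∈ l, (symmDiff L M).card ≤ (384 * (h + 1) ^ 2 * q) ^ 2) ∧
      8 * q * ((l.map (natCost G w f C)).sum + natCost G w f C L) ≤
        8 * q * (l.length * natCost G w f C L + natCost G w f C O) +
          (natCost G w f C L + natCost G w f C O) := by
  obtain ⟨c, hc⟩ := exists_isVoronoi (G := G) (w := w) (L ∪ O)
  obtain ⟨l, hl, hs⟩ := exists_division (G := contraction G (L ∪ O) c) (W := L ∪ O) hq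
    fun H => hG (H.of_contraction hc)
  refine ⟨l.map (mixed l L O), ?_, ?_, ?_, ?_⟩
  · obtain ⟨x, hx⟩ := hne
    obtain ⟨R, hR, _⟩ := hl.cover x hx
    rw [List.length_map]
    exact List.length_pos_of_mem hR
  · have h1 : l.length ≤ (l.map Finset.card).sum := by
      have := List.length_le_sum_of_one_le (l.map Finset.card) (by
        simpa using fun R hR => (hl.nonempty R hR))
      simpa using this
    have h2 : (L ∪ O).card ≤ Fintype.card V := Finset.card_le_univ _
    rw [List.length_map]
    by_contra! hlt
    have h3 : 2 * (L ∪ O).card + 1 ≤ (l.map Finset.card).sum := by omega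
    have h4 := Nat.mul_le_mul_left (24 * q) h3
    have h5 : (L ∪ O).card ≤ q * (L ∪ O).card := Nat.le_mul_of_pos_left _ hq
    nlinarith
  · intro M hM
    obtain ⟨R, hR, rfl⟩ := List.mem_map.1 hM
    exact (Finset.card_le_card (symmDiff_mixed_subset l L O R)).trans (hl.card_le R hR)
  · have hcard := sum_card_mixed_le hl hs
    rw [List.map_map, List.length_map]
    have hcost : (l.map (natCost G w f C ∘ mixed l L O)).sum =
        f * ((l.map fun R => (mixed l L O R).card).sum : ℕ) +
          ∑ v ∈ C, (l.map fun R => setDist G w (mixed l L O R) v).sum := by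
      generalize mixed l L O = m
      clear hcard hs hl
      induction l with
      | nil => simp
      | cons R l ih =>
        simp only [List.map_cons, List.sum_cons, ih, Function.comp_apply, natCost,
          Finset.sum_add_distrib, Nat.cast_add]
        ring
    rw [hcost]
    set k : ℕ := l.length
    set m : ℕ := (l.map fun R => (mixed l L O R).card).sum
    have hconn : ∑ v ∈ C, (l.map fun R => setDist G w (mixed l L O R) v).sum +
        ∑ v ∈ C, setDist G w L v ≤
        k * ∑ v ∈ C, setDist G w L v + ∑ v ∈ C, setDist G w O v := by
      rw [← Finset.sum_add_distrib, Finset.mul_sum, ← Finset.sum_add_distrib]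
      exact Finset.sum_le_sum fun v _ => sum_setDist_mixed_le hc hl v
    have hfac : 8 * q * (f * m + f * L.card) ≤
        8 * q * (k * (f * L.card) + f * O.card) + (f * L.card + f * O.card) := by
      have h1 := Nat.mul_le_mul_left f hcard
      have h2 := Nat.mul_le_mul_left f (Finset.card_union_le L O)
      nlinarith
    have hfac' : (8 * q * (f * m + f * L.card) : ℕ∞) ≤
        8 * q * (k * (f * L.card) + f * O.card) + (f * L.card + f * O.card) := by
      exact_mod_cast hfac
    unfold natCost
    set a := ∑ v ∈ C, (l.map fun R => setDist G w (mixed l L O R) v).sum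
    set b := ∑ v ∈ C, setDist G w L v
    set d := ∑ v ∈ C, setDist G w O v
    calc (8 * q * (f * m + a + (f * L.card + b)) : ℕ∞)
        = 8 * q * (f * m + f * L.card) + 8 * q * (a + b) := by ring
      _ ≤ 8 * q * (k * (f * L.card) + f * O.card) + (f * L.card + f * O.card) +
          8 * q * (k * b + d) := by gcongr
      _ ≤ 8 * q * (k * (f * L.card) + f * O.card) + (f * L.card + f * O.card) +
          8 * q * (k * b + d) + (b + d) := le_self_add
      _ = _ := by ring

end LocalSearch

/-! ### Register updates and counted loops. -/

section Machine

@[simp] theorem State.setReg_reg (s : State) (x a y : ℕ) :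
    (s.setReg x a).reg y = if y = x then a else s.reg y := by
  simp [State.setReg, Function.update_apply]

@[simp] theorem State.setReg_mem (s : State) (x a : ℕ) : (s.setReg x a).mem = s.mem := rfl

@[simp] theorem State.setMem_reg (s : State) (x a : ℕ) : (s.setMem x a).reg = s.reg := rfl

@[simp] theorem State.setMem_mem (s : State) (x a y : ℕ) :
    (s.setMem x a).mem y = if y = x then a else s.mem y := by
  simp [State.setMem, Function.update_apply]

/-- A loop that is executed `n` times. -/
theorem Exec.loop_of_inv {x n τ : ℕ} {Q : Prog} (Inv : ℕ → State → Prop)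
    (hx : ∀ i s, i ≤ n → Inv i s → s.reg x = n - i)
    (hstep : ∀ i s, i < n → Inv i s → ∃ t s', Exec Q s t s' ∧ t ≤ τ ∧ Inv (i + 1) s')
    {s : State} (h0 : Inv 0 s) :
    ∃ t s', Exec (Prog.loop x Q) s t s' ∧ t ≤ n * (τ + 1) + 1 ∧ Inv n s' := by
  suffices H : ∀ j i s, i + j = n → Inv i s →
      ∃ t s', Exec (Prog.loop x Q) s t s' ∧ t ≤ j * (τ + 1) + 1 ∧ Inv n s' from
    H n 0 s (by omega) h0
  intro j
  induction j with
  | zero =>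
    intro i s hi hs
    obtain rfl : i = n := by omega
    exact ⟨1, s, Exec.loopDone (by simpa using hx i s le_rfl hs), by omega, hs⟩
  | succ j ih =>
    intro i s hi hs
    obtain ⟨t₁, s₁, hQ, ht₁, hs₁⟩ := hstep i s (by omega) hs
    obtain ⟨t₂, s₂, hL, ht₂, hs₂⟩ := ih (i + 1) s₁ (by omega) hs₁
    refine ⟨_, s₂, Exec.loopStep ?_ hQ hL, ?_, hs₂⟩
    · rw [hx i s (by omega) hs]; omega
    · rw [Nat.succ_mul]; omega

end Machine

/-! ### A calculus of programs with capped loops. -/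

section Computable

/-- The data available to computations: a bound on the number of iterations of each loop, and the
memory. -/
structure Root where
  fuel : ℕ
  mem : ℕ → ℕ

/-- Contexts of computations: the root data and finitely many local variables. -/
class Ctx (α : Type) where
  root : α → Root
  len : ℕ
  get : α → ℕ → ℕ

instance : Ctx Root := ⟨id, 0, fun _ _ => 0⟩

instance {α : Type} [Ctx α] : Ctx (α × ℕ) :=
  ⟨fun p => Ctx.root p.1, Ctx.len α + 1, fun p i => if i = Ctx.len α then p.2 else Ctx.get p.1 i⟩

variable {α : Type} [Ctx α]

/-- The loop bound. -/
def fuel (a : α) : ℕ := (Ctx.root a).fuel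

/-- The content of a memory cell. -/
def cell (a : α) (i : ℕ) : ℕ := (Ctx.root a).mem i

/-- The local variables of `a` are in the registers given by `ρ`. -/
structure Holds (ρ : ℕ → ℕ) (a : α) (s : State) : Prop where
  fuel : s.reg 0 = fuel a
  mem : s.mem = cell a
  var : ∀ i < Ctx.len α, s.reg (ρ i) = Ctx.get a i

/-- `s'` differs from `s` at most in the registers from `d` on. -/
def SameBelow (d : ℕ) (s s' : State) : Prop := (∀ i < d, s'.reg i = s.reg i) ∧ s'.mem = s.mem

theorem SameBelow.trans {d d' : ℕ} (hd : d ≤ d') {s s' s'' : State} (h : SameBelow d s s')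
    (h' : SameBelow d' s' s'') : SameBelow d s s'' :=
  ⟨fun i hi => (h'.1 i (by omega)).trans (h.1 i hi), h'.2.trans h.2⟩

theorem SameBelow.setReg {d : ℕ} {s s' : State} (h : SameBelow d s s') {x : ℕ} (hx : d ≤ x)
    (a : ℕ) : SameBelow d s (s'.setReg x a) :=
  ⟨fun i hi => by rw [State.setReg_reg, if_neg (by omega), h.1 i hi], h.2⟩

theorem SameBelow.refl (d : ℕ) (s : State) : SameBelow d s s := ⟨fun _ _ => rfl, rfl⟩

theorem Holds.of_same {ρ : ℕ → ℕ} {a : α} {s s' : State} {d : ℕ} (h : Holds ρ a s) (hd : 1 ≤ d)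
    (hρ : ∀ i < Ctx.len α, ρ i < d) (hs : SameBelow d s s') : Holds ρ a s' :=
  ⟨(hs.1 0 hd).trans h.fuel, hs.2.trans h.mem, fun i hi => (hs.1 _ (hρ i hi)).trans (h.var i hi)⟩

/-- The program `P` computes `f` into register `d`, for local variables placed by `ρ`, in time
`T`. -/
def Computes (P : Prog) (T : Polynomial ℕ) (ρ : ℕ → ℕ) (d : ℕ) (f : α → ℕ) : Prop :=
  ∀ (a : α) (s : State), Holds ρ a s → ∃ t s', Exec P s t s' ∧ t ≤ T.eval (fuel a) ∧
    s'.reg d = f a ∧ SameBelow d s s'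

/-- `f` is computed by a program, in time polynomial in the bound on the number of iterations of each
loop. -/
def Comp (f : α → ℕ) : Prop :=
  ∀ (ρ : ℕ → ℕ) (d : ℕ), 1 ≤ d → (∀ i < Ctx.len α, ρ i < d) → ∃ P T, Computes P T ρ d f

theorem Comp.lit (k : ℕ) : Comp fun _ : α => k := fun ρ d _ _ =>
  ⟨Prog.const d k, 1, fun a s _ => ⟨1, _, Exec.const d k s, by simp, by simp,
    (SameBelow.refl d s).setReg le_rfl _⟩⟩

/-- There is no move between registers, so the target is cleared and the source added; this requires
distinct registers. -/
theorem exec_copy (x y : ℕ) (hxy : y ≠ x) (s : State) :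
    ∃ s', Exec (Prog.seq (Prog.const x 0) (Prog.add x x y)) s 2 s' ∧ s' = s.setReg x (s.reg y) := by
  refine ⟨_, Exec.seq (Exec.const x 0 s) (Exec.add x x y _), ?_⟩
  simp [State.setReg, Function.update_of_ne hxy]

theorem Comp.copy {f : α → ℕ}
    (h : ∀ (ρ : ℕ → ℕ) (d : ℕ), 1 ≤ d → (∀ i < Ctx.len α, ρ i < d) →
      ∃ y < d, ∀ (a : α) s, Holds ρ a s → s.reg y = f a) : Comp f := fun ρ d hd hρ => by
  obtain ⟨y, hy, hf⟩ := h ρ d hd hρ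
  refine ⟨.seq (.const d 0) (.add d d y), 2, fun a s hs => ?_⟩
  obtain ⟨s', he, rfl⟩ := exec_copy d y (by omega) s
  exact ⟨2, _, he, by simp [Polynomial.eval_ofNat], by simpa using hf a s hs,
    (SameBelow.refl d s).setReg le_rfl _⟩

theorem Comp.fuel : Comp fun a : α => UFL.fuel a :=
  Comp.copy fun _ _ hd _ => ⟨0, hd, fun _ _ hs => hs.fuel⟩

theorem Comp.var0 : Comp fun p : α × ℕ => p.2 :=
  Comp.copy fun ρ _ _ hρ => ⟨ρ (Ctx.len α), hρ _ (Nat.lt_succ_self _), fun a s hs => by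
    simpa [Ctx.get] using hs.var (Ctx.len α) (Nat.lt_succ_self _)⟩

/-- Outer variables keep their indices when a context is extended, so the same program works. -/
theorem Comp.weak {f : α → ℕ} (h : Comp f) : Comp fun p : α × ℕ => f p.1 := fun ρ d hd hρ => by
  obtain ⟨P, T, hP⟩ := h ρ d hd fun i hi => hρ i (Nat.lt_succ_of_lt hi)
  refine ⟨P, T, fun p s hs => hP p.1 s ⟨hs.fuel, hs.mem, fun i hi => ?_⟩⟩
  have := hs.var i (Nat.lt_succ_of_lt hi)
  simpa [Ctx.get, hi.ne] using this

theorem Comp.unop {op : ℕ → ℕ → Prog} {g : α → ℕ → ℕ}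
    (hop : ∀ x y a s, s.mem = cell a → Exec (op x y) s 1 (s.setReg x (g a (s.reg y)))) {f : α → ℕ}
    (hf : Comp f) : Comp fun a => g a (f a) := fun ρ d hd hρ => by
  obtain ⟨P, T, hP⟩ := hf ρ d hd hρ
  refine ⟨Prog.seq P (op d d), T + 1, fun a s hs => ?_⟩
  obtain ⟨t, s', he, ht, hv, hsame⟩ := hP a s hs
  refine ⟨_, _, Exec.seq he (hop d d a s' (hsame.2.trans hs.mem)), by simpa using ht, by simp [hv],
    hsame.setReg le_rfl _⟩

theorem Comp.binop {op : ℕ → ℕ → ℕ → Prog} {g : ℕ → ℕ → ℕ}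
    (hop : ∀ x y z (s : State), Exec (op x y z) s 1 (s.setReg x (g (s.reg y) (s.reg z)))) {f₁ f₂ : α → ℕ}
    (h₁ : Comp f₁) (h₂ : Comp f₂) : Comp fun a => g (f₁ a) (f₂ a) := fun ρ d hd hρ => by
  obtain ⟨P₁, T₁, hP₁⟩ := h₁ ρ d hd hρ
  obtain ⟨P₂, T₂, hP₂⟩ := h₂ ρ (d + 1) (by omega) fun i hi => (hρ i hi).trans (by omega)
  refine ⟨Prog.seq (Prog.seq P₁ P₂) (op d d (d + 1)), T₁ + T₂ + 1, fun a s hs => ?_⟩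
  obtain ⟨t₁, s₁, he₁, ht₁, hv₁, hsame₁⟩ := hP₁ a s hs
  obtain ⟨t₂, s₂, he₂, ht₂, hv₂, hsame₂⟩ := hP₂ a s₁ (hs.of_same hd hρ hsame₁)
  refine ⟨_, _, Exec.seq (Exec.seq he₁ he₂) (hop _ _ _ _), ?_, ?_, ?_⟩
  · simp only [Polynomial.eval_add, Polynomial.eval_one]; omega
  · simp [hv₂, hsame₂.1 d (by omega), hv₁]
  · exact (hsame₁.trans (by omega) hsame₂).setReg le_rfl _

theorem Comp.add {f g : α → ℕ} (hf : Comp f) (hg : Comp g) : Comp fun a => f a + g a :=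
  Comp.binop Exec.add hf hg

theorem Comp.sub {f g : α → ℕ} (hf : Comp f) (hg : Comp g) : Comp fun a => f a - g a :=
  Comp.binop Exec.sub hf hg

theorem Comp.half {f : α → ℕ} (hf : Comp f) : Comp fun a => f a / 2 :=
  Comp.unop (g := fun _ x => x / 2) (fun x y _ s _ => Exec.half x y s) hf

theorem Comp.cell {f : α → ℕ} (hf : Comp f) : Comp fun a => UFL.cell a (f a) :=
  Comp.unop (g := fun a x => UFL.cell a x)
    (fun x y a s h => by rw [← h]; exact Exec.load x y s) hf

theorem Comp.ite {c f g : α → ℕ} (hc : Comp c) (hf : Comp f) (hg : Comp g) :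
    Comp fun a => if c a ≠ 0 then f a else g a := fun ρ d hd hρ => by
  obtain ⟨P, T, hP⟩ := hc ρ d hd hρ
  obtain ⟨P₁, T₁, hP₁⟩ := hf ρ d hd hρ
  obtain ⟨P₂, T₂, hP₂⟩ := hg ρ d hd hρ
  refine ⟨Prog.seq P (Prog.ite d P₁ P₂), T + 1 + T₁ + T₂, fun a s hs => ?_⟩
  obtain ⟨t, s', he, ht, hv, hsame⟩ := hP a s hs
  obtain ⟨t₁, s₁, he₁, ht₁, hv₁, hsame₁⟩ := hP₁ a s' (hs.of_same hd hρ hsame)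
  obtain ⟨t₂, s₂, he₂, ht₂, hv₂, hsame₂⟩ := hP₂ a s' (hs.of_same hd hρ hsame)
  by_cases h : c a = 0
  · refine ⟨_, s₂, Exec.seq he (Exec.iteFalse (hv.trans h) he₂), ?_, by simp [h, hv₂],
      hsame.trans le_rfl hsame₂⟩
    simp only [Polynomial.eval_add, Polynomial.eval_one]; omega
  · refine ⟨_, s₁, Exec.seq he (Exec.iteTrue (by rwa [hv]) he₁), ?_, by simp [h, hv₁],
      hsame.trans le_rfl hsame₁⟩
    simp only [Polynomial.eval_add, Polynomial.eval_one]; omega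

theorem Comp.ite_lt {x y f g : α → ℕ} (hx : Comp x) (hy : Comp y) (hf : Comp f) (hg : Comp g) :
    Comp fun a => if x a < y a then f a else g a := by
  have : (fun a => if x a < y a then f a else g a) = fun a => if y a - x a ≠ 0 then f a else g a := by
    funext a
    congr 1
    rw [eq_iff_iff]; omega
  rw [this]
  exact (hy.sub hx).ite hf hg

theorem Comp.ite_eq {x y f g : α → ℕ} (hx : Comp x) (hy : Comp y) (hf : Comp f) (hg : Comp g) :
    Comp fun a => if x a = y a then f a else g a := by
  have : (fun a => if x a = y a then f a else g a) =
      fun a => if (y a - x a) + (x a - y a) ≠ 0 then g a else f a := by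
    funext a
    by_cases h : x a = y a
    · simp [h]
    · have : (y a - x a) + (x a - y a) ≠ 0 := by omega
      rw [if_neg h, if_pos this]
  rw [this]
  exact ((hy.sub hx).add (hx.sub hy)).ite hg hf

/-- Iterate `B 0`, `B 1`, …, `B (n - 1)`, starting with `x`. -/
def natFold (B : ℕ → ℕ → ℕ) (x : ℕ) : ℕ → ℕ
  | 0 => x
  | n + 1 => B n (natFold B x n)

theorem natFold_succ (B : ℕ → ℕ → ℕ) (x n : ℕ) :
    natFold B x (n + 1) = B n (natFold B x n) := rfl

/-- Iterate `B 0`, `B 1`, …, `B (n - 1)`, but at most `F` of them. -/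
def fold (F n x : ℕ) (B : ℕ → ℕ → ℕ) : ℕ := natFold B x (min n F)

/-- The cap keeps the time polynomial: at most `fuel` runs of a polynomial body. Register `d` counts
down, `d + 1` is the index, `d + 2` the accumulator, `d + 3` receives the value of the body, and `d
+ 4` holds `1`. -/
theorem Comp.fold {cnt init : α → ℕ} {B : α → ℕ → ℕ → ℕ} (hcnt : Comp cnt) (hinit : Comp init)
    (hB : Comp fun p : (α × ℕ) × ℕ => B p.1.1 p.1.2 p.2) :
    Comp fun a => UFL.fold (UFL.fuel a) (cnt a) (init a) (B a) := fun ρ d hd hρ => by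
  obtain ⟨P₁, T₁, hP₁⟩ := hcnt ρ d hd hρ
  obtain ⟨P₂, T₂, hP₂⟩ := hinit ρ (d + 2) (by omega) fun i hi => (hρ i hi).trans (by omega)
  set m := Ctx.len α with hm
  let ρ' : ℕ → ℕ := fun i => if i < m then ρ i else if i = m then d + 1 else d + 2
  obtain ⟨Q, T, hQ⟩ := hB ρ' (d + 3) (by omega) (by
    intro i _
    simp only [ρ']
    split_ifs with h1 h2
    · have := hρ i h1; omega
    · omega
    · omega)
  let body : Prog := .seq Q (.seq (.seq (.const (d + 2) 0) (.add (d + 2) (d + 2) (d + 3)))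
    (.seq (.const (d + 4) 1) (.seq (.add (d + 1) (d + 1) (d + 4)) (.sub d d (d + 4)))))
  -- Two truncated subtractions turn a count `x` into `x - (x - F) = min x F`.
  refine ⟨.seq P₁ (.seq (.sub (d + 1) d 0) (.seq (.sub d d (d + 1)) (.seq P₂ (.seq (.const (d + 1) 0)
    (.seq (.loop d body) (.seq (.const d 0) (.add d d (d + 2)))))))),
    T₁ + T₂ + .X * (T + 6) + 6, fun a s hs => ?_⟩
  obtain ⟨t₁, s₁, he₁, ht₁, hv₁, hsame₁⟩ := hP₁ a s hs
  set F := UFL.fuel a with hF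
  set n := min (cnt a) F with hn
  have h0 : s₁.reg 0 = F := (hsame₁.1 0 hd).trans hs.fuel
  set s₂ := s₁.setReg (d + 1) (s₁.reg d - s₁.reg 0) with hs₂
  set s₃ := s₂.setReg d (s₂.reg d - s₂.reg (d + 1)) with hs₃
  have hsame₃ : SameBelow d s s₃ := (hsame₁.setReg (by omega) _).setReg le_rfl _
  have hv₃ : s₃.reg d = n := by
    rw [hs₃, hs₂]; simp [hv₁, h0]; omega
  obtain ⟨t₄, s₄, he₄, ht₄, hv₄, hsame₄⟩ := hP₂ a s₃ (hs.of_same hd hρ hsame₃)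
  set s₅ := s₄.setReg (d + 1) 0 with hs₅
  have hsame₅ : SameBelow d s s₅ := (hsame₃.trans (by omega) hsame₄).setReg (by omega) _
  let Inv : ℕ → State → Prop := fun i s' =>
    s'.reg d = n - i ∧ s'.reg (d + 1) = i ∧ s'.reg (d + 2) = natFold (B a) (init a) i ∧
      SameBelow d s s'
  have hInv0 : Inv 0 s₅ := by
    refine ⟨?_, by simp [hs₅], ?_, hsame₅⟩
    · simp [hs₅, hsame₄.1 d (by omega), hv₃]
    · simp [hs₅, hv₄, natFold]
  obtain ⟨t₆, s₆, he₆, ht₆, hi₆⟩ := Exec.loop_of_inv (x := d) (n := n) (Q := body)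
    (τ := T.eval F + 5) Inv (fun i s' _ h => h.1) (by
      rintro i s' hi ⟨h1, h2, h3, h4⟩
      have hH : Holds ρ' (((a, i), natFold (B a) (init a) i) : (α × ℕ) × ℕ) s' := by
        have := hs.of_same hd hρ h4
        refine ⟨this.fuel, this.mem, fun k hk => ?_⟩
        simp only [ρ', Ctx.get, Ctx.len, ← hm]
        by_cases hk1 : k < m
        · rw [if_pos hk1, if_neg (by omega), if_neg (by omega)]
          exact this.var k hk1
        · by_cases hk2 : k = m
          · rw [if_neg hk1, if_pos hk2, if_neg (by omega), if_pos hk2, h2]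
          · have hk3 : k < m + 1 + 1 := hk
            rw [if_neg hk1, if_neg hk2, if_pos (by omega), h3]
      obtain ⟨t, s'', he, ht, hv, hsame⟩ := hQ _ s' hH
      refine ⟨_, _, Exec.seq he (Exec.seq (Exec.seq (Exec.const _ _ _) (Exec.add _ _ _ _))
        (Exec.seq (Exec.const _ _ _) (Exec.seq (Exec.add _ _ _ _) (Exec.sub _ _ _ _)))), ?_,
        ?_, ?_, ?_, ?_⟩
      · have : t ≤ T.eval F := ht
        omega
      · simp [hsame.1 d (by omega), h1]; omega
      · simp [hsame.1 (d + 1) (by omega), h2]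
      · simp [hv, natFold]
      · exact (((((h4.trans (by omega) hsame).setReg (by omega) _).setReg (by omega) _).setReg
          (by omega) _).setReg (by omega) _).setReg (by omega) _) hInv0
  obtain ⟨h61, h62, h63, h64⟩ := hi₆
  refine ⟨_, _, Exec.seq he₁ (Exec.seq (Exec.sub _ _ _ _) (Exec.seq (Exec.sub _ _ _ _) (Exec.seq he₄
    (Exec.seq (Exec.const _ _ _) (Exec.seq he₆ (Exec.seq (Exec.const _ _ _)
    (Exec.add _ _ _ _))))))), ?_, ?_, ?_⟩
  · have hnF : n * (T.eval F + 5 + 1) ≤ F * (T.eval F + 6) :=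
      Nat.mul_le_mul_right _ (min_le_right _ _)
    rw [← hF] at ht₄
    simp only [Polynomial.eval_add, Polynomial.eval_mul, Polynomial.eval_X, Polynomial.eval_ofNat]
    omega
  · simp [h63, UFL.fold, hn, hF]
  · exact (h64.setReg le_rfl _).setReg le_rfl _

theorem Comp.var1 : Comp fun p : (α × ℕ) × ℕ => p.1.2 := Comp.var0.weak

end Computable

section Algorithm

/-! ### The local search algorithm

All functions have the maximal number `F` of iterations of a loop as first argument; `m` is the
content of the memory. -/

/-- `x * 2 ^ k` -/
def shl (F x k : ℕ) : ℕ := fold F k x fun _ y => y + y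

/-- `x / 2 ^ k` -/
def shr (F x k : ℕ) : ℕ := fold F k x fun _ y => y / 2

/-- `x % 2 ^ k` -/
def low (F x k : ℕ) : ℕ := x - shl F (shr F x k) k

/-- `x * y`, by repeated addition -/
def mulSmall (F x y : ℕ) : ℕ := fold F y 0 fun _ z => z + x

/-- `x * y`, by repeated doubling -/
def mulBig (F x y : ℕ) : ℕ :=
  fold F F 0 fun i z => if low F (shr F y i) 1 ≠ 0 then z + shl F x i else z

/-- The number with index `i` in the array `A` of numbers of `w` bits -/
def arrayGet (F w A i : ℕ) : ℕ := low F (shr F A (mulSmall F w i)) w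

/-- The array `f 0, …, f (n - 1)` of numbers of `w` bits -/
def arrayOf (F w n : ℕ) (f : ℕ → ℕ) : ℕ := fold F n 0 fun i z => z + shl F (f i) (mulSmall F w i)

/-- `f 0 + … + f (n - 1)` -/
def sumTo (F n : ℕ) (f : ℕ → ℕ) : ℕ := fold F n 0 fun i z => z + f i

/-- The three numbers of an entry of the adjacency matrix -/
def edgeAt (m : ℕ → ℕ) (j c : ℕ) : ℕ := m (5 + m 2 + (j + j + j) + c)

/-- The denominator of an entry of the adjacency matrix, and `1` for non-edges -/
def denAt (m : ℕ → ℕ) (j : ℕ) : ℕ := if edgeAt m j 0 ≠ 0 then edgeAt m j 2 else 1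

/-- The opening cost, multiplied by all denominators -/
def openInt (F : ℕ) (m : ℕ → ℕ) : ℕ :=
  fold F (mulSmall F (m 2) (m 2)) (m 3) fun i z => mulBig F z (denAt m i)

/-- An edge weight, multiplied by all denominators -/
def weightInt (F : ℕ) (m : ℕ → ℕ) (j : ℕ) : ℕ :=
  fold F (mulSmall F (m 2) (m 2)) (m 4) fun i z =>
    mulBig F z (if i = j then edgeAt m i 1 else denAt m i)

/-- The exponent of the number that replaces infinity -/
def width (F : ℕ) (m : ℕ → ℕ) (l : ℕ) : ℕ := mulSmall F l (mulSmall F (m 2) (m 2) + 5)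

/-- The initial distances from the set `S` -/
def distInit (F : ℕ) (m : ℕ → ℕ) (W S : ℕ) : ℕ :=
  arrayOf F (W + 1) (m 2) fun v => if arrayGet F 1 S v ≠ 0 then 0 else shl F 1 W

/-- One round of the algorithm of Bellman and Ford for the vertex `v` -/
def relaxAt (F : ℕ) (m : ℕ → ℕ) (W d v : ℕ) : ℕ :=
  fold F (m 2) (arrayGet F (W + 1) d v) fun u z =>
    if edgeAt m (mulSmall F (m 2) v + u) 0 ≠ 0 then
      if arrayGet F (W + 1) d u + weightInt F m (mulSmall F (m 2) v + u) < z then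
        arrayGet F (W + 1) d u + weightInt F m (mulSmall F (m 2) v + u)
      else z
    else z

/-- One round of the algorithm of Bellman and Ford -/
def relax (F : ℕ) (m : ℕ → ℕ) (W d : ℕ) : ℕ := arrayOf F (W + 1) (m 2) (relaxAt F m W d)

/-- The distances from `S` -/
def distArray (F : ℕ) (m : ℕ → ℕ) (W S : ℕ) : ℕ :=
  fold F (m 2) (distInit F m W S) fun _ d => relax F m W d

/-- The cost of `S`, multiplied by all denominators -/
def costInt (F : ℕ) (m : ℕ → ℕ) (W S : ℕ) : ℕ :=
  sumTo F (m 2) (fun v => if arrayGet F 1 S v ≠ 0 then openInt F m else 0) +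
  sumTo F (m 2) fun v => if m (5 + v) ≠ 0 then arrayGet F (W + 1) (distArray F m W S) v else 0

/-- The number of bits of a vertex -/
def vertexBits (F : ℕ) (m : ℕ → ℕ) : ℕ :=
  fold F (m 2) 0 fun _ b => if shl F 1 b < m 2 then b + 1 else b

/-- The number of vertices in a swap -/
def swapSize (F : ℕ) (m : ℕ → ℕ) (c : ℕ) : ℕ :=
  mulSmall F (mulSmall F c (m 1)) (mulSmall F c (m 1))

/-- Remove from `S` or insert into `S` the vertices listed in the array `k` -/
def flip (F : ℕ) (m : ℕ → ℕ) (c S k : ℕ) : ℕ :=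
  arrayOf F 1 (m 2) fun v =>
    if sumTo F (swapSize F m c) (fun j => if arrayGet F (vertexBits F m) k j = v then 1 else 0) ≠ 0
    then 1 - arrayGet F 1 S v else arrayGet F 1 S v

/-- The best solution that differs from `S` by one swap -/
def improve (F : ℕ) (m : ℕ → ℕ) (c W S : ℕ) : ℕ :=
  fold F (shl F 1 (mulSmall F (vertexBits F m) (swapSize F m c))) S fun k T =>
    if costInt F m W (flip F m c S k) < costInt F m W T then flip F m c S k else T

/-- Local search -/
def localSearch (F : ℕ) (m : ℕ → ℕ) (c W : ℕ) : ℕ :=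
  fold F F (arrayOf F 1 (m 2) fun _ => 1) fun _ S => improve F m c W S

/-- `x ^ n` -/
def powSmall (F x n : ℕ) : ℕ := fold F n 1 fun _ z => mulSmall F z x

end Algorithm

/-! ### The local search is built from computable functions. -/

section Computability

variable {α : Type} [Ctx α] {x y z u w : α → ℕ}

theorem Comp.shl (hx : Comp x) (hy : Comp y) : Comp fun a => UFL.shl (UFL.fuel a) (x a) (y a) :=
  Comp.fold hy hx (Comp.var0.add Comp.var0)

theorem Comp.shr (hx : Comp x) (hy : Comp y) : Comp fun a => UFL.shr (UFL.fuel a) (x a) (y a) :=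
  Comp.fold hy hx Comp.var0.half

theorem Comp.low (hx : Comp x) (hy : Comp y) : Comp fun a => UFL.low (UFL.fuel a) (x a) (y a) :=
  hx.sub ((hx.shr hy).shl hy)

theorem Comp.mulSmall (hx : Comp x) (hy : Comp y) :
    Comp fun a => UFL.mulSmall (UFL.fuel a) (x a) (y a) :=
  Comp.fold hy (Comp.lit 0) (Comp.var0.add hx.weak.weak)

theorem Comp.mulBig (hx : Comp x) (hy : Comp y) :
    Comp fun a => UFL.mulBig (UFL.fuel a) (x a) (y a) :=
  Comp.fold Comp.fuel (Comp.lit 0) (((hy.weak.weak.shr Comp.var1).low (Comp.lit 1)).ite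
    (Comp.var0.add (hx.weak.weak.shl Comp.var1)) Comp.var0)

theorem Comp.arrayGet (hw : Comp w) (hx : Comp x) (hy : Comp y) :
    Comp fun a => UFL.arrayGet (UFL.fuel a) (w a) (x a) (y a) :=
  (hx.shr (hw.mulSmall hy)).low hw

theorem Comp.arrayOf {f : α → ℕ → ℕ} (hw : Comp w) (hx : Comp x)
    (hf : Comp fun p : α × ℕ => f p.1 p.2) :
    Comp fun a => UFL.arrayOf (UFL.fuel a) (w a) (x a) (f a) :=
  Comp.fold hx (Comp.lit 0) (Comp.var0.add (hf.weak.shl (hw.weak.weak.mulSmall Comp.var1)))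

theorem Comp.sumTo {f : α → ℕ → ℕ} (hx : Comp x) (hf : Comp fun p : α × ℕ => f p.1 p.2) :
    Comp fun a => UFL.sumTo (UFL.fuel a) (x a) (f a) :=
  Comp.fold hx (Comp.lit 0) (Comp.var0.add hf.weak)

theorem Comp.edgeAt (hx : Comp x) (c : ℕ) : Comp fun a => UFL.edgeAt (UFL.cell a) (x a) c :=
  ((((Comp.lit 5).add (Comp.lit 2).cell).add ((hx.add hx).add hx)).add (Comp.lit c)).cell

theorem Comp.denAt (hx : Comp x) : Comp fun a => UFL.denAt (UFL.cell a) (x a) :=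
  (hx.edgeAt 0).ite (hx.edgeAt 2) (Comp.lit 1)

theorem Comp.order : Comp fun a : α => UFL.cell a 2 := (Comp.lit 2).cell

theorem Comp.openInt : Comp fun a : α => UFL.openInt (UFL.fuel a) (UFL.cell a) :=
  Comp.fold (Comp.order.mulSmall Comp.order) (Comp.lit 3).cell (Comp.var0.mulBig Comp.var1.denAt)

theorem Comp.weightInt (hx : Comp x) :
    Comp fun a => UFL.weightInt (UFL.fuel a) (UFL.cell a) (x a) :=
  Comp.fold (Comp.order.mulSmall Comp.order) (Comp.lit 4).cell (Comp.var0.mulBig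
    (Comp.ite_eq Comp.var1 hx.weak.weak (Comp.var1.edgeAt 1) Comp.var1.denAt))

theorem Comp.width (hx : Comp x) : Comp fun a => UFL.width (UFL.fuel a) (UFL.cell a) (x a) :=
  hx.mulSmall ((Comp.order.mulSmall Comp.order).add (Comp.lit 5))

theorem Comp.distInit (hw : Comp w) (hx : Comp x) :
    Comp fun a => UFL.distInit (UFL.fuel a) (UFL.cell a) (w a) (x a) :=
  Comp.arrayOf (hw.add (Comp.lit 1)) Comp.order
    (((Comp.lit 1).arrayGet hx.weak Comp.var0).ite (Comp.lit 0) ((Comp.lit 1).shl hw.weak))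

theorem Comp.relaxAt (hw : Comp w) (hx : Comp x) (hy : Comp y) :
    Comp fun a => UFL.relaxAt (UFL.fuel a) (UFL.cell a) (w a) (x a) (y a) := by
  have hw' := hw.add (Comp.lit 1)
  have he := (Comp.order.mulSmall hy.weak.weak).add (Comp.var1 (α := α))
  have hs := (hw'.weak.weak.arrayGet hx.weak.weak Comp.var1).add he.weightInt
  exact Comp.fold Comp.order (hw'.arrayGet hx hy)
    ((he.edgeAt 0).ite (Comp.ite_lt hs Comp.var0 hs Comp.var0) Comp.var0)

theorem Comp.relax (hw : Comp w) (hx : Comp x) :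
    Comp fun a => UFL.relax (UFL.fuel a) (UFL.cell a) (w a) (x a) :=
  Comp.arrayOf (hw.add (Comp.lit 1)) Comp.order (hw.weak.relaxAt hx.weak Comp.var0)

theorem Comp.distArray (hw : Comp w) (hx : Comp x) :
    Comp fun a => UFL.distArray (UFL.fuel a) (UFL.cell a) (w a) (x a) :=
  Comp.fold Comp.order (hw.distInit hx) (hw.weak.weak.relax Comp.var0)

theorem Comp.costInt (hw : Comp w) (hx : Comp x) :
    Comp fun a => UFL.costInt (UFL.fuel a) (UFL.cell a) (w a) (x a) :=
  (Comp.sumTo Comp.order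
    (((Comp.lit 1).arrayGet hx.weak Comp.var0).ite Comp.openInt (Comp.lit 0))).add
  (Comp.sumTo Comp.order (((Comp.lit 5).add Comp.var0).cell.ite
    ((hw.weak.add (Comp.lit 1)).arrayGet (hw.weak.distArray hx.weak) Comp.var0) (Comp.lit 0)))

theorem Comp.vertexBits : Comp fun a : α => UFL.vertexBits (UFL.fuel a) (UFL.cell a) :=
  Comp.fold Comp.order (Comp.lit 0) (Comp.ite_lt ((Comp.lit 1).shl Comp.var0) Comp.order
    (Comp.var0.add (Comp.lit 1)) Comp.var0)

theorem Comp.swapSize (c : ℕ) : Comp fun a : α => UFL.swapSize (UFL.fuel a) (UFL.cell a) c :=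
  ((Comp.lit c).mulSmall (Comp.lit 1).cell).mulSmall ((Comp.lit c).mulSmall (Comp.lit 1).cell)

theorem Comp.flip (c : ℕ) (hx : Comp x) (hy : Comp y) :
    Comp fun a => UFL.flip (UFL.fuel a) (UFL.cell a) c (x a) (y a) := by
  have hg := (Comp.lit 1).arrayGet hx.weak Comp.var0
  have hd : Comp fun p : (α × ℕ) × ℕ => if UFL.arrayGet (UFL.fuel p)
      (UFL.vertexBits (UFL.fuel p) (UFL.cell p)) (y p.1.1) p.2 = p.1.2 then 1 else 0 :=
    Comp.ite_eq (Comp.vertexBits.arrayGet hy.weak.weak Comp.var0) Comp.var1 (Comp.lit 1)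
      (Comp.lit 0)
  exact Comp.arrayOf (Comp.lit 1) Comp.order
    ((Comp.sumTo (Comp.swapSize c) hd).ite ((Comp.lit 1).sub hg) hg)

theorem Comp.improve (c : ℕ) (hw : Comp w) (hx : Comp x) :
    Comp fun a => UFL.improve (UFL.fuel a) (UFL.cell a) c (w a) (x a) := by
  have hf := Comp.flip c hx.weak.weak Comp.var1
  exact Comp.fold ((Comp.lit 1).shl (Comp.vertexBits.mulSmall (Comp.swapSize c))) hx
    (Comp.ite_lt (hw.weak.weak.costInt hf) (hw.weak.weak.costInt Comp.var0) hf Comp.var0)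

theorem Comp.localSearch (c : ℕ) (hw : Comp w) :
    Comp fun a => UFL.localSearch (UFL.fuel a) (UFL.cell a) c (w a) :=
  Comp.fold Comp.fuel (Comp.arrayOf (Comp.lit 1) Comp.order (Comp.lit 1))
    (Comp.improve c hw.weak.weak Comp.var0)

theorem Comp.powSmall (hx : Comp x) (hy : Comp y) :
    Comp fun a => UFL.powSmall (UFL.fuel a) (x a) (y a) :=
  Comp.fold hy (Comp.lit 1) (Comp.var0.mulSmall hx.weak.weak)

end Computability

/-! ### Values of the arithmetic functions when the loop bound is large enough. -/

section Arithmetic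

variable {F : ℕ}

theorem fold_eq {n : ℕ} (h : n ≤ F) (x : ℕ) (B : ℕ → ℕ → ℕ) : fold F n x B = natFold B x n := by
  rw [fold, min_eq_left h]

theorem shl_eq {k : ℕ} (h : k ≤ F) (x : ℕ) : shl F x k = x * 2 ^ k := by
  rw [shl, fold_eq h]
  clear h
  induction k with
  | zero => simp [natFold]
  | succ k ih => rw [natFold, ih, pow_succ]; ring

theorem shr_eq {k : ℕ} (h : k ≤ F) (x : ℕ) : shr F x k = x / 2 ^ k := by
  rw [shr, fold_eq h]
  clear h
  induction k with
  | zero => simp [natFold]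
  | succ k ih => rw [natFold, ih, pow_succ, Nat.div_div_eq_div_mul]

theorem low_eq {k : ℕ} (h : k ≤ F) (x : ℕ) : low F x k = x % 2 ^ k := by
  rw [low, shl_eq h, shr_eq h]
  have := Nat.div_add_mod' x (2 ^ k)
  omega

theorem mulSmall_eq {y : ℕ} (h : y ≤ F) (x : ℕ) : mulSmall F x y = x * y := by
  rw [mulSmall, fold_eq h]
  clear h
  induction y with
  | zero => simp [natFold]
  | succ k ih => rw [natFold, ih]; ring

theorem mulBig_eq {y : ℕ} (hF : 1 ≤ F) (h : y < 2 ^ F) (x : ℕ) : mulBig F x y = x * y := by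
  rw [mulBig, fold_eq le_rfl]
  have key : ∀ k ≤ F, natFold (fun i z => if low F (shr F y i) 1 ≠ 0 then z + shl F x i else z) 0 k =
      x * (y % 2 ^ k) := by
    intro k
    induction k with
    | zero => simp [natFold, Nat.mod_one]
    | succ k ih =>
      intro hk
      rw [natFold, ih (by omega), low_eq hF, shr_eq (by omega), shl_eq (by omega), pow_one,
        Nat.mod_pow_succ]
      rcases Nat.mod_two_eq_zero_or_one (y / 2 ^ k) with h0 | h1
      · simp [h0]
      · simp [h1]; ring
  rw [key F le_rfl, Nat.mod_eq_of_lt h]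

theorem sumTo_eq {n : ℕ} (h : n ≤ F) (f : ℕ → ℕ) : sumTo F n f = ∑ i ∈ Finset.range n, f i := by
  rw [sumTo, fold_eq h]
  clear h
  induction n with
  | zero => simp [natFold]
  | succ k ih => rw [natFold, ih, Finset.sum_range_succ]

theorem powSmall_eq {x n : ℕ} (hx : x ≤ F) (h : n ≤ F) : powSmall F x n = x ^ n := by
  rw [powSmall, fold_eq h]
  clear h
  induction n with
  | zero => simp [natFold]
  | succ k ih => rw [natFold, ih, mulSmall_eq hx, pow_succ]

theorem arrayGet_eq {w A i : ℕ} (hw : w ≤ F) (hi : i ≤ F) (hwi : w * i ≤ F) :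
    arrayGet F w A i = A / 2 ^ (w * i) % 2 ^ w := by
  rw [arrayGet, mulSmall_eq hi, shr_eq hwi, low_eq hw]

theorem arrayGet_lt {w A i : ℕ} (hw : w ≤ F) : arrayGet F w A i < 2 ^ w := by
  rw [arrayGet, low_eq hw]
  exact Nat.mod_lt _ (by positivity)

theorem arrayOf_eq {w n : ℕ} (hn : n ≤ F) (hwn : w * n ≤ F) (f : ℕ → ℕ) :
    arrayOf F w n f = ∑ i ∈ Finset.range n, f i * 2 ^ (w * i) := by
  rw [arrayOf, fold_eq hn]
  induction n with
  | zero => simp [natFold]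
  | succ k ih =>
    have hk : w * k ≤ F := (Nat.mul_le_mul_left w (Nat.le_succ k)).trans hwn
    rw [natFold, ih (by omega) hk, Finset.sum_range_succ, mulSmall_eq (by omega), shl_eq hk]

theorem sum_lt_pow {w n : ℕ} {f : ℕ → ℕ} (hf : ∀ i < n, f i < 2 ^ w) :
    ∑ i ∈ Finset.range n, f i * 2 ^ (w * i) < 2 ^ (w * n) := by
  induction n with
  | zero => simp
  | succ n ih =>
    rw [Finset.sum_range_succ, Nat.mul_succ, pow_add]
    have h1 := ih fun i hi => hf i (by omega)
    have h2 := Nat.mul_le_mul_right (2 ^ (w * n)) (Nat.succ_le_of_lt (hf n (by omega)))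
    rw [Nat.succ_mul, mul_comm (2 ^ w)] at h2
    omega

/-- Digit extraction in base `2 ^ w`: the summands above `i` are multiples of `2 ^ (w * (i + 1))`,
and those below `i` add up to less than `2 ^ (w * i)`. -/
theorem sum_div_mod {w n i : ℕ} {f : ℕ → ℕ} (hf : ∀ i < n, f i < 2 ^ w) (hi : i < n) :
    (∑ j ∈ Finset.range n, f j * 2 ^ (w * j)) / 2 ^ (w * i) % 2 ^ w = f i := by
  induction n with
  | zero => omega
  | succ n ih =>
    rw [Finset.sum_range_succ]
    have hlt : ∀ j < n, f j < 2 ^ w := fun j hj => hf j (by omega)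
    rcases Nat.lt_succ_iff_lt_or_eq.1 hi with h | rfl
    · obtain ⟨k, rfl⟩ := Nat.exists_eq_add_of_lt h
      have : f (i + k + 1) * 2 ^ (w * (i + k + 1)) =
          2 ^ (w * i) * (f (i + k + 1) * 2 ^ (w * k) * 2 ^ w) := by
        rw [Nat.mul_succ, mul_add, pow_add, pow_add]; ring
      rw [this, Nat.add_mul_div_left _ _ (by positivity), Nat.add_mul_mod_self_right]
      exact ih hlt h
    · rw [mul_comm (f i), Nat.add_mul_div_left _ _ (by positivity),
        Nat.div_eq_of_lt (sum_lt_pow hlt), zero_add, Nat.mod_eq_of_lt (hf i (by omega))]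

theorem arrayGet_arrayOf {w n i : ℕ} {f : ℕ → ℕ} (hw : w ≤ F) (hn : n ≤ F) (hwn : w * n ≤ F)
    (hf : ∀ i < n, f i < 2 ^ w) (hi : i < n) : arrayGet F w (arrayOf F w n f) i = f i := by
  rw [arrayGet_eq hw (by omega) ((Nat.mul_le_mul_left w hi.le).trans hwn), arrayOf_eq hn hwn,
    sum_div_mod hf hi]

end Arithmetic

/-! ### Replacing walks by short ones. -/

section ShortestPaths

variable {V : Type*} {G : SimpleGraph V} {w : V → V → ℕ}

theorem wlen_append {u v x : V} (p : G.Walk u v) (q : G.Walk v x) :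
    wlen w (p.append q) = wlen w p + wlen w q := by
  induction p with
  | nil => simp [wlen]
  | cons h p ih => simp only [SimpleGraph.Walk.cons_append, wlen, ih]; ring

theorem wlen_bypass_le [DecidableEq V] {u v : V} (p : G.Walk u v) :
    wlen w p.bypass ≤ wlen w p := by
  induction p with
  | nil => simp [SimpleGraph.Walk.bypass]
  | @cons a b c h p ih =>
    simp only [SimpleGraph.Walk.bypass]
    split_ifs with hs
    · have h1 := wlen_append (w := w) (p.bypass.takeUntil a hs) (p.bypass.dropUntil a hs)
      rw [SimpleGraph.Walk.take_spec] at h1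
      simp only [wlen]
      omega
    · simp only [wlen]; omega

theorem wlen_le_mul {M : ℕ} (hM : ∀ u v, G.Adj u v → w u v ≤ M) {u v : V} (p : G.Walk u v) :
    wlen w p ≤ p.length * M := by
  induction p with
  | nil => simp [wlen]
  | cons h p ih =>
    have := hM _ _ h
    simp only [wlen, SimpleGraph.Walk.length_cons]
    rw [Nat.succ_mul]
    omega

/-- Every walk can be replaced by a short one. -/
theorem exists_short_walk [Fintype V] {u v : V} (p : G.Walk u v) :
    ∃ p' : G.Walk u v, p'.length ≤ Fintype.card V ∧ wlen w p' ≤ wlen w p := by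
  classical
  exact ⟨p.bypass, (p.bypass_isPath.length_lt).le, wlen_bypass_le p⟩

end ShortestPaths

/-! ### Loops that compute minima. -/

section Folds

theorem natFold_min {c g : ℕ → ℕ} {x n : ℕ} {r : ℕ}
    (hr : r = natFold (fun u z => if c u ≠ 0 then if g u < z then g u else z else z) x n) :
    r ≤ x ∧ (∀ u < n, c u ≠ 0 → r ≤ g u) ∧ (r = x ∨ ∃ u < n, c u ≠ 0 ∧ r = g u) := by
  induction n generalizing r with
  | zero => exact ⟨hr.le, by simp, Or.inl hr⟩
  | succ n ih =>
    obtain ⟨h1, h2, h3⟩ := ih rfl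
    rw [natFold] at hr
    set z := natFold (fun u z => if c u ≠ 0 then if g u < z then g u else z else z) x n
    have hz : r = z ∨ (c n ≠ 0 ∧ r = g n) := by
      split_ifs at hr with a b
      · exact Or.inr ⟨a, hr⟩
      · exact Or.inl hr
      · exact Or.inl hr
    have hrz : r ≤ z := by split_ifs at hr <;> omega
    have hrg : c n ≠ 0 → r ≤ g n := by intro hc; rw [if_pos hc] at hr; split_ifs at hr <;> omega
    refine ⟨hrz.trans h1, fun u hu hc => ?_, ?_⟩
    · rcases Nat.lt_succ_iff_lt_or_eq.1 hu with h | rfl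
      · exact hrz.trans (h2 u h hc)
      · exact hrg hc
    · rcases hz with h | ⟨hc, h⟩
      · rcases h3 with h' | ⟨u, hu, hc, h'⟩
        · exact Or.inl (h.trans h')
        · exact Or.inr ⟨u, by omega, hc, h.trans h'⟩
      · exact Or.inr ⟨n, by omega, hc, h⟩

theorem natFold_best {c : ℕ → ℕ} {g : ℕ → ℕ} {x n : ℕ} :
    c (natFold (fun k T => if c (g k) < c T then g k else T) x n) ≤ c x ∧
      ∀ k < n, c (natFold (fun k T => if c (g k) < c T then g k else T) x n) ≤ c (g k) := by
  induction n with
  | zero => simp [natFold]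
  | succ n ih =>
    rw [natFold]
    set T := natFold (fun k T => if c (g k) < c T then g k else T) x n
    have h1 : c (if c (g n) < c T then g n else T) ≤ c T := by split_ifs <;> omega
    have h2 : c (if c (g n) < c T then g n else T) ≤ c (g n) := by split_ifs <;> omega
    refine ⟨h1.trans ih.1, fun k hk => ?_⟩
    rcases Nat.lt_succ_iff_lt_or_eq.1 hk with h | rfl
    · exact h1.trans (ih.2 k h)
    · exact h2

end Folds

/-! ### Correctness of distances, costs and swaps. -/

section Correctness

variable {n F W : ℕ} {m : ℕ → ℕ} {G : SimpleGraph (Fin n)} {C : Finset (Fin n)}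

/-- The memory contains the graph `G` and the clients `C`. -/
structure Decodes (m : ℕ → ℕ) (G : SimpleGraph (Fin n)) (C : Finset (Fin n)) : Prop where
  order : m 2 = n
  adj : ∀ u v : Fin n, edgeAt m (n * u + v) 0 ≠ 0 ↔ G.Adj u v
  client : ∀ v : Fin n, m (5 + v) ≠ 0 ↔ v ∈ C

/-- The loop bound suffices for the computation of costs. -/
structure Enough (F W n : ℕ) : Prop where
  pos : 1 ≤ F
  order : n ≤ F
  square : n * n ≤ F
  width : W + 1 ≤ F
  array : (W + 1) * n ≤ F

/-- The set with the characteristic vector `S`. -/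
def setOfBits (F n S : ℕ) : Finset (Fin n) := Finset.univ.filter fun v => arrayGet F 1 S v ≠ 0

/-- The edge lengths, multiplied by all denominators. -/
def lenInt (F : ℕ) (m : ℕ → ℕ) (n : ℕ) (u v : Fin n) : ℕ := weightInt F m (n * u + v)

theorem relaxAt_spec (hD : Decodes m G C) (hF : Enough F W n) (d : ℕ) (v : Fin n) :
    relaxAt F m W d v ≤ arrayGet F (W + 1) d v ∧
    (∀ u : Fin n, G.Adj v u →
      relaxAt F m W d v ≤ arrayGet F (W + 1) d u + lenInt F m n v u) ∧
    (relaxAt F m W d v = arrayGet F (W + 1) d v ∨ ∃ u : Fin n, G.Adj v u ∧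
      relaxAt F m W d v = arrayGet F (W + 1) d u + lenInt F m n v u) := by
  have hmul : mulSmall F (m 2) v = n * v := by
    rw [mulSmall_eq (v.2.le.trans hF.order), hD.order]
  have key := natFold_min (c := fun u => edgeAt m (mulSmall F (m 2) v + u) 0)
    (g := fun u => arrayGet F (W + 1) d u + weightInt F m (mulSmall F (m 2) v + u))
    (x := arrayGet F (W + 1) d v) (n := n) (r := relaxAt F m W d v)
    (by rw [relaxAt, hD.order, fold_eq hF.order])
  simp only [hmul] at key
  refine ⟨key.1, fun u hu => key.2.1 u u.2 ((hD.adj v u).2 hu), key.2.2.imp id ?_⟩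
  rintro ⟨u, hu, hc, hr⟩
  exact ⟨⟨u, hu⟩, (hD.adj v ⟨u, hu⟩).1 hc, hr⟩

/-- The invariant of the rounds of Bellman and Ford. The bound `2 ^ W` belongs to the induction
because it makes every entry fit into its `W + 1` bits; a sum such as infinity plus a length is
never stored in place of a smaller entry. -/
theorem distArray_aux (hD : Decodes m G C) (hF : Enough F W n) (S k : ℕ) (v : Fin n) :
    arrayGet F (W + 1) (natFold (fun _ d => relax F m W d) (distInit F m W S) k) v ≤ 2 ^ W ∧
    (∀ u ∈ setOfBits F n S, ∀ p : G.Walk v u, p.length ≤ k →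
      arrayGet F (W + 1) (natFold (fun _ d => relax F m W d) (distInit F m W S) k) v ≤
        wlen (lenInt F m n) p) ∧
    (arrayGet F (W + 1) (natFold (fun _ d => relax F m W d) (distInit F m W S) k) v = 2 ^ W ∨
      ∃ u ∈ setOfBits F n S, ∃ p : G.Walk v u, wlen (lenInt F m n) p =
        arrayGet F (W + 1) (natFold (fun _ d => relax F m W d) (distInit F m W S) k) v) := by
  have h2W : 2 ^ W < 2 ^ (W + 1) := Nat.pow_lt_pow_right (by norm_num) (Nat.lt_succ_self W)
  induction k generalizing v with
  | zero =>
    have hget : arrayGet F (W + 1) (distInit F m W S) v =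
        if arrayGet F 1 S v ≠ 0 then 0 else 2 ^ W := by
      have hshl : shl F 1 W = 2 ^ W := by
        rw [shl_eq (by have := hF.width; omega), one_mul]
      rw [distInit, hD.order, arrayGet_arrayOf hF.width hF.order hF.array ?_ v.2, hshl]
      intro i _
      split_ifs
      · positivity
      · rwa [hshl]
    simp only [natFold, hget]
    by_cases hv : v ∈ setOfBits F n S
    · have hv' : arrayGet F 1 S v ≠ 0 := (Finset.mem_filter.1 hv).2
      simp only [if_pos hv']
      exact ⟨Nat.zero_le _, fun _ _ _ _ => Nat.zero_le _,
        Or.inr ⟨v, hv, .nil, rfl⟩⟩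
    · have hv' : ¬ arrayGet F 1 S v ≠ 0 := fun h =>
        hv (Finset.mem_filter.2 ⟨Finset.mem_univ _, h⟩)
      simp only [if_neg hv']
      refine ⟨le_rfl, fun u hu p hp => ?_, by simp⟩
      rw [SimpleGraph.Walk.eq_of_length_eq_zero (Nat.le_zero.1 hp)] at hv
      exact absurd hu hv
  | succ k ih =>
    set d := natFold (fun _ d => relax F m W d) (distInit F m W S) k with hd
    have hrel : ∀ v : Fin n, relaxAt F m W d v ≤ 2 ^ W := fun v =>
      (relaxAt_spec hD hF d v).1.trans (ih v).1
    have hget : arrayGet F (W + 1) (relax F m W d) v = relaxAt F m W d v := by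
      rw [relax, hD.order, arrayGet_arrayOf hF.width hF.order hF.array ?_ v.2]
      intro i hi
      exact (hrel ⟨i, hi⟩).trans_lt h2W
    simp only [natFold, ← hd, hget]
    obtain ⟨h1, h2, h3⟩ := relaxAt_spec hD hF d v
    refine ⟨hrel v, fun u hu p hp => ?_, ?_⟩
    · cases p with
      | nil => exact h1.trans ((ih v).2.1 v hu .nil (by simp))
      | @cons _ b _ hvb p =>
        have h4 := (ih b).2.1 u hu p (by simpa using hp)
        have h5 := h2 b hvb
        simp only [wlen]
        omega
    · rcases h3 with h | ⟨u, hu, h⟩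
      · rw [h]; exact (ih v).2.2
      · rcases (ih u).2.2 with h' | ⟨x, hx, p, hp⟩
        · left
          have := hrel v
          omega
        · exact Or.inr ⟨x, hx, .cons hu p, by simp only [wlen]; omega⟩

/-- The computed distances are the true ones, with infinity replaced by `2 ^ W`. -/
theorem distArray_eq (hD : Decodes m G C) (hF : Enough F W n) (S : ℕ) (v : Fin n) :
    ((arrayGet F (W + 1) (distArray F m W S) v : ℕ) : ℕ∞) =
      min ((2 ^ W : ℕ) : ℕ∞) (setDist G (lenInt F m n) (setOfBits F n S) v) := by
  have hda : distArray F m W S = natFold (fun _ d => relax F m W d) (distInit F m W S) n := by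
    rw [distArray, hD.order, fold_eq hF.order]
  obtain ⟨h1, h2, h3⟩ := distArray_aux hD hF S n v
  rw [hda]
  refine le_antisymm (le_min (by exact_mod_cast h1) (le_setDist fun u hu p => ?_)) ?_
  · obtain ⟨p', hp', hle⟩ := exists_short_walk (w := lenInt F m n) p
    rw [Fintype.card_fin] at hp'
    exact_mod_cast (h2 u hu p' hp').trans hle
  · rcases h3 with h | ⟨u, hu, p, hp⟩
    · rw [h]; exact min_le_left _ _
    · rw [← hp]; exact (min_le_right _ _).trans (setDist_le hu p)

theorem costInt_eq (hD : Decodes m G C) (hF : Enough F W n) (S : ℕ) :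
    costInt F m W S = openInt F m * (setOfBits F n S).card +
      ∑ v ∈ C, arrayGet F (W + 1) (distArray F m W S) v := by
  rw [costInt, hD.order, sumTo_eq hF.order, sumTo_eq hF.order, Finset.sum_range, Finset.sum_range]
  congr 1
  · rw [← Finset.sum_filter, Finset.sum_const, smul_eq_mul, mul_comm]
    rfl
  · rw [← Finset.sum_filter]
    refine Finset.sum_congr ?_ fun _ _ => rfl
    ext v
    simpa using hD.client v

/-- The cost of a good instance is computed correctly. -/
theorem costInt_spec (hD : Decodes m G C) (hF : Enough F W n) {M : ℕ}
    (hM : ∀ u v, G.Adj u v → lenInt F m n u v ≤ M)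
    (hMW : openInt F m * n + n * (n * M) + n * M < 2 ^ W) (S : ℕ) :
    (natCost G (lenInt F m n) (openInt F m) C (setOfBits F n S) ≠ ⊤ →
      ((costInt F m W S : ℕ) : ℕ∞) =
        natCost G (lenInt F m n) (openInt F m) C (setOfBits F n S) ∧ costInt F m W S < 2 ^ W) ∧
    (natCost G (lenInt F m n) (openInt F m) C (setOfBits F n S) = ⊤ →
      2 ^ W ≤ costInt F m W S) := by
  rw [costInt_eq hD hF]
  set w := lenInt F m n
  set T := setOfBits F n S
  have hdist := distArray_eq hD hF S
  -- Finite distances come from walks with at most `n` edges, so they are below `2 ^ W`, and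
  -- replacing infinity by `2 ^ W` changes none of them.
  have hsmall : ∀ v, setDist G w T v ≠ ⊤ →
      setDist G w T v ≤ (n * M : ℕ) := by
    intro v hv
    by_contra! hlt
    refine hv (top_le_iff.1 (le_setDist fun u hu p => ?_))
    obtain ⟨p', hp', -⟩ := exists_short_walk (w := w) p
    rw [Fintype.card_fin] at hp'
    have h1 := wlen_le_mul hM p'
    have h2 : wlen w p' ≤ n * M := h1.trans (Nat.mul_le_mul_right _ hp')
    have h3 := setDist_le (w := w) hu p'
    exact absurd (h3.trans (by exact_mod_cast h2)) (not_le.2 hlt)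
  constructor
  · intro hfin
    have hC : ∀ v ∈ C, setDist G w T v ≠ ⊤ := by
      intro v hv htop
      refine hfin (top_le_iff.1 ?_)
      rw [← htop]
      exact (Finset.single_le_sum (f := fun v => setDist G w T v) (fun _ _ => bot_le) hv).trans
        le_add_self
    have heq : ∀ v ∈ C, ((arrayGet F (W + 1) (distArray F m W S) v : ℕ) : ℕ∞) =
        setDist G w T v := by
      intro v hv
      rw [hdist v]
      refine min_eq_right ((hsmall v (hC v hv)).trans ?_)
      exact_mod_cast (by omega : n * M ≤ 2 ^ W)
    refine ⟨?_, ?_⟩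
    · push_cast
      rw [natCost, Finset.sum_congr rfl heq]
    · have h1 : ∀ v ∈ C, arrayGet F (W + 1) (distArray F m W S) v ≤ n * M := by
        intro v hv
        have := hsmall v (hC v hv)
        rw [← heq v hv] at this
        exact_mod_cast this
      have h2 := Finset.sum_le_card_nsmul C _ _ h1
      have h3 : C.card ≤ n := by simpa using Finset.card_le_univ C
      have h4 : T.card ≤ n := by simpa using Finset.card_le_univ T
      rw [smul_eq_mul] at h2
      have h5 := Nat.mul_le_mul_right (n * M) h3
      have h6 := Nat.mul_le_mul_left (openInt F m) h4
      omega
  · intro htop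
    have : ∃ v ∈ C, setDist G w T v = ⊤ := by
      by_contra! h
      refine absurd htop (ne_of_lt ?_)
      rw [natCost]
      refine ENat.add_lt_top.2 ⟨?_, ?_⟩
      · exact_mod_cast ENat.natCast_lt_top _
      · exact WithTop.sum_lt_top.2 fun v hv => lt_top_iff_ne_top.2 (h v hv)
    obtain ⟨v, hv, hvt⟩ := this
    have h1 : arrayGet F (W + 1) (distArray F m W S) v = 2 ^ W := by
      have := hdist v
      rw [hvt, min_eq_left le_top] at this
      exact_mod_cast this
    rw [← h1]
    exact (Finset.single_le_sum (f := fun v : Fin n => arrayGet F (W + 1) (distArray F m W S) v)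
      (fun _ _ => Nat.zero_le _) hv).trans (Nat.le_add_left _ _)

/-- The upper bound keeps the number of codes of swaps polynomial; its `+ 1` is needed for `n = 0`.
-/
theorem vertexBits_spec (h2 : m 2 = n) (hn : n ≤ F) :
    n ≤ 2 ^ vertexBits F m ∧ 2 ^ vertexBits F m ≤ 2 * n + 1 := by
  rw [vertexBits, h2, fold_eq hn]
  have key : ∀ k ≤ n, natFold (fun _ b => if shl F 1 b < n then b + 1 else b) 0 k ≤ k ∧
      (n ≤ 2 ^ natFold (fun _ b => if shl F 1 b < n then b + 1 else b) 0 k ∨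
        natFold (fun _ b => if shl F 1 b < n then b + 1 else b) 0 k = k) ∧
      2 ^ natFold (fun _ b => if shl F 1 b < n then b + 1 else b) 0 k ≤ 2 * n + 1 := by
    intro k
    induction k with
    | zero => simp [natFold]
    | succ k ih =>
      intro hk
      obtain ⟨h1, h2, h3⟩ := ih (by omega)
      rw [natFold]
      set b := natFold (fun _ b => if shl F 1 b < n then b + 1 else b) 0 k
      rw [shl_eq (by omega), one_mul]
      split_ifs with hb
      · refine ⟨by omega, Or.inr ?_, by rw [pow_succ]; omega⟩
        rcases h2 with h | h <;> omega
      · exact ⟨by omega, Or.inl (by omega), h3⟩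
  obtain ⟨-, h2, h3⟩ := key n le_rfl
  refine ⟨?_, h3⟩
  rcases h2 with h | h
  · exact h
  · rw [h]; exact Nat.lt_two_pow_self.le

/-- Every small swap is the result of `flip`. -/
theorem exists_flip {c s b : ℕ} (h2 : m 2 = n) (hF : Enough F W n) (hs : swapSize F m c = s)
    (hb : vertexBits F m = b) (hsF : s ≤ F) (hbs : b * s ≤ F) (hnb : n ≤ 2 ^ b) (hbF : b ≤ F)
    (S : ℕ) (T : Finset (Fin n)) (hT : (symmDiff (setOfBits F n S) T).card ≤ s)
    (hne : setOfBits F n S ≠ T) :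
    ∃ k < 2 ^ (b * s), setOfBits F n (flip F m c S k) = T := by
  classical
  set D := symmDiff (setOfBits F n S) T with hD
  obtain ⟨v₀, hv₀⟩ : D.Nonempty := by
    rw [Finset.nonempty_iff_ne_empty]
    intro h
    exact hne (symmDiff_eq_bot.1 h)
  -- The code lists `D` and is padded with copies of `v₀`. Repetitions are harmless because `flip`
  -- only asks whether a vertex occurs. The padding needs a vertex of `D`, which is why the trivial
  -- swap is excluded.
  let f : ℕ → ℕ := fun j => ((D.toList.getD j v₀ : Fin n) : ℕ)
  have hf : ∀ i < s, f i < 2 ^ b := fun i _ => (Fin.is_lt _).trans_le hnb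
  refine ⟨∑ j ∈ Finset.range s, f j * 2 ^ (b * j), sum_lt_pow hf, ?_⟩
  have hmem : ∀ j, D.toList.getD j v₀ ∈ D := by
    intro j
    by_cases hj : j < D.toList.length
    · rw [List.getD_eq_getElem _ _ hj]
      exact Finset.mem_toList.1 (List.getElem_mem hj)
    · rw [List.getD_eq_default _ _ (by omega)]; exact hv₀
  ext v
  have hflip : arrayGet F 1 (flip F m c S (∑ j ∈ Finset.range s, f j * 2 ^ (b * j))) v =
      if v ∈ D then 1 - arrayGet F 1 S v else arrayGet F 1 S v := by
    have hbit : ∀ i, arrayGet F 1 S i < 2 := fun i => by simpa using arrayGet_lt (i := i) hF.pos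
    rw [flip, h2, arrayGet_arrayOf hF.pos hF.order (by have := hF.order; omega) ?_ v.2, hs, hb,
      sumTo_eq hsF]
    · congr 1
      have : ∀ j ∈ Finset.range s,
          arrayGet F b (∑ j ∈ Finset.range s, f j * 2 ^ (b * j)) j = f j := by
        intro j hj
        have hj' := Finset.mem_range.1 hj
        rw [arrayGet_eq hbF (by omega) ((Nat.mul_le_mul_left b hj'.le).trans hbs),
          sum_div_mod hf hj']
      rw [Finset.sum_congr rfl fun j hj => by rw [this j hj], eq_iff_iff, Ne,
        Finset.sum_eq_zero_iff]
      constructor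
      · intro h
        push Not at h
        obtain ⟨j, _, hj⟩ := h
        have : f j = v := by
          by_contra hne
          simp [hne] at hj
        have hv : D.toList.getD j v₀ = v := Fin.ext this
        exact hv ▸ hmem j
      · intro hv h
        obtain ⟨j, hj, hjv⟩ := List.getElem_of_mem (Finset.mem_toList.2 hv)
        have hjs : j < s := by rw [Finset.length_toList] at hj; omega
        have hfv : f j = v := by
          simp only [f]
          rw [List.getD_eq_getElem _ _ hj, hjv]
        have := h j (Finset.mem_range.2 hjs)
        simp [hfv] at this
    · intro i _
      have := hbit i
      rw [pow_one]
      split_ifs <;> omega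
  have h2' : arrayGet F 1 S v < 2 := by simpa using arrayGet_lt (i := v) hF.pos
  have hSv : v ∈ setOfBits F n S ↔ arrayGet F 1 S v ≠ 0 := by simp [setOfBits]
  have hgoal : v ∈ setOfBits F n (flip F m c S (∑ j ∈ Finset.range s, f j * 2 ^ (b * j))) ↔
      (if v ∈ D then 1 - arrayGet F 1 S v else arrayGet F 1 S v) ≠ 0 := by
    rw [← hflip]; simp [setOfBits]
  rw [hgoal]
  have hvD : v ∈ D ↔ (v ∈ setOfBits F n S ∧ v ∉ T) ∨ (v ∈ T ∧ v ∉ setOfBits F n S) := by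
    rw [hD, Finset.mem_symmDiff]
  by_cases h : v ∈ D
  · rw [if_pos h]
    rw [hvD, hSv] at h
    by_cases hvT : v ∈ T
    · simp only [hvT, iff_true]
      simp only [hvT, not_true, and_false, true_and, false_or, not_not] at h
      omega
    · simp only [hvT, iff_false, not_not]
      simp only [hvT, not_false_eq_true, and_true, false_and, or_false] at h
      omega
  · rw [if_neg h, ← hSv]
    rw [hvD] at h
    tauto

end Correctness

/-! ### Convergence of local search. -/

section Convergence

variable {n F W : ℕ} {m : ℕ → ℕ} {G : SimpleGraph (Fin n)} {C : Finset (Fin n)}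

/-- The loop bound suffices for local search. -/
structure EnoughSwaps (F W n q c : ℕ) : Prop extends Enough F W n where
  factor : c * q ≤ F
  num : q ≤ F
  size : (c * q) ^ 2 ≤ F
  codes : (2 * n + 1) ^ (c * q) ^ 2 ≤ F
  rounds : 2 * (2 * n + 1) * (W + 8 * q) ≤ F

theorem swapSize_eq {q c : ℕ} (hq : m 1 = q) (h1 : c * q ≤ F) (h2 : q ≤ F) :
    swapSize F m c = (c * q) ^ 2 := by
  rw [swapSize, hq, mulSmall_eq h2, mulSmall_eq h1, sq]

theorem improve_spec {q c : ℕ} (hD : Decodes m G C) (hq : m 1 = q) (hF : EnoughSwaps F W n q c)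
    (S : ℕ) :
    costInt F m W (improve F m c W S) ≤ costInt F m W S ∧
    ∀ T, (symmDiff (setOfBits F n S) T).card ≤ (c * q) ^ 2 →
      ∃ S', setOfBits F n S' = T ∧ costInt F m W (improve F m c W S) ≤ costInt F m W S' := by
  have hs := swapSize_eq hq hF.factor hF.num
  obtain ⟨hnb, hb2⟩ := vertexBits_spec hD.order hF.order
  set s := (c * q) ^ 2 with hs'
  set b := vertexBits F m with hb
  have hcodes : 2 ^ (b * s) ≤ F := by
    rw [pow_mul]
    exact (Nat.pow_le_pow_left hb2 s).trans hF.codes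
  have hbs : b * s ≤ F := Nat.lt_two_pow_self.le.trans hcodes
  have hbF : b ≤ F := by
    have h1 : b < 2 ^ b := Nat.lt_two_pow_self
    have h2 : b ≤ n := by
      rw [hb, vertexBits, hD.order, fold_eq hF.order]
      have key : ∀ k, natFold (fun _ b => if shl F 1 b < n then b + 1 else b) 0 k ≤ k := by
        intro k
        induction k with
        | zero => simp [natFold]
        | succ k ih => rw [natFold]; split_ifs <;> omega
      exact key n
    exact h2.trans hF.order
  have himp : improve F m c W S = natFold (fun k T =>
      if costInt F m W (flip F m c S k) < costInt F m W T then flip F m c S k else T) S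
      (2 ^ (b * s)) := by
    rw [improve, hs, ← hb, mulSmall_eq hF.size, shl_eq hbs, one_mul, fold_eq hcodes]
  have hbest := natFold_best (c := costInt F m W) (g := flip F m c S) (x := S) (n := 2 ^ (b * s))
  rw [← himp] at hbest
  refine ⟨hbest.1, fun T hT => ?_⟩
  by_cases hST : setOfBits F n S = T
  · exact ⟨S, hST, hbest.1⟩
  · obtain ⟨k, hk, hkT⟩ := exists_flip hD.order hF.toEnough hs hb.symm hF.size hbs hnb hbF S T hT hST
    exact ⟨_, hkT, hbest.2 k hk⟩

/-- The best swap is no worse than any of those of `exists_swaps`; swaps of infinite cost satisfy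
this trivially. If both solutions are empty, there are no regions, but then the two costs agree. -/
theorem exists_progress {q h c : ℕ} (hc : c = 384 * (h + 1) ^ 2) (hD : Decodes m G C)
    (hq : m 1 = q) (hq1 : 1 ≤ q)
    (hF : EnoughSwaps F W n q c) (hG : ¬ HasCliqueMinor G Finset.univ h) {M : ℕ}
    (hM : ∀ u v, G.Adj u v → lenInt F m n u v ≤ M)
    (hMW : openInt F m * n + n * (n * M) + n * M < 2 ^ W) {O : Finset (Fin n)} {o : ℕ}
    (ho : natCost G (lenInt F m n) (openInt F m) C O = o) {S : ℕ} (hS : costInt F m W S < 2 ^ W) :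
    ∃ k, 1 ≤ k ∧ k ≤ 2 * n + 1 ∧
      8 * q * (k * costInt F m W (improve F m c W S) + costInt F m W S) ≤
        8 * q * (k * costInt F m W S + o) + (costInt F m W S + o) := by
  obtain ⟨himp, hswap⟩ := improve_spec hD hq hF S
  set w := lenInt F m n
  set f := openInt F m with hf
  set x := costInt F m W S with hx
  set x' := costInt F m W (improve F m c W S) with hx'
  have hspec := fun S => costInt_spec hD hF.toEnough hM hMW S
  have hSfin : natCost G w f C (setOfBits F n S) ≠ ⊤ := fun htop =>
    absurd ((hspec S).2 htop) (not_le.2 hS)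
  have hSx := ((hspec S).1 hSfin).1
  rw [← hx] at hSx
  by_cases hne : (setOfBits F n S ∪ O).Nonempty
  · obtain ⟨l, hl1, hl2, hl3, hl4⟩ := exists_swaps (G := G) (w := w) hq1 hG f C (setOfBits F n S) O hne
    rw [Fintype.card_fin] at hl2
    refine ⟨l.length, hl1, by omega, ?_⟩
    have hle : ∀ y ∈ l.map (natCost G w f C), (x' : ℕ∞) ≤ y := by
      intro y hy
      obtain ⟨T, hT, rfl⟩ := List.mem_map.1 hy
      by_cases htop : natCost G w f C T = ⊤
      · rw [htop]; exact le_top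
      · obtain ⟨S', hS', hle⟩ := hswap T (hc ▸ hl3 T hT)
        rw [← hS'] at htop ⊢
        rw [← ((hspec S').1 htop).1]
        exact_mod_cast hle
    have hsum := List.card_nsmul_le_sum _ _ hle
    rw [List.length_map, nsmul_eq_mul] at hsum
    rw [← hSx, ho] at hl4
    have : (8 * q * (l.length * x' + x) : ℕ∞) ≤ 8 * q * (l.length * x + o) + (x + o) :=
      le_trans (by gcongr) hl4
    exact_mod_cast this
  · rw [Finset.not_nonempty_iff_eq_empty, Finset.union_eq_empty] at hne
    rw [hne.1, ← hne.2, ho] at hSx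
    have hxo : o = x := by exact_mod_cast hSx.symm
    refine ⟨1, le_rfl, by omega, ?_⟩
    rw [hxo]
    have := Nat.mul_le_mul_left (8 * q) himp
    nlinarith

/-- A sequence that makes progress towards `(8q+1)/(8q-1) o` gets there. -/
theorem converges {q W K o N : ℕ} {x : ℕ → ℕ} (hq : 1 ≤ q) (hK : 1 ≤ K) (h0 : x 0 < 2 ^ W)
    (hmono : ∀ t, x (t + 1) ≤ x t)
    (hstep : ∀ t, ∃ k, 1 ≤ k ∧ k ≤ K ∧
      8 * q * (k * x (t + 1) + x t) ≤ 8 * q * (k * x t + o) + (x t + o))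
    (hN : 2 * K * (W + 8 * q) ≤ N) : q * x N ≤ (q + 1) * o := by
  -- By integrality the left side is then at most `0`, and `q (8 q + 1) ≤ (8 q - 1) (q + 1)`.
  suffices H : (8 * (q : ℝ) - 1) * x N - (8 * q + 1) * o < 1 by
    have h1 : (8 * (q : ℤ) - 1) * x N - (8 * q + 1) * o < 1 := by exact_mod_cast H
    have h2 : (8 * (q : ℤ) - 1) * x N ≤ (8 * q + 1) * o := by omega
    have hq' : (1 : ℤ) ≤ q := by exact_mod_cast hq
    have ho : (0 : ℤ) ≤ o := Nat.cast_nonneg o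
    have h3 : (8 * (q : ℤ) - 1) * (q * x N) ≤ (8 * q - 1) * ((q + 1) * o) := by
      calc (8 * (q : ℤ) - 1) * (q * x N) = q * ((8 * (q : ℤ) - 1) * x N) := by ring
        _ ≤ q * ((8 * q + 1) * o) := mul_le_mul_of_nonneg_left h2 (by omega)
        _ ≤ (8 * q - 1) * ((q + 1) * o) := by nlinarith [mul_nonneg (sub_nonneg.2 hq') ho]
    have h4 : (q : ℤ) * x N ≤ (q + 1) * o := le_of_mul_le_mul_left h3 (by omega)
    exact_mod_cast h4
  by_contra! hcon
  have hqr : (1 : ℝ) ≤ q := by exact_mod_cast hq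
  have hKr : (1 : ℝ) ≤ K := by exact_mod_cast hK
  let z : ℕ → ℝ := fun t => (8 * (q : ℝ) - 1) * x t - (8 * q + 1) * o
  have hzmono : Antitone z := antitone_nat_of_succ_le fun t => by
    have : (x (t + 1) : ℝ) ≤ x t := by exact_mod_cast hmono t
    have : (8 * (q : ℝ) - 1) * x (t + 1) ≤ (8 * (q : ℝ) - 1) * x t :=
      mul_le_mul_of_nonneg_left this (by linarith)
    simp only [z]; linarith
  -- The progress hypothesis says `z t ≤ 8 q k (x t - x (t + 1))`. The drop of `z` is `8 q - 1`
  -- times that of `x`, and `8 q ≤ 2 (8 q - 1)` gives the factor `2`.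
  set θ : ℝ := 1 - 1 / (2 * K) with hθ
  have hzstep : ∀ t, z (t + 1) ≤ z t * θ := by
    intro t
    obtain ⟨k, hk1, hkK, hk⟩ := hstep t
    have hkr : (8 * q * (k * x (t + 1) + x t) : ℝ) ≤ 8 * q * (k * x t + o) + (x t + o) := by
      exact_mod_cast hk
    have hxr : (x (t + 1) : ℝ) ≤ x t := by exact_mod_cast hmono t
    have hkK' : (k : ℝ) ≤ K := by exact_mod_cast hkK
    have h1 : z t ≤ 8 * q * (k * (x t - x (t + 1))) := by simp only [z]; linarith
    have h2 : k * ((x t : ℝ) - x (t + 1)) ≤ K * (x t - x (t + 1)) :=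
      mul_le_mul_of_nonneg_right hkK' (by linarith)
    have h3 : z t ≤ 2 * K * (z t - z (t + 1)) := by
      have h4 : z t - z (t + 1) = (8 * (q : ℝ) - 1) * (x t - x (t + 1)) := by simp only [z]; ring
      have h5 : 0 ≤ K * ((x t : ℝ) - x (t + 1)) := mul_nonneg (by linarith) (by linarith)
      rw [h4]
      nlinarith
    have h6 : z t * θ = z t - z t / (2 * K) := by rw [hθ]; ring
    have h7 : z t / (2 * K) ≤ z t - z (t + 1) := by
      rw [div_le_iff₀ (by linarith)]; linarith
    linarith
  have hθ0 : 0 ≤ θ := by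
    rw [hθ, sub_nonneg, div_le_one (by linarith)]; linarith
  have hzpow : ∀ t, z t ≤ z 0 * θ ^ t := by
    intro t
    induction t with
    | zero => simp
    | succ t ih =>
      rw [pow_succ, ← mul_assoc]
      exact (hzstep t).trans (mul_le_mul_of_nonneg_right ih hθ0)
  have hz0 : z 0 ≤ 8 * q * 2 ^ W := by
    have h1 : (x 0 : ℝ) ≤ 2 ^ W := by exact_mod_cast h0.le
    have h2 : (0 : ℝ) ≤ o := Nat.cast_nonneg o
    have h3 : (8 * (q : ℝ) - 1) * x 0 ≤ (8 * (q : ℝ) - 1) * 2 ^ W :=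
      mul_le_mul_of_nonneg_left h1 (by linarith)
    have h4 : (0 : ℝ) ≤ 2 ^ W := by positivity
    simp only [z]
    nlinarith
  -- The number of rounds is chosen so that this beats the initial excess, at most `8 q 2 ^ W < exp
  -- (W + 8 q)`.
  have hexp : θ ^ N ≤ Real.exp (-(W + 8 * q)) := by
    have h1 : θ ≤ Real.exp (-(1 / (2 * K))) := by
      have := Real.add_one_le_exp (-(1 / (2 * K) : ℝ))
      rw [hθ]; linarith
    refine (pow_le_pow_left₀ hθ0 h1 N).trans ?_
    rw [← Real.exp_nat_mul, Real.exp_le_exp]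
    have h2 : (2 * K * (W + 8 * q) : ℝ) ≤ N := by exact_mod_cast hN
    have h3 : (W + 8 * q : ℝ) ≤ N * (1 / (2 * K)) := by
      rw [mul_one_div, le_div_iff₀ (by linarith)]; linarith
    linarith
  have h2W : (2 : ℝ) ^ W ≤ Real.exp W := by
    have h1 : (2 : ℝ) ≤ Real.exp 1 := by have := Real.add_one_le_exp (1 : ℝ); linarith
    calc (2 : ℝ) ^ W ≤ Real.exp 1 ^ W := pow_le_pow_left₀ (by norm_num) h1 W
      _ = Real.exp W := by rw [← Real.exp_nat_mul, mul_one]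
  have h8q : 8 * (q : ℝ) < Real.exp (8 * q) := by
    have := Real.add_one_le_exp (8 * (q : ℝ)); linarith
  have hlt : 8 * (q : ℝ) * 2 ^ W < Real.exp (W + 8 * q) := by
    rw [add_comm, Real.exp_add]
    exact mul_lt_mul h8q h2W (by positivity) (Real.exp_pos _).le
  have h1 : (1 : ℝ) ≤ z N := hcon
  have h2 := hzpow N
  have h3 : z 0 * θ ^ N ≤ 8 * q * 2 ^ W * Real.exp (-(W + 8 * q)) :=
    mul_le_mul hz0 hexp (pow_nonneg hθ0 N) (by positivity)
  have h4 : 8 * (q : ℝ) * 2 ^ W * Real.exp (-(W + 8 * q)) < 1 := by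
    rw [Real.exp_neg, ← div_eq_mul_inv, div_lt_one (Real.exp_pos _)]
    exact hlt
  linarith

/-- Local search finds a nearly optimal solution. -/
theorem localSearch_spec {q h c : ℕ} (hc : c = 384 * (h + 1) ^ 2) (hD : Decodes m G C)
    (hq : m 1 = q) (hq1 : 1 ≤ q)
    (hF : EnoughSwaps F W n q c) (hG : ¬ HasCliqueMinor G Finset.univ h) {M : ℕ}
    (hM : ∀ u v, G.Adj u v → lenInt F m n u v ≤ M)
    (hMW : openInt F m * n + n * (n * M) + n * M < 2 ^ W) (O : Finset (Fin n)) :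
    q * natCost G (lenInt F m n) (openInt F m) C
        (setOfBits F n (localSearch F m c W)) ≤
      (q + 1) * natCost G (lenInt F m n) (openInt F m) C O := by
  obtain ⟨S₀, hS₀⟩ : ∃ S₀, S₀ = arrayOf F 1 (m 2) fun _ => 1 := ⟨_, rfl⟩
  obtain ⟨S, hSdef⟩ : ∃ S, S = natFold (fun _ S => improve F m c W S) S₀ := ⟨_, rfl⟩
  have hS0 : S 0 = S₀ := by rw [hSdef, natFold]
  have hS : ∀ t, S (t + 1) = improve F m c W (S t) := fun t => by rw [hSdef, natFold_succ]
  have hspec := fun S => costInt_spec hD hF.toEnough hM hMW S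
  by_cases htop : natCost G (lenInt F m n) (openInt F m) C O = ⊤
  · rw [htop, ENat.mul_top (by exact_mod_cast Nat.succ_ne_zero q)]
    exact le_top
  obtain ⟨o, ho⟩ := ENat.ne_top_iff_exists.1 htop
  -- With all vertices open every client has distance zero, so local search starts, and stays, at
  -- finite cost.
  have h0 : costInt F m W (S 0) < 2 ^ W := by
    refine ((hspec _).1 (ne_of_lt ?_)).2
    have huniv : setOfBits F n (S 0) = Finset.univ := by
      ext v
      have : arrayGet F 1 S₀ v = 1 := by
        rw [hS₀, hD.order, arrayGet_arrayOf hF.pos hF.order (by have := hF.order; omega) (by simp) v.2]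
      simp [setOfBits, hS0, this]
    rw [huniv, natCost]
    refine ENat.add_lt_top.2 ⟨by exact_mod_cast ENat.natCast_lt_top _, ?_⟩
    refine WithTop.sum_lt_top.2 fun v _ => ?_
    exact (setDist_le (Finset.mem_univ v) .nil).trans_lt (ENat.natCast_lt_top _)
  have hmono : ∀ t, costInt F m W (S (t + 1)) ≤ costInt F m W (S t) := fun t =>
    by rw [hS]; exact (improve_spec hD hq hF (S t)).1
  have hsmall : ∀ t, costInt F m W (S t) < 2 ^ W := by
    intro t
    induction t with
    | zero => exact h0
    | succ t ih => exact (hmono t).trans_lt ih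
  have hfin := converges (x := fun t => costInt F m W (S t)) hq1 (Nat.le_add_left 1 (2 * n)) h0 hmono
    (fun t => by
      rw [hS t]
      exact exists_progress hc hD hq hq1 hF hG hM hMW ho.symm (hsmall t)) hF.rounds
  have hls : localSearch F m c W = S F := by rw [localSearch, fold_eq le_rfl, ← hS₀, hSdef]
  have hne : natCost G (lenInt F m n) (openInt F m) C (setOfBits F n (S F)) ≠ ⊤ := fun h =>
    absurd ((hspec _).2 h) (not_le.2 (hsmall F))
  rw [hls, ← ((hspec _).1 hne).1, ← ho]
  exact_mod_cast hfin

end Convergence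

/-! ### The layout of the input in memory. -/

section Lists

theorem getD_flatMap {β : Type*} {k c : ℕ} (f : β → List ℕ) (l : List β)
    (hf : ∀ b ∈ l, (f b).length = k) (i : ℕ) (hi : i < l.length) (hc : c < k) :
    (l.flatMap f).getD (k * i + c) 0 = (f l[i]).getD c 0 := by
  induction l generalizing i with
  | nil => simp at hi
  | cons b l ih =>
    have hb := hf b (by simp)
    rw [List.flatMap_cons]
    cases i with
    | zero =>
      rw [List.getD_append _ _ _ _ (by rw [hb]; simpa using hc)]
      simp
    | succ i =>
      have hk : k * (i + 1) + c = k + (k * i + c) := by ring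
      rw [List.getD_append_right _ _ _ _ (by rw [hb]; omega), hb, hk, Nat.add_sub_cancel_left]
      exact ih (fun b' hb' => hf b' (by simp [hb'])) i (by simpa using hi)

theorem length_flatMap_const {β : Type*} {k : ℕ} (f : β → List ℕ) (l : List β)
    (hf : ∀ b ∈ l, (f b).length = k) : (l.flatMap f).length = k * l.length := by
  induction l with
  | nil => simp
  | cons b l ih =>
    rw [List.flatMap_cons, List.length_append, hf b (by simp),
      ih fun b' hb' => hf b' (by simp [hb']), List.length_cons]
    ring

variable (ε : ℚ≥0) (I : Instance)

/-- The initial memory -/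
noncomputable def inputMem (i : ℕ) : ℕ := (input ε I).getD i 0

open Classical in
/-- An entry of the adjacency matrix -/
noncomputable def entry (u v : Fin I.n) : List ℕ :=
  if I.graph.Adj u v then [1, (I.weight s(u, v)).num, (I.weight s(u, v)).den] else [0, 0, 0]

open Classical in
theorem input_eq : input ε I = [ε.num, ε.den, I.n, I.openCost.num, I.openCost.den] ++
    (((List.finRange I.n).map fun v => if v ∈ I.clients then 1 else 0) ++
    ((List.finRange I.n).flatMap fun u => (List.finRange I.n).flatMap fun v => entry I u v)) := by
  simp [input, Instance.encode, entry]

theorem length_entry (u v : Fin I.n) : (entry I u v).length = 3 := by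
  rw [entry]; split_ifs <;> rfl

theorem length_input : (input ε I).length = 5 + I.n + 3 * (I.n * I.n) := by
  classical
  rw [input_eq, List.length_append, List.length_append, List.length_map, List.length_finRange,
    length_flatMap_const (k := 3 * I.n)]
  · simp; ring
  · intro u _
    rw [length_flatMap_const (k := 3) _ _ fun v _ => length_entry I u v, List.length_finRange]

theorem inputMem_one : inputMem ε I 1 = ε.den := by simp [inputMem, input_eq]
theorem inputMem_two : inputMem ε I 2 = I.n := by simp [inputMem, input_eq]
theorem inputMem_three : inputMem ε I 3 = I.openCost.num := by simp [inputMem, input_eq]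
theorem inputMem_four : inputMem ε I 4 = I.openCost.den := by simp [inputMem, input_eq]

open Classical in
theorem inputMem_client (v : Fin I.n) :
    inputMem ε I (5 + v) = if v ∈ I.clients then 1 else 0 := by
  rw [inputMem, input_eq, List.getD_append_right _ _ _ _ (by simp),
    List.getD_append _ _ _ _ (by simp)]
  simp

theorem inputMem_edge (u v : Fin I.n) (c : ℕ) (hc : c < 3) :
    edgeAt (inputMem ε I) (I.n * u + v) c = (entry I u v).getD c 0 := by
  classical
  rw [edgeAt, inputMem_two, inputMem, input_eq, List.getD_append_right _ _ _ _ (by simp; omega),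
    List.getD_append_right _ _ _ _ (by simp; omega)]
  have hidx : 5 + I.n + (I.n * u + v + (I.n * u + v) + (I.n * u + v)) + c -
      [ε.num, ε.den, I.n, I.openCost.num, I.openCost.den].length -
      ((List.finRange I.n).map fun v => if v ∈ I.clients then 1 else 0).length =
      3 * I.n * u + (3 * v + c) := by
    simp only [List.length_cons, List.length_nil, List.length_map, List.length_finRange]
    have : 3 * I.n * (u : ℕ) = I.n * u + I.n * u + I.n * u := by ring
    omega
  rw [hidx, getD_flatMap (k := 3 * I.n) _ _ ?_ u (by simp) (by omega),
    getD_flatMap (k := 3) _ _ (fun v _ => length_entry I _ v) v (by simp) hc]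
  · simp
  · intro u _
    rw [length_flatMap_const (k := 3) _ _ fun v _ => length_entry I u v, List.length_finRange]

theorem edgeAt_of_adj {u v : Fin I.n} (h : I.graph.Adj u v) :
    edgeAt (inputMem ε I) (I.n * u + v) 0 = 1 ∧
    edgeAt (inputMem ε I) (I.n * u + v) 1 = (I.weight s(u, v)).num ∧
    edgeAt (inputMem ε I) (I.n * u + v) 2 = (I.weight s(u, v)).den := by
  refine ⟨?_, ?_, ?_⟩ <;> rw [inputMem_edge ε I u v _ (by norm_num), entry, if_pos h] <;> rfl

theorem decodes_input : Decodes (inputMem ε I) I.graph I.clients where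
  order := inputMem_two ε I
  adj u v := by
    by_cases h : I.graph.Adj u v
    · simp [(edgeAt_of_adj ε I h).1, h]
    · rw [inputMem_edge ε I u v 0 (by norm_num), entry, if_neg h]
      simp [h]
  client v := by
    classical
    rw [inputMem_client]
    split_ifs with h <;> simp [h]

/-- Non-edges are encoded with denominator `0`; `denAt` reads `1` there, so the product of all
denominators is a valid scaling factor. -/
theorem denAt_pos (j : ℕ) (hj : j < I.n * I.n) : 0 < denAt (inputMem ε I) j := by
  have hn : 0 < I.n := Nat.pos_of_ne_zero fun h => by simp [h] at hj
  obtain ⟨u, v, rfl⟩ : ∃ u v : Fin I.n, j = I.n * u + v :=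
    ⟨⟨j / I.n, Nat.div_lt_of_lt_mul hj⟩, ⟨j % I.n, Nat.mod_lt _ hn⟩, (Nat.div_add_mod _ _).symm⟩
  rw [denAt]
  by_cases h : I.graph.Adj u v
  · rw [(edgeAt_of_adj ε I h).2.2]
    split_ifs
    · exact NNRat.den_pos _
    · exact one_pos
  · rw [if_neg ((decodes_input ε I).adj u v |>.not.2 h)]
    exact one_pos

end Lists

/-! ### Clearing denominators and bounding the resulting integers. -/

section Scaling

variable {F l : ℕ} {m : ℕ → ℕ}

theorem natFold_mulBig (hF : 1 ≤ F) {g : ℕ → ℕ} (hg : ∀ i, g i < 2 ^ F) (x n : ℕ) :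
    natFold (fun i z => mulBig F z (g i)) x n = x * ∏ i ∈ Finset.range n, g i := by
  induction n with
  | zero => simp [natFold]
  | succ n ih => rw [natFold, ih, mulBig_eq hF (hg n), Finset.prod_range_succ, mul_assoc]

/-- The numbers in the memory have at most `l` bits, and `F` is large enough for multiplications. -/
structure Bounded (F : ℕ) (m : ℕ → ℕ) (l : ℕ) : Prop where
  pos : 1 ≤ l
  cells : ∀ i, m i < 2 ^ l
  bits : l ≤ F
  order : m 2 ≤ F
  square : m 2 * m 2 ≤ F

variable (hB : Bounded F m l)
include hB

theorem Bounded.edgeAt_lt (j c : ℕ) : edgeAt m j c < 2 ^ l := hB.cells _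

theorem Bounded.denAt_lt (j : ℕ) : denAt m j < 2 ^ l := by
  rw [denAt]
  split_ifs
  · exact hB.cells _
  · exact Nat.one_lt_two_pow (by have := hB.pos; omega)

theorem Bounded.factor_lt (i j : ℕ) : (if i = j then edgeAt m i 1 else denAt m i) < 2 ^ l := by
  split_ifs
  · exact hB.edgeAt_lt _ _
  · exact hB.denAt_lt _

theorem Bounded.pow_le : 2 ^ l ≤ 2 ^ F := Nat.pow_le_pow_right (by norm_num) hB.bits

theorem openInt_eq : openInt F m = m 3 * ∏ i ∈ Finset.range (m 2 * m 2), denAt m i := by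
  rw [openInt, mulSmall_eq hB.order, fold_eq hB.square,
    natFold_mulBig (hB.pos.trans hB.bits) fun i => (hB.denAt_lt i).trans_le hB.pow_le]

theorem weightInt_eq (j : ℕ) : weightInt F m j =
    m 4 * ∏ i ∈ Finset.range (m 2 * m 2), if i = j then edgeAt m i 1 else denAt m i := by
  rw [weightInt, mulSmall_eq hB.order, fold_eq hB.square,
    natFold_mulBig (hB.pos.trans hB.bits) fun i => (hB.factor_lt i j).trans_le hB.pow_le]

omit hB in
theorem mul_prod_le_pow {x n : ℕ} {g : ℕ → ℕ} (hx : x < 2 ^ l) (hg : ∀ i, g i < 2 ^ l) :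
    x * ∏ i ∈ Finset.range n, g i ≤ 2 ^ (l * (n + 1)) := by
  have : ∏ i ∈ Finset.range n, g i ≤ (2 ^ l) ^ n := by
    simpa using Finset.prod_le_pow_card (Finset.range n) g (2 ^ l) fun i _ => (hg i).le
  calc _ ≤ 2 ^ l * (2 ^ l) ^ n := Nat.mul_le_mul hx.le this
    _ = 2 ^ (l * (n + 1)) := by rw [← pow_mul, ← pow_add]; congr 1; ring

theorem Bounded.openInt_le : openInt F m ≤ 2 ^ (l * (m 2 * m 2 + 1)) := by
  rw [openInt_eq hB]
  exact mul_prod_le_pow (hB.cells _) hB.denAt_lt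

theorem Bounded.weightInt_le (j : ℕ) : weightInt F m j ≤ 2 ^ (l * (m 2 * m 2 + 1)) := by
  rw [weightInt_eq hB]
  exact mul_prod_le_pow (hB.cells _) fun i => hB.factor_lt i j

/-- With `M = 2 ^ (l (n² + 1))` and `n < 2 ^ l`, each of the three terms is at most `2 ^ (2 l) M`,
and `4 ≤ 2 ^ (2 l)`. This explains the `5 = 1 + 4` in the exponent. -/
theorem Bounded.cost_lt :
    openInt F m * m 2 + m 2 * (m 2 * 2 ^ (l * (m 2 * m 2 + 1))) + m 2 * 2 ^ (l * (m 2 * m 2 + 1)) <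
      2 ^ (l * (m 2 * m 2 + 5)) := by
  have h1 := hB.openInt_le
  have h2 := (hB.cells 2).le
  have hl : 1 ≤ 2 ^ l := Nat.one_le_two_pow
  have h4 : 4 ≤ 2 ^ l * 2 ^ l := by
    have : 2 ^ 1 ≤ 2 ^ l := Nat.pow_le_pow_right (by norm_num) hB.pos
    nlinarith
  set M := 2 ^ (l * (m 2 * m 2 + 1)) with hM
  have hM0 : 0 < M := by positivity
  have h5 : 2 ^ (l * (m 2 * m 2 + 5)) = 2 ^ l * 2 ^ l * (2 ^ l * (2 ^ l * M)) := by
    rw [hM, ← pow_add, ← pow_add, ← pow_add, ← pow_add]; congr 1; ring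
  rw [h5]
  have h6 : openInt F m * m 2 ≤ 2 ^ l * M := by
    rw [mul_comm]; exact Nat.mul_le_mul h2 h1
  have h7 : m 2 * M ≤ 2 ^ l * M := Nat.mul_le_mul_right _ h2
  have h8 : m 2 * (m 2 * M) ≤ 2 ^ l * (2 ^ l * M) := Nat.mul_le_mul h2 h7
  have h9 : 2 ^ l * M ≤ 2 ^ l * (2 ^ l * M) := Nat.le_mul_of_pos_left _ (by positivity)
  have h10 : 0 < 2 ^ l * (2 ^ l * M) := by positivity
  have h11 := Nat.mul_le_mul_right (2 ^ l * (2 ^ l * M)) h4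
  omega

end Scaling

/-! ### Comparison of scaled and true costs. -/

section Cost

variable {F l : ℕ} (ε : ℚ≥0) (I : Instance)

/-- The product of all denominators -/
noncomputable def commonDen : ℕ :=
  inputMem ε I 4 * ∏ i ∈ Finset.range (I.n * I.n), denAt (inputMem ε I) i

theorem commonDen_pos : 0 < commonDen ε I := by
  refine Nat.mul_pos ?_ (Finset.prod_pos fun i hi => denAt_pos ε I i (Finset.mem_range.1 hi))
  rw [inputMem_four]; exact NNRat.den_pos _

variable (hB : Bounded F (inputMem ε I) l)
include hB

theorem openInt_input : (openInt F (inputMem ε I) : ℚ≥0) = commonDen ε I * I.openCost := by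
  rw [openInt_eq hB, commonDen, inputMem_three, inputMem_four, inputMem_two]
  push_cast
  conv_rhs => rw [mul_right_comm]
  rw [mul_comm (I.openCost.den : ℚ≥0), NNRat.mul_den_eq_num]

/-- In the product of all denominators the factor of the edge itself is replaced by its numerator,
which multiplies the product by the weight. -/
theorem lenInt_input {u v : Fin I.n} (h : I.graph.Adj u v) :
    (lenInt F (inputMem ε I) I.n u v : ℚ≥0) = commonDen ε I * I.weight s(u, v) := by
  obtain ⟨h0, h1, h2⟩ := edgeAt_of_adj ε I h
  rw [lenInt, weightInt_eq hB, commonDen, inputMem_two]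
  set j := I.n * (u : ℕ) + v with hj
  have hjn : j ∈ Finset.range (I.n * I.n) := by
    rw [Finset.mem_range, hj]
    have := u.2
    have := v.2
    have : I.n * ((u : ℕ) + 1) ≤ I.n * I.n := Nat.mul_le_mul_left _ (by omega)
    rw [Nat.mul_succ] at this
    omega
  rw [← Finset.mul_prod_erase _ _ hjn, ← Finset.mul_prod_erase _ (denAt (inputMem ε I)) hjn,
    if_pos rfl, h1, denAt, h0, h2,
    Finset.prod_congr rfl fun i hi => if_neg (Finset.ne_of_mem_erase hi)]
  simp only [ne_eq, one_ne_zero, not_false_eq_true, if_true]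
  push_cast
  rw [← NNRat.mul_den_eq_num (I.weight s(u, v))]
  ring

theorem wlen_input {u v : Fin I.n} (p : I.graph.Walk u v) :
    (wlen (lenInt F (inputMem ε I) I.n) p : ℚ≥0) = commonDen ε I * I.walkLength p := by
  induction p with
  | nil => simp [wlen, Instance.walkLength]
  | cons h p ih =>
    simp only [wlen, Instance.walkLength, SimpleGraph.Walk.edges_cons, List.map_cons, List.sum_cons,
      Nat.cast_add, mul_add] at ih ⊢
    rw [lenInt_input ε I hB h, ih]

theorem setDist_input (S : Finset (Fin I.n)) (v : Fin I.n) :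
    ((setDist I.graph (lenInt F (inputMem ε I) I.n) S v : ℕ∞) : ℝ≥0∞) =
      commonDen ε I * ⨅ u ∈ S, I.dist v u := by
  have h0 : ((commonDen ε I : ℕ) : ℝ≥0∞) ≠ 0 := by
    exact_mod_cast (commonDen_pos ε I).ne'
  have ht : ((commonDen ε I : ℕ) : ℝ≥0∞) ≠ ⊤ := ENNReal.natCast_ne_top _
  rw [setDist, ENat.toENNReal_iInf, ENNReal.mul_iInf_of_ne h0 ht]
  refine iInf_congr fun u => ?_
  rw [ENat.toENNReal_iInf, ENNReal.mul_iInf_of_ne h0 ht]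
  refine iInf_congr fun _ => ?_
  rw [ENat.toENNReal_iInf, Instance.dist, ENNReal.mul_iInf_of_ne h0 ht]
  refine iInf_congr fun p => ?_
  have h1 := congrArg (fun x : ℚ≥0 => ((x : ℝ≥0) : ℝ≥0∞)) (wlen_input ε I hB p)
  simpa using h1

theorem natCost_input (S : Finset (Fin I.n)) :
    ((natCost I.graph (lenInt F (inputMem ε I) I.n) (openInt F (inputMem ε I)) I.clients S : ℕ∞) :
      ℝ≥0∞) = commonDen ε I * I.cost S := by
  have h1 := congrArg (fun x : ℚ≥0 => ((x : ℝ≥0) : ℝ≥0∞)) (openInt_input ε I hB)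
  have h2 : ((openInt F (inputMem ε I) : ℕ) : ℝ≥0∞) =
      commonDen ε I * ((I.openCost : ℝ≥0) : ℝ≥0∞) := by simpa using h1
  rw [natCost, Instance.cost, mul_add, Finset.mul_sum, ← mul_assoc, ← h2]
  simp only [ENat.toENNReal_add, ENat.toENNReal_mul, ENat.toENNReal_coe]
  congr 1
  rw [← Finset.sum_congr rfl fun v _ => setDist_input ε I hB S v]
  exact map_sum ENat.toENNRealRingHom _ _

/-- The approximation guarantee for the scaled costs gives the one for the true costs. -/
theorem cost_le_of_natCost_le (hε : 0 < ε) {S O : Finset (Fin I.n)}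
    (h : (ε.den : ℕ∞) * natCost I.graph (lenInt F (inputMem ε I) I.n) (openInt F (inputMem ε I))
        I.clients S ≤ (ε.den + 1) *
      natCost I.graph (lenInt F (inputMem ε I) I.n) (openInt F (inputMem ε I)) I.clients O) :
    I.cost S ≤ (1 + ((ε : ℝ≥0) : ℝ≥0∞)) * I.cost O := by
  have h1 := ENat.toENNReal_mono h
  simp only [ENat.toENNReal_add, ENat.toENNReal_mul, ENat.toENNReal_coe, ENat.toENNReal_one,
    natCost_input ε I hB] at h1
  -- Only the denominator of `ε` enters the algorithm; a positive numerator gives `1 / ε.den ≤ ε`.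
  have hnum : (1 : ℕ) ≤ ε.num := Nat.one_le_iff_ne_zero.2 (NNRat.num_ne_zero.2 hε.ne')
  have h2 : ((ε.den : ℕ) : ℝ≥0∞) * ((ε : ℝ≥0) : ℝ≥0∞) = ε.num := by
    have := congrArg (fun x : ℚ≥0 => ((x : ℝ≥0) : ℝ≥0∞)) (NNRat.den_mul_eq_num ε)
    simpa only [NNRat.cast_mul, NNRat.cast_natCast, ENNReal.coe_mul, ENNReal.coe_natCast] using this
  have h3 : ((ε.den : ℕ) : ℝ≥0∞) + 1 ≤ ε.den * (1 + ((ε : ℝ≥0) : ℝ≥0∞)) := by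
    rw [mul_add, mul_one, h2]
    gcongr
    exact_mod_cast hnum
  have h4 : ((ε.den : ℕ) : ℝ≥0∞) * commonDen ε I ≠ 0 := by
    exact_mod_cast (Nat.mul_pos (NNRat.den_pos ε) (commonDen_pos ε I)).ne'
  have h5 : ((ε.den : ℕ) : ℝ≥0∞) * commonDen ε I ≠ ⊤ :=
    ENNReal.mul_ne_top (ENNReal.natCast_ne_top _) (ENNReal.natCast_ne_top _)
  refine (ENNReal.mul_le_mul_iff_right h4 h5).1 ?_
  calc ((ε.den : ℕ) : ℝ≥0∞) * commonDen ε I * I.cost S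
      = ε.den * (commonDen ε I * I.cost S) := by ring
    _ ≤ (ε.den + 1) * (commonDen ε I * I.cost O) := h1
    _ ≤ ε.den * (1 + ((ε : ℝ≥0) : ℝ≥0∞)) * (commonDen ε I * I.cost O) := by gcongr
    _ = _ := by ring

end Cost

/-! ### The phases of the final program. -/

section Phases

/-- Registers `0` and `2` contain `F` and `l`, and the memory is `m`. -/
structure Shows (s : State) (F l : ℕ) (m : ℕ → ℕ) : Prop where
  fuel : s.reg 0 = F
  num : s.reg 2 = l
  mem : s.mem = m

theorem Comp.exists_assign {f : Root × ℕ → ℕ} (hf : Comp f) (y : ℕ) (hy : y < 3) :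
    ∃ P T, ∀ s F l m, Shows s F l m → ∃ t s', Exec P s t s' ∧ t ≤ Polynomial.eval F T ∧
      s' = s'.setReg y (f (⟨F, m⟩, l)) ∧ ∀ x < 3, x ≠ y → s'.reg x = s.reg x ∧ s'.mem = m := by
  obtain ⟨P, T, hP⟩ := hf (fun _ => 2) 3 (by norm_num) fun _ _ => by norm_num
  refine ⟨.seq P (.seq (.const y 0) (.add y y 3)), T + 2, fun s F l m hs => ?_⟩
  obtain ⟨t, s₁, he, ht, hv, hsame⟩ := hP (⟨F, m⟩, l) s
    ⟨hs.fuel, hs.mem, fun i hi => by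
      obtain rfl : i = 0 := by simp only [Ctx.len] at hi; omega
      exact hs.num⟩
  obtain ⟨s₂, he₂, rfl⟩ := exec_copy y 3 (by omega) s₁
  refine ⟨_, _, Exec.seq he he₂, ?_, ?_, fun x hx hxy => ⟨?_, hsame.2.trans hs.mem⟩⟩
  · have h2 : Polynomial.eval F (2 : Polynomial ℕ) = 2 := by simp [Polynomial.eval_ofNat]
    rw [Polynomial.eval_add, h2]
    exact Nat.add_le_add_right ht 2
  · simp [State.setReg, hv]
  · simp [hxy, hsame.1 x hx]

/-- Computes the loop bound of the next phase; the time is measured in the old bound. -/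
theorem Comp.exists_refuel {f : Root × ℕ → ℕ} (hf : Comp f) :
    ∃ P T, ∀ s F l m, Shows s F l m → ∃ t s', Exec P s t s' ∧ t ≤ Polynomial.eval F T ∧
      Shows s' (f (⟨F, m⟩, l)) l m := by
  obtain ⟨P, T, hP⟩ := hf.exists_assign 0 (by norm_num)
  refine ⟨P, T, fun s F l m hs => ?_⟩
  obtain ⟨t, s', he, ht, h1, h2⟩ := hP s F l m hs
  have h3 := h2 2 (by norm_num) (by norm_num)
  refine ⟨t, s', he, ht, ?_, h3.1.trans hs.num, h3.2⟩
  rw [h1]; simp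

theorem Comp.exists_store {f : Root × ℕ → ℕ} (hf : Comp f) :
    ∃ P T, ∀ s F l m, Shows s F l m → ∃ t s', Exec P s t s' ∧ t ≤ Polynomial.eval F T ∧
      Shows s' F (f (⟨F, m⟩, l)) m := by
  obtain ⟨P, T, hP⟩ := hf.exists_assign 2 (by norm_num)
  refine ⟨P, T, fun s F l m hs => ?_⟩
  obtain ⟨t, s', he, ht, h1, h2⟩ := hP s F l m hs
  have h3 := h2 0 (by norm_num) (by norm_num)
  refine ⟨t, s', he, ht, h3.1.trans hs.fuel, ?_, h3.2⟩
  rw [h1]; simp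

theorem size_half (x : ℕ) : Nat.size (x / 2) = Nat.size x - 1 := by
  refine le_antisymm (Nat.size_le.2 ?_) ?_
  · rcases Nat.eq_zero_or_pos x with rfl | hx
    · simp
    have h1 := Nat.lt_size_self x
    have h2 : 0 < Nat.size x := Nat.size_pos.2 hx
    obtain ⟨k, hk⟩ : ∃ k, Nat.size x = k + 1 := ⟨_, (Nat.succ_pred_eq_of_pos h2).symm⟩
    rw [hk] at h1 ⊢
    rw [pow_succ] at h1
    rw [Nat.add_sub_cancel]
    omega
  · have h1 := Nat.lt_size_self (x / 2)
    have : Nat.size x ≤ Nat.size (x / 2) + 1 := Nat.size_le.2 (by rw [pow_succ]; omega)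
    omega

/-- This loop is not capped by the fuel, which at this point does not yet account for the bit length
of the input numbers. -/
theorem exec_size :
    ∃ P, ∀ s F l m, Shows s F l m → ∃ t s', Exec P s t s' ∧ t ≤ 3 * Nat.size l + 5 ∧
      Shows s' F (Nat.size l) m := by
  let Q : Prog := .seq (.add 3 3 4) (.half 2 2)
  have hloop : ∀ k s, Nat.size (s.reg 2) = k → s.reg 4 = 1 → ∃ s', Exec (.loop 2 Q) s (3 * k + 1) s' ∧
      s'.reg 3 = s.reg 3 + k ∧ s'.reg 0 = s.reg 0 ∧ s'.mem = s.mem := by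
    intro k
    induction k with
    | zero =>
      intro s hk _
      exact ⟨s, Exec.loopDone (Nat.size_eq_zero.1 hk), rfl, rfl, rfl⟩
    | succ k ih =>
      intro s hk h4
      obtain ⟨s', he, h1, h2, h3⟩ := ih ((s.setReg 3 (s.reg 3 + s.reg 4)).setReg 2 (s.reg 2 / 2))
        (by simp [size_half, hk]) (by simp [h4])
      refine ⟨s', ?_, ?_, ?_, ?_⟩
      · have := Exec.loopStep (x := 2) (P := Q) (by intro h; simp [h] at hk)
          (Exec.seq (Exec.add 3 3 4 s) (Exec.half 2 2 _)) (by simpa using he)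
        convert this using 1
        ring
      · rw [h1]; simp [h4]; ring
      · rw [h2]; simp
      · rw [h3]; simp
  refine ⟨.seq (.const 3 0) (.seq (.const 4 1) (.seq (.loop 2 Q) (.seq (.const 2 0) (.add 2 2 3)))),
    fun s F l m hs => ?_⟩
  obtain ⟨s', he, h1, h2, h3⟩ := hloop (Nat.size l) ((s.setReg 3 0).setReg 4 1)
    (by simp [hs.num]) (by simp)
  refine ⟨_, _, Exec.seq (Exec.const _ _ _) (Exec.seq (Exec.const _ _ _) (Exec.seq he
    (Exec.seq (Exec.const _ _ _) (Exec.add _ _ _ _)))), by omega, ?_, ?_, ?_⟩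
  · simp [h2, hs.fuel]
  · simp [h1]
  · simp [h3, hs.mem]

/-- The binary digits of a number are written to the memory. -/
theorem exec_output :
    ∃ P, ∀ s F S m, Shows s F S m → ∃ t s', Exec P s t s' ∧ t ≤ m 2 * 10 + 5 ∧
      ∀ i < m 2, s'.mem i = S / 2 ^ i % 2 := by
  -- Register `6` receives the parity `x - 2 ⌊x / 2⌋` of what remains of `S`.
  let Q : Prog := .seq (.half 5 2) (.seq (.add 6 5 5) (.seq (.sub 6 2 6) (.seq (.store 4 6)
    (.seq (.half 2 2) (.seq (.const 7 1) (.seq (.add 4 4 7) (.sub 3 3 7)))))))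
  -- The number of vertices is loaded first, because the output overwrites the cell that contains
  -- it.
  refine ⟨.seq (.const 3 2) (.seq (.load 3 3) (.seq (.const 4 0) (.loop 3 Q))),
    fun s F S m hs => ?_⟩
  obtain ⟨t, s', he, ht, -, -, -, h4⟩ := Exec.loop_of_inv (x := 3) (n := m 2) (Q := Q) (τ := 8)
    (fun i s' => s'.reg 3 = m 2 - i ∧ s'.reg 4 = i ∧ s'.reg 2 = S / 2 ^ i ∧
      ∀ j < i, s'.mem j = S / 2 ^ j % 2) (fun i s' _ h => h.1) (by
    rintro i s' hi ⟨h1, h2, h3, h4⟩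
    refine ⟨_, _, Exec.seq (Exec.half _ _ _) (Exec.seq (Exec.add _ _ _ _) (Exec.seq (Exec.sub _ _ _ _)
      (Exec.seq (Exec.store _ _ _) (Exec.seq (Exec.half _ _ _) (Exec.seq (Exec.const _ _ _)
      (Exec.seq (Exec.add _ _ _ _) (Exec.sub _ _ _ _))))))), by norm_num, ?_, ?_, ?_, ?_⟩
    · simp [h1]; omega
    · simp [h2]
    · simp [h3, Nat.div_div_eq_div_mul, pow_succ]
    · intro j hj
      by_cases hji : j = i
      · simp [h2, h3, hji]; omega
      · simp [h2, hji, h4 j (by omega)]) (s := ((s.setReg 3 2).setReg 3 (m 2)).setReg 4 0)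
    ⟨by simp, by simp, by simp [hs.num], by simp⟩
  have hload : ((s.setReg 3 2).mem ((s.setReg 3 2).reg 3)) = m 2 := by simp [hs.mem]
  rw [← hload] at he
  exact ⟨_, s', Exec.seq (Exec.const _ _ _) (Exec.seq (Exec.load _ _ _)
    (Exec.seq (Exec.const _ _ _) he)), by omega, h4⟩

end Phases

/-! ### Choice of the loop bounds, and the whole program. -/

section Scheme

variable (m : ℕ → ℕ) (c : ℕ)

/-- An upper bound for the parameters of an instance -/
def param : ℕ := m 2 + m 1 + (c + 10)

/-- The number of bits of the input numbers -/
def bits : ℕ := Nat.size (8 + ∑ i ∈ Finset.range (5 + m 2 + 3 * (m 2 * m 2)), m i)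

/-- An upper bound for the parameters and the number of bits -/
def base : ℕ := param m c ^ 4 + bits m

/-- The loop bound for local search -/
def searchFuel : ℕ := base m c ^ ((c * m 1) ^ 2 + 10)

theorem param_bounds : m 2 ≤ param m c ^ 4 ∧ m 1 ≤ param m c ^ 4 ∧ c * m 1 ≤ param m c ^ 4 ∧
    (c * m 1) ^ 2 + 10 ≤ param m c ^ 4 ∧ 5 + m 2 + 3 * (m 2 * m 2) ≤ param m c ^ 4 ∧
    2 * m 2 + 1 ≤ param m c ^ 4 := by
  obtain ⟨a, ha⟩ : ∃ a, a = m 2 + m 1 + c := ⟨_, rfl⟩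
  have hp : param m c = a + 10 := by rw [param, ha]; ring
  have h1 : c * m 1 ≤ a * a := Nat.mul_le_mul (by omega) (by omega)
  have h2 : (c * m 1) ^ 2 ≤ (a * a) ^ 2 := Nat.pow_le_pow_left h1 2
  have h3 : m 2 * m 2 ≤ a * a := Nat.mul_le_mul (by omega) (by omega)
  have h4 : (a + 10) ^ 4 = (a * a) ^ 2 + 40 * (a * a * a) + 600 * (a * a) + 4000 * a + 10000 := by ring
  have h5 : m 2 ≤ a := by omega
  have h6 : m 1 ≤ a := by omega
  rw [hp, h4]
  generalize (a * a) ^ 2 = x at *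
  generalize a * a * a = y at *
  generalize a * a = z at *
  refine ⟨?_, ?_, ?_, ?_, ?_, ?_⟩ <;> omega

/-- The loop bound is bootstrapped. Additions need no loop, so `param` is computed with bound `0`;
two squarings reach a bound that suffices to sum the input. The bit length of that sum gives `base`,
and a power of it is the bound for local search. -/
theorem exists_prog : ∃ (P : Prog) (T₁ T₂ T₃ T₄ T₅ T₆ : Polynomial ℕ), ∀ m : ℕ → ℕ,
    ∃ t s', Exec P ⟨fun _ => 0, m⟩ t s' ∧
      t ≤ T₁.eval 0 + T₂.eval (param m c) + T₂.eval (param m c ^ 2) + T₃.eval (param m c ^ 4) +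
        3 * bits m + T₄.eval (param m c ^ 4) + T₅.eval (base m c) + T₆.eval (searchFuel m c) +
        m 2 * 10 + 10 ∧
      ∀ i < m 2, s'.mem i = localSearch (searchFuel m c) m c (width (searchFuel m c) m (bits m)) /
        2 ^ i % 2 := by
  obtain ⟨P₁, T₁, h₁⟩ := Comp.exists_refuel (Comp.order.add ((Comp.lit 1).cell.add (Comp.lit (c + 10))))
  obtain ⟨P₂, T₂, h₂⟩ := Comp.exists_refuel (Comp.fuel.mulSmall Comp.fuel)
  obtain ⟨P₃, T₃, h₃⟩ := Comp.exists_store ((Comp.lit 8).add (Comp.sumTo (((Comp.lit 5).add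
    Comp.order).add ((Comp.order.mulSmall Comp.order).add ((Comp.order.mulSmall Comp.order).add
      (Comp.order.mulSmall Comp.order)))) (f := fun (a : Root × ℕ) i => cell a i) Comp.var0.cell))
  obtain ⟨P₄, h₄⟩ := exec_size
  obtain ⟨P₅, T₅, h₅⟩ := Comp.exists_refuel (Comp.fuel.add Comp.var0)
  obtain ⟨P₆, T₆, h₆⟩ := Comp.exists_refuel (Comp.fuel.powSmall ((Comp.swapSize c).add (Comp.lit 10)))
  obtain ⟨P₇, T₇, h₇⟩ := Comp.exists_store (Comp.localSearch c (Comp.width Comp.var0))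
  obtain ⟨P₈, h₈⟩ := exec_output
  refine ⟨.seq P₁ (.seq P₂ (.seq P₂ (.seq P₃ (.seq P₄ (.seq P₅ (.seq P₆ (.seq P₇ P₈))))))),
    T₁, T₂, T₃, T₅, T₆, T₇, fun m => ?_⟩
  obtain ⟨b1, b2, b3, b4, b5, b6⟩ := param_bounds m c
  obtain ⟨t₁, s₁, e₁, l₁, i₁⟩ := h₁ ⟨fun _ => 0, m⟩ 0 0 m ⟨rfl, rfl, rfl⟩
  have v₁ : Shows s₁ (param m c) 0 m := by
    convert i₁ using 1
    simp only [param, cell, Ctx.root, id]; ring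
  obtain ⟨t₂, s₂, e₂, l₂, i₂⟩ := h₂ _ _ _ _ v₁
  have v₂ : Shows s₂ (param m c ^ 2) 0 m := by
    convert i₂ using 1
    rw [mulSmall_eq le_rfl, sq]; rfl
  obtain ⟨t₃, s₃, e₃, l₃, i₃⟩ := h₂ _ _ _ _ v₂
  have v₃ : Shows s₃ (param m c ^ 4) 0 m := by
    convert i₃ using 1
    rw [mulSmall_eq le_rfl]; simp only [fuel, Ctx.root, id]; ring
  obtain ⟨t₄, s₄, e₄, l₄, i₄⟩ := h₃ _ _ _ _ v₃
  have v₄ : Shows s₄ (param m c ^ 4) (8 + ∑ i ∈ Finset.range (5 + m 2 + 3 * (m 2 * m 2)), m i) m := by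
    convert i₄ using 1
    simp only [fuel, cell, Ctx.root, id]
    rw [mulSmall_eq b1, show 5 + m 2 + (m 2 * m 2 + (m 2 * m 2 + m 2 * m 2)) =
      5 + m 2 + 3 * (m 2 * m 2) by ring, sumTo_eq b5]
  obtain ⟨t₅, s₅, e₅, l₅, i₅⟩ := h₄ _ _ _ _ v₄
  obtain ⟨t₆, s₆, e₆, l₆, v₆⟩ := h₅ _ _ _ _ i₅
  obtain ⟨t₇, s₇, e₇, l₇, i₇⟩ := h₆ _ (base m c) (bits m) _ v₆
  have v₇ : Shows s₇ (searchFuel m c) (bits m) m := by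
    convert i₇ using 1
    change searchFuel m c = powSmall (base m c) (base m c) (swapSize (base m c) m c + 10)
    have hb : param m c ^ 4 ≤ base m c := Nat.le_add_right _ _
    rw [swapSize_eq rfl (b3.trans hb) (b2.trans hb), powSmall_eq le_rfl (b4.trans hb), searchFuel]
  obtain ⟨t₈, s₈, e₈, l₈, v₈⟩ := h₇ _ _ _ _ v₇
  obtain ⟨t₉, s₉, e₉, l₉, h₉⟩ := h₈ _ _ _ _ v₈
  refine ⟨_, s₉, Exec.seq e₁ (Exec.seq e₂ (Exec.seq e₃ (Exec.seq e₄ (Exec.seq e₅ (Exec.seq e₆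
    (Exec.seq e₇ (Exec.seq e₈ e₉))))))), ?_, h₉⟩
  change t₅ ≤ 3 * bits m + 5 at l₅
  omega

/-- The part `(c * q) ^ 2` of the exponent pays for the codes of swaps; everything else is at most
the sixth power of `base`, well within the extra `10`. -/
theorem enoughSwaps_searchFuel {q n : ℕ} (hq : m 1 = q) (hn : m 2 = n) :
    EnoughSwaps (searchFuel m c) (bits m * (n * n + 5)) n q c := by
  obtain ⟨b1, b2, b3, b4, b5, b6⟩ := param_bounds m c
  rw [hn] at b1 b5 b6
  rw [hq] at b2 b3 b4
  obtain ⟨s, hs⟩ : ∃ s, s = (c * q) ^ 2 := ⟨_, rfl⟩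
  obtain ⟨D, hD⟩ : ∃ D, D = base m c := ⟨_, rfl⟩
  have hF : searchFuel m c = D ^ (s + 10) := by rw [searchFuel, hD, hs, hq]
  have hDl : param m c ^ 4 + bits m = D := hD.symm
  rw [← hs] at b4
  have h10 : 10 ≤ D := by omega
  have hk : ∀ k ≤ s + 10, D ^ k ≤ searchFuel m c := fun k hk => by
    rw [hF]; exact Nat.pow_le_pow_right (by omega) hk
  have h1 : D ≤ searchFuel m c := by simpa using hk 1 (by omega)
  have h2 : D * D ≤ D ^ 10 := by
    rw [← sq]; exact Nat.pow_le_pow_right (by omega) (by norm_num)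
  have hW : bits m * (n * n + 5) + 8 * q + 1 ≤ D ^ 4 := by
    have : bits m * (n * n + 5) ≤ D * D := Nat.mul_le_mul (by omega) (by omega)
    have h3 : D * D * 10 ≤ D ^ 4 := by
      rw [show D ^ 4 = D * D * (D * D) by ring]
      exact Nat.mul_le_mul_left _ (by nlinarith)
    nlinarith
  refine ⟨⟨by omega, by omega, by omega, ?_, ?_⟩, by omega, by omega, by omega, ?_, ?_⟩
  · have := hk 4 (by omega); omega
  · calc _ ≤ D ^ 4 * D := Nat.mul_le_mul (by omega) (by omega)
      _ = D ^ 5 := by ring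
      _ ≤ _ := hk 5 (by omega)
  · rw [← hs]
    exact (Nat.pow_le_pow_left (by omega) s).trans (hk s (by omega))
  · calc _ ≤ D * D * D ^ 4 := Nat.mul_le_mul (Nat.mul_le_mul (by omega) (by omega)) (by omega)
      _ = D ^ 6 := by ring
      _ ≤ _ := hk 6 (by omega)

end Scheme

/-! ### Bit size of the input. -/

section Size

theorem size_add_le (a b : ℕ) : Nat.size (a + b) ≤ Nat.size a + Nat.size b := by
  rcases Nat.eq_zero_or_pos a with rfl | ha
  · simp
  rcases Nat.eq_zero_or_pos b with rfl | hb
  · simp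
  refine Nat.size_le.2 ?_
  have h1 := Nat.lt_size_self a
  have h2 := Nat.lt_size_self b
  rw [pow_add]
  nlinarith

theorem size_sum_le_bitSize (l : List ℕ) : Nat.size l.sum ≤ bitSize l := by
  induction l with
  | nil => simp
  | cons a l ih =>
    have h1 := size_add_le a l.sum
    have h2 : bitSize (a :: l) = Nat.size a + 1 + bitSize l := by simp [bitSize]
    rw [List.sum_cons]
    omega

theorem length_le_bitSize (l : List ℕ) : l.length ≤ bitSize l := by
  induction l with
  | nil => simp
  | cons a l ih =>
    have h2 : bitSize (a :: l) = Nat.size a + 1 + bitSize l := by simp [bitSize]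
    rw [List.length_cons]
    omega

theorem sum_getD (l : List ℕ) : ∑ i ∈ Finset.range l.length, l.getD i 0 = l.sum := by
  induction l with
  | nil => simp
  | cons a l ih =>
    rw [List.length_cons, Finset.sum_range_succ', List.sum_cons, ← ih]
    simp [add_comm]

theorem eval_mono (T : Polynomial ℕ) {a b : ℕ} (h : a ≤ b) : T.eval a ≤ T.eval b := by
  rw [Polynomial.eval_eq_sum_range, Polynomial.eval_eq_sum_range]
  gcongr

variable (ε : ℚ≥0) (I : Instance)

theorem bits_input : bits (inputMem ε I) = Nat.size (8 + (input ε I).sum) := by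
  rw [bits, inputMem_two, ← length_input ε I, ← sum_getD]
  rfl

theorem bits_input_le : bits (inputMem ε I) ≤ bitSize (input ε I) + 4 := by
  rw [bits_input]
  have h1 := size_add_le 8 (input ε I).sum
  have h2 := size_sum_le_bitSize (input ε I)
  have h3 : Nat.size 8 = 4 := by decide
  omega

theorem order_le_bitSize : I.n ≤ bitSize (input ε I) := by
  have h1 := length_le_bitSize (input ε I)
  rw [length_input] at h1
  omega

theorem inputMem_lt (i : ℕ) : inputMem ε I i < 2 ^ bits (inputMem ε I) := by
  rw [bits_input]
  refine lt_of_le_of_lt ?_ (Nat.lt_size_self _)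
  by_cases h : i < (input ε I).length
  · rw [inputMem, List.getD_eq_getElem _ _ h]
    exact (List.single_le_sum (by simp) _ (List.getElem_mem h)).trans (Nat.le_add_left _ _)
  · rw [inputMem, List.getD_eq_default _ _ (by omega)]
    exact Nat.zero_le _

theorem bounded_input (c : ℕ) :
    Bounded (searchFuel (inputMem ε I) c) (inputMem ε I) (bits (inputMem ε I)) := by
  have hE := enoughSwaps_searchFuel (inputMem ε I) c (inputMem_one ε I) (inputMem_two ε I)
  refine ⟨?_, inputMem_lt ε I, ?_, ?_, ?_⟩
  · rw [bits_input]
    exact Nat.size_pos.2 (by omega)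
  · have := hE.width
    nlinarith
  · rw [inputMem_two]; exact hE.order
  · rw [inputMem_two]; exact hE.square

end Size

/-! ### The approximation scheme. -/

section Main

theorem isMinor_of_hasCliqueMinor {n h : ℕ} {G : SimpleGraph (Fin n)} (H : SimpleGraph (Fin h))
    (hG : HasCliqueMinor G Finset.univ h) : IsMinor H G := by
  obtain ⟨C, hC, hC'⟩ := hG
  refine ⟨fun v => C v, fun v => (hC v v.2).2.induce_connected, fun u v huv => ?_, fun u v huv => ?_⟩
  · have := (hC' u u.2 v v.2 (fun h => huv (Fin.ext h))).1
    exact Finset.disjoint_coe.2 this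
  · obtain ⟨x, hx, y, hy, hxy⟩ := (hC' u u.2 v v.2 (fun h => huv.ne (Fin.ext h))).2
    exact ⟨x, hx, y, hy, hxy⟩

/-- The local optimum is nearly optimal. -/
theorem cost_localSearch_le {h c : ℕ} (hc : c = 384 * (h + 1) ^ 2) {ε : ℚ≥0} (hε : 0 < ε) (I : Instance)
    (hG : ¬ HasCliqueMinor I.graph Finset.univ h) {m : ℕ → ℕ} (hm : m = inputMem ε I)
    (O : Finset (Fin I.n)) :
    I.cost (setOfBits (searchFuel m c) I.n
      (localSearch (searchFuel m c) m c (width (searchFuel m c) m (bits m)))) ≤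
      (1 + ((ε : ℝ≥0) : ℝ≥0∞)) * I.cost O := by
  subst hm
  have h2 := inputMem_two ε I
  have hE := enoughSwaps_searchFuel (inputMem ε I) c (inputMem_one ε I) h2
  have hB := bounded_input ε I c
  have hW : width (searchFuel (inputMem ε I) c) (inputMem ε I) (bits (inputMem ε I)) =
      bits (inputMem ε I) * (I.n * I.n + 5) := by
    have h5 : I.n * I.n + 5 ≤ searchFuel (inputMem ε I) c := by
      have h6 := hE.width
      have h7 : 1 ≤ bits (inputMem ε I) := hB.pos
      nlinarith
    rw [width, h2, mulSmall_eq hE.order, mulSmall_eq h5]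
  have hcost := hB.cost_lt
  rw [h2] at hcost
  have hw := fun j => hB.weightInt_le j
  rw [h2] at hw
  rw [hW]
  exact cost_le_of_natCost_le ε I hB hε (by
    exact_mod_cast localSearch_spec hc (decodes_input ε I) (inputMem_one ε I) (NNRat.den_pos ε) hE hG
      (fun u v _ => hw _) hcost O)

/-- The program depends on `h` alone. Only the time bound depends on `ε`, because the exponent of
the loop bound contains `ε.den`. -/
theorem isPTAS_of_not_hasCliqueMinor {K : GraphFamily} {h : ℕ}
    (hK : ∀ n, ∀ G ∈ K n, ¬ HasCliqueMinor G Finset.univ h) : ∃ P, IsPTAS K P := by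
  obtain ⟨c, hc⟩ : ∃ c, c = 384 * (h + 1) ^ 2 := ⟨_, rfl⟩
  obtain ⟨P, T₁, T₂, T₃, T₄, T₅, T₆, hP⟩ := exists_prog c
  refine ⟨P, fun ε hε => ?_⟩
  let p : Polynomial ℕ := .X + .C (ε.den + (c + 10))
  let b : Polynomial ℕ := p ^ 4 + (.X + 4)
  refine ⟨.C (T₁.eval 0) + T₂.comp p + T₂.comp (p ^ 2) + T₃.comp (p ^ 4) + 3 * (.X + 4) +
    T₄.comp (p ^ 4) + T₅.comp b + T₆.comp (b ^ ((c * ε.den) ^ 2 + 10)) + .X * 10 + 10, fun I hI => ?_⟩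
  obtain ⟨t, s, he, ht, hs⟩ := hP (inputMem ε I)
  obtain ⟨N, hN⟩ : ∃ N, N = bitSize (input ε I) := ⟨_, rfl⟩
  have hn : I.n ≤ N := hN ▸ order_le_bitSize ε I
  have hbits : bits (inputMem ε I) ≤ N + 4 := hN ▸ bits_input_le ε I
  have hparam : param (inputMem ε I) c ≤ p.eval N := by
    simp only [param, inputMem_one, inputMem_two, p, Polynomial.eval_add, Polynomial.eval_X,
      Polynomial.eval_C]
    omega
  have hpow : ∀ k, param (inputMem ε I) c ^ k ≤ (p ^ k).eval N := fun k => by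
    rw [Polynomial.eval_pow]; exact Nat.pow_le_pow_left hparam k
  have hbase : base (inputMem ε I) c ≤ b.eval N := by
    simp only [b, Polynomial.eval_add, Polynomial.eval_X, Polynomial.eval_ofNat]
    exact Nat.add_le_add (hpow 4) hbits
  have hfuel : searchFuel (inputMem ε I) c ≤ (b ^ ((c * ε.den) ^ 2 + 10)).eval N := by
    rw [Polynomial.eval_pow, searchFuel, inputMem_one]
    exact Nat.pow_le_pow_left hbase _
  refine ⟨t, s, he, ht.trans ?_, fun O => ?_⟩
  · rw [← hN, inputMem_two]
    simp only [Polynomial.eval_add, Polynomial.eval_mul, Polynomial.eval_comp, Polynomial.eval_C,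
      Polynomial.eval_X, Polynomial.eval_ofNat]
    have h1 := eval_mono T₂ hparam
    have h2 := eval_mono T₂ (hpow 2)
    have h3 := eval_mono T₃ (hpow 4)
    have h4 := eval_mono T₄ (hpow 4)
    have h5 := eval_mono T₅ hbase
    have h6 := eval_mono T₆ hfuel
    omega
  · have hout : s.output I.n = setOfBits (searchFuel (inputMem ε I) c) I.n
        (localSearch (searchFuel (inputMem ε I) c) (inputMem ε I) c
          (width (searchFuel (inputMem ε I) c) (inputMem ε I) (bits (inputMem ε I)))) := by
      have hE := enoughSwaps_searchFuel (inputMem ε I) c (inputMem_one ε I) (inputMem_two ε I)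
      ext v
      have hv : (v : ℕ) ≤ searchFuel (inputMem ε I) c := v.2.le.trans hE.order
      rw [State.output, setOfBits, Finset.mem_filter, Finset.mem_filter,
        hs v (by rw [inputMem_two]; exact v.2), arrayGet_eq hE.pos hv (by omega), one_mul, pow_one]
    rw [hout]
    exact cost_localSearch_le hc hε I (hK _ _ hI) rfl O

end Main
end UFL

/-- For every nontrivial minor-closed family of graphs there is a polynomial-time approximation
scheme for uniform uncapacitated facility location in edge-weighted graphs of the family. -/
theorem mainTheorem8 (K : UFL.GraphFamily) (hclosed : K.MinorClosed) (hnontriv : K.Nontrivial) :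
    ∃ P : UFL.Prog, UFL.IsPTAS K P := by
  obtain ⟨h, H, hH⟩ := hnontriv
  exact UFL.isPTAS_of_not_hasCliqueMinor fun n G hG hminor =>
    hH (hclosed n h G H hG (UFL.isMinor_of_hasCliqueMinor H hminor))
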